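/- Let $\mathtt g\ge 2$ be an integer, $n=2\mathtt g+1$, $W=x_1^{n}+x_2^{n}+x_3^{n}-x_1x_2x_3\in\mathbb C[x_1,x_2,x_3]$ and $G=\{(\zeta,\zeta,\zeta^{-2})\mid \zeta^{n}=1\}\subset(\mathbb C^*)^3$, acting by rescaling the variables. **The space $X$.** Call finite sets $\Lambda_1,\Lambda_2,\Lambda_3\subset\mathbb C^*$ *suitable* if the configuration of hyperplanes $\{x_i=\lambda\}$, $\lambda\in\Lambda_i$, is $G$-stable and contains every critical point of $W$ other than the origin. For suitable sets let $X=\mathbb C^3\setminus\bigcup_{i,\,\lambda\in\Lambda_i}\{x_i=\lambda\}$, so that $\mathbb C[X]$ is the localization of $\mathbb C[x_1,x_2,x_3]$ at the elements $x_i-\lambda$, $\lambda\in\Lambda_i$. **The algebra $M^*(X,W,G)$.** For $g=(g_1,g_2,g_3)\in G$ let $I_g=\{i\mid g_i\ne1\}$, $d_g=|I_g|$, let $x^g$ be obtained from $x$ by setting $x_i=0$ for $i\in I_g$, and let $\mathbb C[X^g]=\mathbb C[X]/(x_i)_{i\in I_g}$, $W^g=W(x^g)$, $M(W^g)=\mathbb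 C[X^g]/(\partial_{x_i}W^g)_{i\notin I_g}$; let $\lfloor f\rfloor_g$ be the class in $M(W^g)$ of $f\in\mathbb C[X]$. Put $M^*(X,W,G)=\bigoplus_{g\in G}M(W^g)\,\xi_g$ with $\xi_g$ of degree $d_g$ mod $2$ and with the $G$-action given by $f\mapsto f(h(x))$ on $M(W^g)$ and by $h(\xi_g)=\prod_{i\in I_g}h_i^{-1}\,\xi_g$. Its product is $$(\lfloor f_1\rfloor_g\xi_g)\cup(\lfloor f_2\rfloor_h\xi_h)=\lfloor f_1f_2\rfloor_{gh}\,\sigma_{g,h}\,\xi_{gh}.$$ Here, with $d_{g,h}=(d_g+d_h-d_{gh})/2$, one sets $\sigma_{g,h}=0$ unless $d_{g,h}\in\mathbb Z_{\ge0}$, and otherwise $\sigma_{g,h}\in M(W^{gh})$ is the coefficient at $\partial_{\theta_{I_{gh}}}$ of $$\frac1{d_{g,h}!}\Upsilon\Big(\big(\lfloor H_W(x,g(x),x)\rfloor_{gh}+\lfloor H_{W,g}(x)\rfloor_{gh}\otimes1+1\otimes\lfloor H_{W,h}(g(x))\rfloor_{gh}\big)^{d_{g,h}}\otimes\partial_{\theta_{I_g}}\otimes\partial_{\theta_{I_h}}\Big),$$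 where $\theta_1,\theta_2,\theta_3$ and $\partial_{\theta_1},\partial_{\theta_2},\partial_{\theta_3}$ are odd generators of Grassmann algebras, $\partial_{\theta_I}$ is the product of the $\partial_{\theta_i}$, $i\in I$, in increasing order, $$\nabla_i^{x\to(x,y)}f=\frac{f(y_1,\dots,y_{i-1},x_i,\dots,x_3)-f(y_1,\dots,y_i,x_{i+1},\dots,x_3)}{x_i-y_i},$$ $$H_W(x,y,z)=\sum_{j\le i}\nabla_j^{y\to(y,z)}\nabla_i^{x\to(x,y)}(W)\,\theta_i\otimes\theta_j,\qquad H_{W,g}(x)=\sum_{i,j\in I_g,\,j<i}\tfrac1{1-g_j}\nabla_j^{x\to(x,x^g)}\nabla_i^{x\to(x,g(x))}(W)\,\theta_j\theta_i,$$ powers are taken in the graded tensor square of the Grassmann algebra in the $\theta_i$, and $\Upsilon(p_1\otimes p_2\otimes q_1\otimes q_2)=(-1)^{|q_1||p_2|}p_1(q_1)\cdot p_2(q_2)$, the $\theta_i$ acting on the algebra in the $\partial_{\theta_j}$ by the odd derivations with $\theta_i(\partial_{\theta_j})=\delta_{ij}$. **Proposition.** 1. Suitable sets exist: the sets $\Lambda_i$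 of all non-zero $i$-th coordinates of the critical points of $W$ other than the origin are finite and suitable. 2. For all suitable sets, the product $\cup$ is well defined and makes $M^*(X,W,G)$ into an associative $G$-equivariant algebra with unit $\xi_e$; and for every compact connected oriented surface $S$ of genus $\mathtt g$ there is an isomorphism of $\mathbb Z/2$-graded algebras $$M^*(X,W,G)^G\simeq H^*(S,\mathbb C).$$ (Here $S$ is given by a finite triangulation with ordered simplices, in the sense of $\Delta$-complexes, and $H^*(S,\mathbb C)$ is its simplicial cohomology with the cup product induced by the Alexander–Whitney formula.) 3. For all suitable sets, $\varphi=\lfloor x_1x_2x_3\rfloor_e\in M(W)$ is non-zero, and for every $\zeta\neq1$ with $\zeta^{n}=1$ and $\widehat\zeta=(\zeta,\zeta,\zeta^{-2})$ $$\sigma_{\widehat\zeta,\widehat\zeta^{-1}}=-\frac{1}{(1-\zeta)^2(1-\zeta^{-2})}\,\varphi,$$ where the denominator is non-zero. -/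

import Mathlib

open scoped TensorProduct

noncomputable section

namespace LG

/-! ### Difference derivatives -/

/-- The difference derivative `∇ᵢ f`, evaluated at a pair of points `(a, b)`:
`(f(b₁, …, bᵢ₋₁, aᵢ, …, a_N) - f(b₁, …, bᵢ, aᵢ₊₁, …, a_N)) / (aᵢ - bᵢ)`, given on monomials by
carrying out the division (see `sub_mul_diffDer`, which characterises it). -/
def diffDer {R A : Type*} [CommRing R] [CommRing A] [Algebra R A] {N : ℕ} (i : Fin N)
    (a b : Fin N → A) : MvPolynomial (Fin N) R →ₗ[R] A :=
  (MvPolynomial.basisMonomials (Fin N) R).constr R fun m =>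
    (∏ k ∈ Finset.univ.filter (fun k => k < i), b k ^ m k) *
      (∑ l ∈ Finset.range (m i), a i ^ l * b i ^ (m i - 1 - l)) *
      ∏ k ∈ Finset.univ.filter (fun k => i < k), a k ^ m k

/-- The point `(b₁, …, b_n, a_{n+1}, …, a_N)`, for which the first `n` coordinates are those
of `b`. -/
def mixedPoint {A : Type*} {N : ℕ} (n : ℕ) (a b : Fin N → A) : Fin N → A :=
  fun k => if (k : ℕ) < n then b k else a k

theorem sub_mul_diffDer {R A : Type*} [CommRing R] [CommRing A] [Algebra R A] {N : ℕ}
    (i : Fin N) (a b : Fin N → A) (f : MvPolynomial (Fin N) R) :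
    (a i - b i) * diffDer i a b f =
      MvPolynomial.aeval (mixedPoint (i : ℕ) a b) f
        - MvPolynomial.aeval (mixedPoint ((i : ℕ) + 1) a b) f := by
  have key : (LinearMap.mulLeft R (a i - b i)) ∘ₗ diffDer i a b =
      (MvPolynomial.aeval (mixedPoint (i : ℕ) a b)).toLinearMap
        - (MvPolynomial.aeval (mixedPoint ((i : ℕ) + 1) a b)).toLinearMap := by
    refine (MvPolynomial.basisMonomials (Fin N) R).ext fun m => ?_
    have hsplit : ∀ c : Fin N → A, ∏ k, c k ^ m k =
        (∏ k ∈ Finset.univ.filter (fun k => k < i), c k ^ m k) * c i ^ m i *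
          ∏ k ∈ Finset.univ.filter (fun k => i < k), c k ^ m k := by
      intro c
      have h1 : (Finset.univ : Finset (Fin N)) =
          (Finset.univ.filter (fun k => k < i) ∪ {i}) ∪
            Finset.univ.filter (fun k => i < k) := by
        ext k
        simp only [Finset.mem_univ, Finset.mem_union, Finset.mem_filter, true_and,
          Finset.mem_singleton, true_iff, or_assoc]
        exact lt_trichotomy k i
      have h2 : Disjoint (Finset.univ.filter (fun k => k < i) ∪ {i})
          (Finset.univ.filter (fun k => i < k)) := by
        rw [Finset.disjoint_left]
        intro k hk hk'
        simp only [Finset.mem_univ, Finset.mem_union, Finset.mem_filter, true_and,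
          Finset.mem_singleton] at hk hk'
        rcases hk with hk | hk
        · exact lt_asymm hk hk'
        · exact absurd hk' (by simp [hk])
      have h3 : Disjoint (Finset.univ.filter (fun k => k < i)) ({i} : Finset (Fin N)) := by
        simp
      conv_lhs => rw [h1]
      rw [Finset.prod_union h2, Finset.prod_union h3, Finset.prod_singleton]
    have hlt : ∀ n : ℕ, (n = i ∨ n = i + 1) →
        ∏ k ∈ Finset.univ.filter (fun k => k < i), mixedPoint n a b k ^ m k =
          ∏ k ∈ Finset.univ.filter (fun k => k < i), b k ^ m k := by
      intro n hn
      refine Finset.prod_congr rfl fun k hk => ?_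
      have hk' : (k : ℕ) < i := by simpa using hk
      have : (k : ℕ) < n := by omega
      simp [mixedPoint, this]
    have hgt : ∀ n : ℕ, (n = i ∨ n = i + 1) →
        ∏ k ∈ Finset.univ.filter (fun k => i < k), mixedPoint n a b k ^ m k =
          ∏ k ∈ Finset.univ.filter (fun k => i < k), a k ^ m k := by
      intro n hn
      refine Finset.prod_congr rfl fun k hk => ?_
      have hk' : (i : ℕ) < k := by simpa using hk
      have : ¬ (k : ℕ) < n := by omega
      simp [mixedPoint, this]
    have hb : MvPolynomial.basisMonomials (Fin N) R m = MvPolynomial.monomial m 1 := by simp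
    have hg := (Commute.all (a i) (b i)).geom_sum₂_mul (m i)
    simp only [LinearMap.comp_apply, LinearMap.mulLeft_apply, LinearMap.sub_apply,
      AlgHom.toLinearMap_apply, diffDer, Module.Basis.constr_basis]
    simp only [hb, MvPolynomial.aeval_monomial, map_one, one_mul]
    rw [Finsupp.prod_fintype _ _ (by simp), Finsupp.prod_fintype _ _ (by simp),
      hsplit, hsplit, hlt _ (Or.inl rfl), hlt _ (Or.inr rfl), hgt _ (Or.inl rfl),
      hgt _ (Or.inr rfl)]
    have e1 : mixedPoint (i : ℕ) a b i = a i := by simp [mixedPoint]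
    have e2 : mixedPoint ((i : ℕ) + 1) a b i = b i := by simp [mixedPoint]
    rw [e1, e2]
    linear_combination
      (∏ k ∈ Finset.univ.filter (fun k => k < i), b k ^ m k) *
        (∏ k ∈ Finset.univ.filter (fun k => i < k), a k ^ m k) * hg
  have := LinearMap.congr_fun key f
  simpa using this

/-- `∇ⱼ^{y → (y,z)} ∇ᵢ^{x → (x,y)} W`, evaluated at `(x, y, z) = (a, b, c)`. -/
def diffDer₂ {R A : Type*} [CommRing R] [CommRing A] [Algebra R A] {N : ℕ} (j i : Fin N)
    (a b c : Fin N → A) (W : MvPolynomial (Fin N) R) : A :=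
  diffDer j b c
    (diffDer i (fun k => (MvPolynomial.C (a k) : MvPolynomial (Fin N) A)) MvPolynomial.X W)

/-! ### Exterior algebras and the map `Υ` -/

/-- The Grassmann algebra on `N` odd generators; it serves both as the algebra in the `θᵢ` and
as the algebra in the `∂_{θᵢ}`. -/
abbrev Grass (N : ℕ) (B : Type*) [CommRing B] : Type _ := ExteriorAlgebra B (Fin N → B)

/-- The `i`-th generator. -/
def gen {N : ℕ} {B : Type*} [CommRing B] (i : Fin N) : Grass N B :=
  ExteriorAlgebra.ι B (Pi.single i 1)

/-- The basis of monomials, indexed by subsets `I` of `{1, …, N}`, the generators being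
multiplied in increasing order. -/
def monomialBasis (N : ℕ) (B : Type*) [CommRing B] :
    Module.Basis (Finset (Fin N)) B (Grass N B) :=
  (Pi.basisFun B (Fin N)).ExteriorAlgebra

/-- The coefficient at the monomial indexed by `I`. -/
def monomialCoeff {N : ℕ} {B : Type*} [CommRing B] (I : Finset (Fin N)) : Grass N B →ₗ[B] B :=
  (monomialBasis N B).coord I

/-- The action of the algebra in the `θᵢ` on the algebra in the `∂_{θᵢ}` that comes from the
Clifford algebra: `θᵢ` acts by the contraction (left odd derivation) with
`θᵢ (∂_{θⱼ}) = δᵢⱼ`. -/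
def thetaAct (N : ℕ) (B : Type*) [CommRing B] :
    Grass N B →ₐ[B] Module.End B (Grass N B) :=
  ExteriorAlgebra.lift B
    ⟨LinearMap.comp (R₁ := B) (R₂ := B) (R₃ := B) (M₁ := Fin N → B)
        (M₂ := Module.Dual B (Fin N → B)) (M₃ := Module.End B (Grass N B))
        (CliffordAlgebra.contractLeft (Q := (0 : QuadraticForm B (Fin N → B))))
        (Pi.basisFun B (Fin N)).toDual,
      fun v => LinearMap.ext fun x =>
        CliffordAlgebra.contractLeft_contractLeft ((Pi.basisFun B (Fin N)).toDual v) x⟩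

/-- The grading of the Grassmann algebra; the degrees in the `θᵢ` are minus these, which gives
the same signs. -/
abbrev grassGrading (N : ℕ) (B : Type*) [CommRing B] : ℕ → Submodule B (Grass N B) :=
  fun n => ⋀[B]^n (Fin N → B)

/-- The tensor square of the Grassmann algebra with the multiplication
`(a ⊗ b)(c ⊗ d) = (-1)^{|b||c|} ac ⊗ bd`. -/
abbrev GrassSq (N : ℕ) (B : Type*) [CommRing B] : Type _ :=
  GradedTensorProduct B (grassGrading N B) (grassGrading N B)

/-- The pure tensor `a ⊗ b`. -/
def ten {N : ℕ} {B : Type*} [CommRing B] (a b : Grass N B) : GrassSq N B :=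
  GradedTensorProduct.tmul B a b

/-- `p₁ ⊗ p₂ ↦ (-1)^{d |p₂|} p₁(q₁) · p₂(q₂)`, where `q₁` is homogeneous of degree `d`; the sign
is produced by applying `d` times the involution that is `-1` on the generators. -/
def upsilon {N : ℕ} {B : Type*} [CommRing B] (d : ℕ) (q₁ q₂ : Grass N B) :
    GrassSq N B →ₗ[B] Grass N B :=
  (TensorProduct.lift
    ((LinearMap.mul B (Grass N B)).compl₁₂
      ((LinearMap.applyₗ q₁) ∘ₗ (thetaAct N B).toLinearMap)
      ((LinearMap.applyₗ q₂) ∘ₗ (thetaAct N B).toLinearMap ∘ₗ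
        ((CliffordAlgebra.involute
          (Q := (0 : QuadraticForm B (Fin N → B)))).toLinearMap ^ d)))) ∘ₗ
    (GradedTensorProduct.of B (grassGrading N B) (grassGrading N B)).symm.toLinearMap

/-! ### Landau–Ginzburg orbifolds -/

/-- The rescaling `x ↦ (g₁x₁, …, g_Nx_N)`, acting on polynomials by `f ↦ f(g(x))`. -/
def rescale {K : Type*} [Field K] {N : ℕ} (g : Fin N → Kˣ) :
    MvPolynomial (Fin N) K →ₐ[K] MvPolynomial (Fin N) K :=
  MvPolynomial.aeval fun i => MvPolynomial.C (g i : K) * MvPolynomial.X i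

/-- `I_g = {i | gᵢ ≠ 1}`. -/
def movedIdx {K : Type*} [Field K] {N : ℕ} (g : Fin N → Kˣ) : Finset (Fin N) := by
  classical exact Finset.univ.filter fun i => g i ≠ 1

/-- `d_g = |I_g|`. -/
def codim {K : Type*} [Field K] {N : ℕ} (g : Fin N → Kˣ) : ℕ := (movedIdx g).card

/-- The point `x^g`: `xᵢ` for `gᵢ = 1` and `0` for `gᵢ ≠ 1`. -/
def fixedPoint {K : Type*} [Field K] {N : ℕ} (g : Fin N → Kˣ) (i : Fin N) :
    MvPolynomial (Fin N) K := by
  classical exact if i ∈ movedIdx g then 0 else MvPolynomial.X i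

/-- `f ↦ f(x^g)`, the restriction to the fixed locus, as a polynomial in the fixed variables. -/
def restrict {K : Type*} [Field K] {N : ℕ} (g : Fin N → Kˣ) :
    MvPolynomial (Fin N) K →ₐ[K] MvPolynomial (Fin N) K :=
  MvPolynomial.aeval (fixedPoint g)

/-- The coefficient of `θⱼ θᵢ` (`j < i` in `I_g`) in `H_{W,g}(x)`. -/
def twistCoeff {K : Type*} [Field K] {N : ℕ} (W : MvPolynomial (Fin N) K) (g : Fin N → Kˣ)
    (j i : Fin N) : MvPolynomial (Fin N) K :=
  MvPolynomial.C (1 - (g j : K))⁻¹ *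
    diffDer j MvPolynomial.X (fixedPoint g)
      (diffDer i MvPolynomial.X (fun k => rescale g (MvPolynomial.X k)) W :
        MvPolynomial (Fin N) K)

/-- A triple `(X, W, G)`: `X` is the affine space with the hyperplanes `xᵢ = c`, `c ∈ pts i`,
removed, `W` is a polynomial on it and `G` is a group of rescalings of the variables that
preserves `X` and `W`. -/
structure Orbifold (K : Type*) [Field K] (N : ℕ) where
  W : MvPolynomial (Fin N) K
  pts : Fin N → Finset K
  G : Subgroup (Fin N → Kˣ)
  ne_zero : ∀ i, ∀ c ∈ pts i, c ≠ 0
  stable : ∀ g ∈ G, ∀ i, ∀ c ∈ pts i, (g i : K) * c ∈ pts i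
  invariant : ∀ g ∈ G, rescale g W = W

namespace Orbifold

variable {K : Type*} [Field K] {N : ℕ} (P : Orbifold K N)

/-- The multiplicative set generated by the `xᵢ - c`, `c ∈ pts i`. -/
def denoms : Submonoid (MvPolynomial (Fin N) K) :=
  Submonoid.closure {p | ∃ i, ∃ c ∈ P.pts i, p = MvPolynomial.X i - MvPolynomial.C c}

/-- The algebra `K[X]` of regular functions. -/
abbrev Reg : Type _ := Localization P.denoms

/-- The kernel of `K[X] → M(W^g)`: it is generated by the `xᵢ`, `i ∈ I_g`, which cut out
`K[X^g]`, and by the partial derivatives of `W^g` in the remaining variables. -/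
def milnorIdeal (g : Fin N → Kˣ) : Ideal P.Reg :=
  Ideal.span
    ({r | ∃ i ∈ movedIdx g, r = algebraMap (MvPolynomial (Fin N) K) P.Reg (MvPolynomial.X i)} ∪
     {r | ∃ i ∉ movedIdx g, r = algebraMap (MvPolynomial (Fin N) K) P.Reg
        (MvPolynomial.pderiv i (restrict g P.W))})

/-- The Milnor algebra `M(W^g) = K[X^g] / (∂_{xᵢ} W^g)`. -/
abbrev Milnor (g : Fin N → Kˣ) : Type _ := P.Reg ⧸ P.milnorIdeal g

/-- The class of a regular function in `M(W^g)`. -/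
def cls (g : Fin N → Kˣ) : P.Reg →ₐ[K] P.Milnor g := Ideal.Quotient.mkₐ K (P.milnorIdeal g)

/-- The class of a polynomial in `M(W^g)`. -/
def polyCls (g : Fin N → Kˣ) (f : MvPolynomial (Fin N) K) : P.Milnor g :=
  P.cls g (algebraMap (MvPolynomial (Fin N) K) P.Reg f)

/-- The element `⌊H_W(x, g(x), x)⌋ + ⌊H_{W,g}(x)⌋ ⊗ 1 + 1 ⊗ ⌊H_{W,h}(g(x))⌋` with coefficients in
`M(W^{gh})`. -/
def structureElement (g h : Fin N → Kˣ) : GrassSq N (P.Milnor (g * h)) :=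
  (∑ i, ∑ j ∈ Finset.univ.filter (fun j => j ≤ i),
      P.polyCls (g * h)
        (diffDer₂ j i MvPolynomial.X (fun k => rescale g (MvPolynomial.X k)) MvPolynomial.X P.W) •
        ten (gen i) (gen j)) +
    ten (∑ i ∈ movedIdx g, ∑ j ∈ (movedIdx g).filter (fun j => j < i),
      P.polyCls (g * h) (twistCoeff P.W g j i) • (gen j * gen i)) 1 +
    ten 1 (∑ i ∈ movedIdx h, ∑ j ∈ (movedIdx h).filter (fun j => j < i),
      P.polyCls (g * h) (rescale g (twistCoeff P.W h j i)) • (gen j * gen i))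

/-- `d_{g,h} = (d_g + d_h - d_{gh}) / 2`, when this is a non-negative integer. -/
def halfExcess (g h : Fin N → Kˣ) : ℕ := (codim g + codim h - codim (g * h)) / 2

/-- The structure constant `σ_{g,h} ∈ M(W^{gh})`; it is zero unless
`(d_g + d_h - d_{gh}) / 2` is a non-negative integer. -/
def sigma (g h : Fin N → Kˣ) : P.Milnor (g * h) := by
  classical
  exact
    if codim (g * h) ≤ codim g + codim h ∧ Even (codim g + codim h - codim (g * h)) then
      ((halfExcess g h).factorial : K)⁻¹ •
        monomialCoeff (movedIdx (g * h))
          (upsilon (codim g)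
            (monomialBasis N (P.Milnor (g * h)) (movedIdx g))
            (monomialBasis N (P.Milnor (g * h)) (movedIdx h))
            (P.structureElement g h ^ halfExcess g h))
    else 0

/-- The space `M^*(X, W, G) = ⨁_g M(W^g) ξ_g`. -/
abbrev Total : Type _ := DirectSum P.G fun g => P.Milnor (g : Fin N → Kˣ)

/-- `v ↦ v ξ_g`. -/
def sector (g : P.G) : P.Milnor (g : Fin N → Kˣ) →ₗ[K] P.Total := by
  classical exact DirectSum.lof K P.G (fun g => P.Milnor (g : Fin N → Kˣ)) g

/-- The elements of even degree, `ξ_g` having degree `d_g`. -/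
def even : Submodule K P.Total :=
  ⨅ g : {g : P.G // ¬ Even (codim (g : Fin N → Kˣ))},
    LinearMap.ker (DirectSum.component K P.G (fun g => P.Milnor (g : Fin N → Kˣ)) g.1)

/-- The elements of odd degree, `ξ_g` having degree `d_g`. -/
def odd : Submodule K P.Total :=
  ⨅ g : {g : P.G // Even (codim (g : Fin N → Kˣ))},
    LinearMap.ker (DirectSum.component K P.G (fun g => P.Milnor (g : Fin N → Kˣ)) g.1)

/-- `cup` is the product `(⌊f₁⌋ ξ_g) ∪ (⌊f₂⌋ ξ_h) = ⌊f₁ f₂⌋ σ_{g,h} ξ_{gh}`. -/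
def IsCup (cup : P.Total →ₗ[K] P.Total →ₗ[K] P.Total) : Prop :=
  ∀ (g h : P.G) (f₁ f₂ : P.Reg),
    cup (P.sector g (P.cls g f₁)) (P.sector h (P.cls h f₂)) =
      P.sector (g * h) (P.cls ((g * h : P.G) : Fin N → Kˣ) (f₁ * f₂) *
        P.sigma (g : Fin N → Kˣ) (h : Fin N → Kˣ))

/-- The unit `ξ_e`. -/
def unit : P.Total := P.sector 1 1

/-! #### The group action -/

theorem isUnit_rescale (h : P.G) (s : P.denoms) :
    IsUnit (((Algebra.ofId (MvPolynomial (Fin N) K) P.Reg).restrictScalars K).comp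
      (rescale (h : Fin N → Kˣ)) s) := by
  obtain ⟨s, hs⟩ := s
  induction hs using Submonoid.closure_induction with
  | mem x hx =>
    obtain ⟨i, c, hc, rfl⟩ := hx
    have hc' := P.stable _ (P.G.inv_mem h.2) i c hc
    have e : rescale (h : Fin N → Kˣ) (MvPolynomial.X i - MvPolynomial.C c) =
        MvPolynomial.C (((h : Fin N → Kˣ) i : Kˣ) : K) *
          (MvPolynomial.X i -
            MvPolynomial.C (((((h : Fin N → Kˣ)⁻¹) i : Kˣ) : K) * c)) := by
      rw [mul_sub, ← MvPolynomial.C_mul]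
      simp [rescale]
    simp only [AlgHom.comp_apply, e]
    rw [map_mul]
    refine IsUnit.mul ?_ ?_
    · refine ((Units.isUnit ((h : Fin N → Kˣ) i)).map MvPolynomial.C).map _
    · exact IsLocalization.map_units P.Reg
        (⟨_, Submonoid.subset_closure ⟨i, _, hc', rfl⟩⟩ : P.denoms)
  | one => simp
  | mul x y _ _ hx hy =>
    simp only [map_mul] at hx hy ⊢
    exact hx.mul hy

/-- The action `f ↦ f(h(x))` of `h` on `K[X]`. -/
def actReg (h : P.G) : P.Reg →ₐ[K] P.Reg :=
  IsLocalization.liftAlgHom (M := P.denoms)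
    (f := ((Algebra.ofId (MvPolynomial (Fin N) K) P.Reg).restrictScalars K).comp
      (rescale (h : Fin N → Kˣ))) (P.isUnit_rescale h)

theorem actReg_algebraMap (h : P.G) (f : MvPolynomial (Fin N) K) :
    P.actReg h (algebraMap _ P.Reg f) = algebraMap _ P.Reg (rescale (h : Fin N → Kˣ) f) := by
  simp [actReg, Algebra.ofId_apply]

theorem _root_.LG.pderiv_rescale {K : Type*} [Field K] {N : ℕ} (h : Fin N → Kˣ) (i : Fin N)
    (f : MvPolynomial (Fin N) K) :
    MvPolynomial.pderiv i (rescale h f) =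
      MvPolynomial.C (h i : K) * rescale h (MvPolynomial.pderiv i f) := by
  induction f using MvPolynomial.induction_on with
  | C a => simp [rescale]
  | add p q hp hq => simp only [map_add, hp, hq, mul_add]
  | mul_X p j hp =>
    have e : rescale h (MvPolynomial.X j : MvPolynomial (Fin N) K) =
        MvPolynomial.C (h j : K) * MvPolynomial.X j := by simp [rescale]
    simp only [map_mul, Derivation.leibniz, map_add, smul_eq_mul, hp, e,
      MvPolynomial.pderiv_C, MvPolynomial.pderiv_X]
    by_cases hij : i = j
    · subst hij
      simp
      ring
    · simp [Pi.single_eq_of_ne (Ne.symm hij)]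
      ring

theorem _root_.LG.rescale_restrict {K : Type*} [Field K] {N : ℕ} (h g : Fin N → Kˣ)
    (f : MvPolynomial (Fin N) K) :
    rescale h (restrict g f) = restrict g (rescale h f) := by
  have : (rescale h).comp (restrict g) = (restrict g).comp (rescale h) := by
    refine MvPolynomial.algHom_ext fun i => ?_
    by_cases hi : i ∈ movedIdx g <;> simp [rescale, restrict, fixedPoint, hi]
  exact AlgHom.congr_fun this f

theorem milnorIdeal_le (h : P.G) (g : Fin N → Kˣ) :
    P.milnorIdeal g ≤ (P.milnorIdeal g).comap (P.actReg h) := by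
  rw [milnorIdeal, Ideal.span_le]
  rintro r (⟨i, hi, rfl⟩ | ⟨i, hi, rfl⟩)
  · simp only [SetLike.mem_coe, Ideal.mem_comap, actReg_algebraMap]
    have e : rescale (h : Fin N → Kˣ) (MvPolynomial.X i : MvPolynomial (Fin N) K) =
        MvPolynomial.C (((h : Fin N → Kˣ) i : Kˣ) : K) * MvPolynomial.X i := by simp [rescale]
    rw [e, map_mul]
    exact Ideal.mul_mem_left _ _ (Ideal.subset_span (Or.inl ⟨i, hi, rfl⟩))
  · simp only [SetLike.mem_coe, Ideal.mem_comap, actReg_algebraMap]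
    have e := pderiv_rescale (h : Fin N → Kˣ) i (restrict g P.W)
    rw [rescale_restrict, P.invariant _ h.2] at e
    have e' : rescale (h : Fin N → Kˣ) (MvPolynomial.pderiv i (restrict g P.W)) =
        MvPolynomial.C ((((h : Fin N → Kˣ) i)⁻¹ : Kˣ) : K) *
          MvPolynomial.pderiv i (restrict g P.W) := by
      conv_rhs => rw [e]
      rw [← mul_assoc, ← MvPolynomial.C_mul]
      simp
    rw [e', map_mul]
    exact Ideal.mul_mem_left _ _ (Ideal.subset_span (Or.inr ⟨i, hi, rfl⟩))

/-- The action of `h` on `M(W^g)`. -/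
def actMilnor (h : P.G) (g : Fin N → Kˣ) : P.Milnor g →ₐ[K] P.Milnor g :=
  Ideal.quotientMapₐ _ (P.actReg h) (P.milnorIdeal_le h g)

/-- The action of `h` on `M^*(X, W, G)`, with `h(ξ_g) = (∏_{i ∈ I_g} hᵢ⁻¹) ξ_g`. -/
def act (h : P.G) : P.Total →ₗ[K] P.Total :=
  DirectSum.lmap fun g : P.G =>
    (∏ i ∈ movedIdx (g : Fin N → Kˣ), (((h : Fin N → Kˣ) i : Kˣ) : K)⁻¹) •
      (P.actMilnor h (g : Fin N → Kˣ)).toLinearMap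

/-- The invariants `M^*(X, W, G)^G`. -/
def invariants : Submodule K P.Total :=
  ⨅ h : P.G, LinearMap.eqLocus (P.act h) LinearMap.id

/-- `cup` is the product of `M^*(X, W, G)`, which is a well-defined, associative, `G`-equivariant
product with unit `ξ_e`. -/
structure IsAlgebra (cup : P.Total →ₗ[K] P.Total →ₗ[K] P.Total) : Prop where
  isCup : P.IsCup cup
  assoc : ∀ x y z, cup (cup x y) z = cup x (cup y z)
  unit_left : ∀ x, cup P.unit x = x
  unit_right : ∀ x, cup x P.unit = x
  equivariant : ∀ h x y, P.act h (cup x y) = cup (P.act h x) (P.act h y)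
  unit_invariant : P.unit ∈ P.invariants
  cup_invariant : ∀ x ∈ P.invariants, ∀ y ∈ P.invariants, cup x y ∈ P.invariants

end Orbifold

/-! ### The Landau–Ginzburg models of the proposition -/

/-- `x₁^{2g+1} + x₂^{2g+1} + x₃^{2g+1} - x₁x₂x₃`. -/
def cuspW (g : ℕ) : MvPolynomial (Fin 3) ℂ :=
  MvPolynomial.X 0 ^ (2 * g + 1) + MvPolynomial.X 1 ^ (2 * g + 1) +
    MvPolynomial.X 2 ^ (2 * g + 1) - MvPolynomial.X 0 * MvPolynomial.X 1 * MvPolynomial.X 2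

/-- The rescaling `(ζ, ζ, ζ⁻²)`. -/
def cuspHom : ℂˣ →* (Fin 3 → ℂˣ) where
  toFun ζ := ![ζ, ζ, ζ⁻¹ ^ 2]
  map_one' := by ext i; fin_cases i <;> simp
  map_mul' a b := by ext i; fin_cases i <;> simp [mul_pow, mul_comm]

/-- The group of all `(ζ, ζ, ζ⁻²)` with `ζ^{2g+1} = 1`. -/
def cuspGroup (g : ℕ) : Subgroup (Fin 3 → ℂˣ) := (rootsOfUnity (2 * g + 1) ℂ).map cuspHom

/-- The critical points of `cuspW g` other than the origin. -/
def redundantPoints (g : ℕ) : Set (Fin 3 → ℂ) :=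
  {p | p ≠ 0 ∧ ∀ i, MvPolynomial.eval p (MvPolynomial.pderiv i (cuspW g)) = 0}

/-- The hyperplanes `xᵢ = c`, `c ∈ pts i`, avoid the origin, form a configuration that is stable
under the group, and contain all critical points other than the origin. -/
structure IsSuitable (g : ℕ) (pts : Fin 3 → Finset ℂ) : Prop where
  ne_zero : ∀ i, ∀ c ∈ pts i, c ≠ 0
  stable : ∀ h ∈ cuspGroup g, ∀ i, ∀ c ∈ pts i, (h i : ℂ) * c ∈ pts i
  removes : ∀ p ∈ redundantPoints g, ∃ i, p i ∈ pts i

theorem cuspW_invariant (g : ℕ) (h : Fin 3 → ℂˣ) (hh : h ∈ cuspGroup g) :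
    rescale h (cuspW g) = cuspW g := by
  obtain ⟨ζ, hζ, rfl⟩ := hh
  have hζ' : ζ ^ (2 * g + 1) = 1 := by simpa using hζ
  have h1 : (ζ : ℂ) ^ (2 * g + 1) = 1 := by
    simpa using congrArg Units.val hζ'
  have h2 : ((ζ : ℂ)⁻¹ ^ 2) ^ (2 * g + 1) = 1 := by
    rw [← pow_mul, mul_comm, pow_mul, inv_pow, h1]; simp
  have h0 : (ζ : ℂ) ≠ 0 := ζ.ne_zero
  have h3 : (ζ : ℂ) * ζ * (ζ : ℂ)⁻¹ ^ 2 = 1 := by field_simp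
  simp only [rescale, cuspW, cuspHom, map_sub, map_add, map_mul, map_pow, MvPolynomial.aeval_X,
    MonoidHom.coe_mk, OneHom.coe_mk, Matrix.cons_val_zero, Matrix.cons_val_one, Matrix.cons_val,
    mul_pow, Units.val_pow_eq_pow_val, Units.val_inv_eq_inv_val]
  simp only [← MvPolynomial.C_pow, h1, h2, MvPolynomial.C_1, one_mul]
  have : (MvPolynomial.C (ζ : ℂ) * MvPolynomial.X 0 * (MvPolynomial.C (ζ : ℂ) * MvPolynomial.X 1) *
      (MvPolynomial.C ((ζ : ℂ)⁻¹ ^ 2) * MvPolynomial.X 2) : MvPolynomial (Fin 3) ℂ) =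
      MvPolynomial.C ((ζ : ℂ) * ζ * (ζ : ℂ)⁻¹ ^ 2) *
        (MvPolynomial.X 0 * MvPolynomial.X 1 * MvPolynomial.X 2) := by
    simp only [MvPolynomial.C_mul]
    ring
  rw [this, h3]
  simp

/-- The triple `(X, W, G)`, where `X` is the complement of the hyperplanes given by `pts`. -/
def cusp (g : ℕ) (pts : Fin 3 → Finset ℂ) (h : IsSuitable g pts) : Orbifold ℂ 3 where
  W := cuspW g
  pts := pts
  G := cuspGroup g
  ne_zero := h.ne_zero
  stable := h.stable
  invariant := cuspW_invariant g

/-! ### Triangulated surfaces and their cohomology -/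

/-- A finite two-dimensional complex of ordered simplices: vertices `V`, edges `E` with endpoints
`ends e 0`, `ends e 1` (in this order), triangles `T` with vertices `corner t 0`, `corner t 1`,
`corner t 2` (in this order) and with `side t i` the edge opposite to the `i`-th vertex. -/
structure Complex₂ where
  V : Type
  E : Type
  T : Type
  [fintypeV : Fintype V]
  [fintypeE : Fintype E]
  [fintypeT : Fintype T]
  ends : E → Fin 2 → V
  side : T → Fin 3 → E
  corner : T → Fin 3 → V
  ends_side : ∀ t i p, ends (side t i) p = corner t (i.succAbove p)

namespace Complex₂

attribute [instance] fintypeV fintypeE fintypeT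

variable (S : Complex₂)

/-- Two corners of triangles are neighbours if they lie at the same end of a common edge. -/
def Neighbours (c c' : S.T × Fin 3) : Prop :=
  ∃ (i i' : Fin 3) (p : Fin 2), S.side c.1 i = S.side c'.1 i' ∧
    i.succAbove p = c.2 ∧ i'.succAbove p = c'.2

/-- The complex triangulates a closed connected surface: each edge is a side of exactly two
triangles (counted with multiplicity), the link of each vertex is non-empty and connected, hence
a circle, and the complex is non-empty and connected. -/
structure IsClosedSurface : Prop where
  two_sides : ∀ e, Nat.card {c : S.T × Fin 3 // S.side c.1 c.2 = e} = 2
  link_nonempty : ∀ v, ∃ t k, S.corner t k = v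
  link_connected : ∀ t k t' k', S.corner t k = S.corner t' k' →
    Relation.EqvGen S.Neighbours (t, k) (t', k')
  nonempty : Nonempty S.V
  connected : ∀ v w, Relation.EqvGen (fun a b => ∃ e, S.ends e 0 = a ∧ S.ends e 1 = b) v w

/-- `o` is an orientation: the triangles, taken with the signs `o`, induce opposite orientations
on the two sides that are glued along any edge. -/
def IsOrientation (o : S.T → ℤˣ) : Prop := by
  classical exact
    ∀ e, ∑ c ∈ Finset.univ.filter (fun c : S.T × Fin 3 => S.side c.1 c.2 = e),
      (o c.1 : ℤ) * (-1) ^ (c.2 : ℕ) = 0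

/-- The genus is `g`: the Euler characteristic is `2 - 2g`. -/
def HasGenus (g : ℕ) : Prop :=
  (Fintype.card S.V : ℤ) - Fintype.card S.E + Fintype.card S.T = 2 - 2 * (g : ℤ)

/-- The simplicial cochains with complex coefficients, in degrees `0`, `1` and `2`. -/
@[ext] structure Cochain where
  c0 : S.V → ℂ
  c1 : S.E → ℂ
  c2 : S.T → ℂ

namespace Cochain

variable {S}

instance : Zero S.Cochain := ⟨⟨0, 0, 0⟩⟩
instance : Add S.Cochain := ⟨fun a b => ⟨a.c0 + b.c0, a.c1 + b.c1, a.c2 + b.c2⟩⟩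
instance : Neg S.Cochain := ⟨fun a => ⟨-a.c0, -a.c1, -a.c2⟩⟩
instance : SMul ℂ S.Cochain := ⟨fun r a => ⟨r • a.c0, r • a.c1, r • a.c2⟩⟩
instance : One S.Cochain := ⟨⟨1, 0, 0⟩⟩

/-- The (Alexander–Whitney) cup product of cochains: front face times back face. -/
instance : Mul S.Cochain := ⟨fun a b =>
  ⟨fun v => a.c0 v * b.c0 v,
   fun e => a.c0 (S.ends e 0) * b.c1 e + a.c1 e * b.c0 (S.ends e 1),
   fun t => a.c0 (S.corner t 0) * b.c2 t + a.c1 (S.side t 2) * b.c1 (S.side t 0) +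
     a.c2 t * b.c0 (S.corner t 2)⟩⟩

@[simp] theorem zero_c0 : (0 : S.Cochain).c0 = 0 := rfl
@[simp] theorem zero_c1 : (0 : S.Cochain).c1 = 0 := rfl
@[simp] theorem zero_c2 : (0 : S.Cochain).c2 = 0 := rfl
@[simp] theorem one_c0 : (1 : S.Cochain).c0 = 1 := rfl
@[simp] theorem one_c1 : (1 : S.Cochain).c1 = 0 := rfl
@[simp] theorem one_c2 : (1 : S.Cochain).c2 = 0 := rfl
@[simp] theorem add_c0 (a b : S.Cochain) : (a + b).c0 = a.c0 + b.c0 := rfl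
@[simp] theorem add_c1 (a b : S.Cochain) : (a + b).c1 = a.c1 + b.c1 := rfl
@[simp] theorem add_c2 (a b : S.Cochain) : (a + b).c2 = a.c2 + b.c2 := rfl
@[simp] theorem neg_c0 (a : S.Cochain) : (-a).c0 = -a.c0 := rfl
@[simp] theorem neg_c1 (a : S.Cochain) : (-a).c1 = -a.c1 := rfl
@[simp] theorem neg_c2 (a : S.Cochain) : (-a).c2 = -a.c2 := rfl
@[simp] theorem smul_c0 (r : ℂ) (a : S.Cochain) : (r • a).c0 = r • a.c0 := rfl
@[simp] theorem smul_c1 (r : ℂ) (a : S.Cochain) : (r • a).c1 = r • a.c1 := rfl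
@[simp] theorem smul_c2 (r : ℂ) (a : S.Cochain) : (r • a).c2 = r • a.c2 := rfl
@[simp] theorem mul_c0 (a b : S.Cochain) (v : S.V) : (a * b).c0 v = a.c0 v * b.c0 v := rfl
@[simp] theorem mul_c1 (a b : S.Cochain) (e : S.E) :
    (a * b).c1 e = a.c0 (S.ends e 0) * b.c1 e + a.c1 e * b.c0 (S.ends e 1) := rfl
@[simp] theorem mul_c2 (a b : S.Cochain) (t : S.T) :
    (a * b).c2 t = a.c0 (S.corner t 0) * b.c2 t + a.c1 (S.side t 2) * b.c1 (S.side t 0) +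
      a.c2 t * b.c0 (S.corner t 2) := rfl

theorem ends_side_two_zero (t : S.T) : S.ends (S.side t 2) 0 = S.corner t 0 :=
  S.ends_side t 2 0
theorem ends_side_two_one (t : S.T) : S.ends (S.side t 2) 1 = S.corner t 1 :=
  S.ends_side t 2 1
theorem ends_side_one_zero (t : S.T) : S.ends (S.side t 1) 0 = S.corner t 0 :=
  S.ends_side t 1 0
theorem ends_side_one_one (t : S.T) : S.ends (S.side t 1) 1 = S.corner t 2 :=
  S.ends_side t 1 1
theorem ends_side_zero_zero (t : S.T) : S.ends (S.side t 0) 0 = S.corner t 1 :=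
  S.ends_side t 0 0
theorem ends_side_zero_one (t : S.T) : S.ends (S.side t 0) 1 = S.corner t 2 :=
  S.ends_side t 0 1

instance : Ring S.Cochain where
  add_assoc a b c := by ext <;> simp [add_assoc]
  zero_add a := by ext <;> simp
  add_zero a := by ext <;> simp
  add_comm a b := by ext <;> simp [add_comm]
  neg_add_cancel a := by ext <;> simp
  nsmul := nsmulRec
  zsmul := zsmulRec
  left_distrib a b c := by ext <;> simp <;> ring
  right_distrib a b c := by ext <;> simp <;> ring
  zero_mul a := by ext <;> simp
  mul_zero a := by ext <;> simp
  one_mul a := by ext <;> simp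
  mul_one a := by ext <;> simp
  mul_assoc a b c := by
    ext <;> simp [ends_side_two_zero, ends_side_two_one, ends_side_zero_zero,
      ends_side_zero_one] <;> ring

instance : Module ℂ S.Cochain where
  one_smul a := by ext <;> simp
  mul_smul r s a := by ext <;> simp [mul_assoc]
  smul_zero r := by ext <;> simp
  smul_add r a b := by ext <;> simp [mul_add]
  add_smul r s a := by ext <;> simp [add_mul]
  zero_smul a := by ext <;> simp

instance : Algebra ℂ S.Cochain :=
  Algebra.ofModule (fun r a b => by ext <;> simp <;> ring) (fun r a b => by ext <;> simp <;> ring)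

/-- The coboundary operator. -/
def d : S.Cochain →ₗ[ℂ] S.Cochain where
  toFun a := ⟨0, fun e => a.c0 (S.ends e 1) - a.c0 (S.ends e 0),
    fun t => a.c1 (S.side t 0) - a.c1 (S.side t 1) + a.c1 (S.side t 2)⟩
  map_add' a b := by ext <;> simp <;> ring
  map_smul' r a := by ext <;> simp <;> ring

@[simp] theorem d_c0 (a : S.Cochain) : (d a).c0 = 0 := rfl
@[simp] theorem d_c1 (a : S.Cochain) (e : S.E) :
    (d a).c1 e = a.c0 (S.ends e 1) - a.c0 (S.ends e 0) := rfl
@[simp] theorem d_c2 (a : S.Cochain) (t : S.T) :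
    (d a).c2 t = a.c1 (S.side t 0) - a.c1 (S.side t 1) + a.c1 (S.side t 2) := rfl

/-- The sign `(-1)^n` in degree `n`. -/
def bar (a : S.Cochain) : S.Cochain := ⟨a.c0, -a.c1, a.c2⟩

theorem d_d (a : S.Cochain) : d (d a) = 0 := by
  ext <;> simp [ends_side_two_zero, ends_side_two_one, ends_side_one_zero, ends_side_one_one,
    ends_side_zero_zero, ends_side_zero_one]

/-- The Leibniz rule. -/
theorem d_mul (a b : S.Cochain) : d (a * b) = d a * b + bar a * d b := by
  ext <;> simp [bar, ends_side_two_zero, ends_side_two_one, ends_side_one_zero, ends_side_one_one,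
    ends_side_zero_zero, ends_side_zero_one] <;> ring

theorem bar_bar (a : S.Cochain) : bar (bar a) = a := by
  ext <;> simp [bar]

theorem d_bar (a : S.Cochain) : d (bar a) = -bar (d a) := by
  ext
  · simp [bar]
  · simp [bar]
  · simp [bar]
    ring

end Cochain

/-- The algebra of cocycles. -/
def cocycles : Subalgebra ℂ S.Cochain where
  carrier := {a | Cochain.d a = 0}
  mul_mem' {a b} ha hb := by
    simp only [Set.mem_ofPred_eq] at *
    rw [Cochain.d_mul, ha, hb]; simp
  add_mem' {a b} ha hb := by
    simp only [Set.mem_ofPred_eq] at *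
    rw [map_add, ha, hb, add_zero]
  algebraMap_mem' r := by
    simp only [Set.mem_ofPred_eq, Algebra.algebraMap_eq_smul_one, map_smul]
    have : Cochain.d (1 : S.Cochain) = 0 := by ext <;> simp
    rw [this, smul_zero]

/-- The two-sided ideal of coboundaries. -/
def coboundaries : Ideal S.cocycles where
  carrier := {a | ∃ b : S.Cochain, Cochain.d b = a}
  add_mem' := by
    rintro a b ⟨a', ha⟩ ⟨b', hb⟩
    exact ⟨a' + b', by simp [ha, hb]⟩
  zero_mem' := ⟨0, by simp⟩
  smul_mem' := by
    rintro ⟨c, hc⟩ x ⟨b, hb⟩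
    refine ⟨Cochain.bar c * b, ?_⟩
    have hc' : Cochain.d c = 0 := hc
    have h0 : Cochain.bar (0 : S.Cochain) = 0 := by ext <;> simp [Cochain.bar]
    rw [Cochain.d_mul, Cochain.d_bar, hc', h0, Cochain.bar_bar, hb]
    simp

instance : S.coboundaries.IsTwoSided where
  mul_mem_of_left := by
    rintro a ⟨c, hc⟩ ⟨b, hb⟩
    refine ⟨b * c, ?_⟩
    have hc' : Cochain.d c = 0 := hc
    rw [Cochain.d_mul, hc', hb]
    simp

/-- The cohomology algebra `H^*(S, ℂ)`. -/
abbrev Cohomology : Type := S.cocycles ⧸ S.coboundaries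

/-- The class of a cocycle. -/
def coclass : S.cocycles →ₐ[ℂ] S.Cohomology := Ideal.Quotient.mkₐ ℂ S.coboundaries

/-- The classes of even degree. -/
def evenPart : Submodule ℂ S.Cohomology :=
  Submodule.map S.coclass.toLinearMap
    { carrier := {a | (a : S.Cochain).c1 = 0}
      add_mem' := by intro a b ha hb; simp_all
      zero_mem' := by simp
      smul_mem' := by intro r a ha; simp_all }

/-- The classes of odd degree. -/
def oddPart : Submodule ℂ S.Cohomology :=
  Submodule.map S.coclass.toLinearMap
    { carrier := {a | (a : S.Cochain).c0 = 0 ∧ (a : S.Cochain).c2 = 0}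
      add_mem' := by intro a b ha hb; simp_all
      zero_mem' := by simp
      smul_mem' := by intro r a ha; simp_all }

/-- `Φ` is an isomorphism of `ℤ/2`-graded algebras from `M^*(X, W, G)^G`, with the product `cup`,
to `H^*(S, ℂ)`. -/
structure IsGradedAlgIso {N : ℕ} (P : Orbifold ℂ N)
    (cup : P.Total →ₗ[ℂ] P.Total →ₗ[ℂ] P.Total)
    (Φ : P.invariants ≃ₗ[ℂ] S.Cohomology) : Prop where
  map_mul : ∀ x y z : P.invariants, (z : P.Total) = cup x y → Φ z = Φ x * Φ y
  map_one : ∀ u : P.invariants, (u : P.Total) = P.unit → Φ u = 1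
  map_even : ∀ x : P.invariants, (x : P.Total) ∈ P.even ↔ Φ x ∈ S.evenPart
  map_odd : ∀ x : P.invariants, (x : P.Total) ∈ P.odd ↔ Φ x ∈ S.oddPart

end Complex₂

end LG

end

/-!
Write `n = 2g + 1` and `φ = x₁x₂x₃`. The relations `n xᵢ^{n-1} = xⱼxₖ` of the Milnor algebra give
`xᵢ² xⱼ = n³ φ^{n-3} xᵢ² xⱼ` (`LG.sq_mul_eq_zero_of_relations`). On `X` the origin is the only
critical point of `W`, so by the Nullstellensatz `1 - n³ φ^{n-3}` is a unit in `M(W)`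
(`LG.IsCuspHom.isUnit_one_sub`), and it follows that `xᵢ² xⱼ = 0`, `xᵢ φ = 0` and `n xᵢⁿ = φ`.
That `φ ≠ 0` is seen with a functional that kills the Jacobian ideal (`LG.socle`). The algebras
`M(W^h)` for `h ≠ 1` are one-dimensional, since all variables are moved by `h`.

The structure constant `σ_{h, h⁻¹}` is computed from the cube of a quadratic element in the
Grassmann variables (`LG.cube_of_anticommuting`, `LG.monomialCoeff_upsilon_structure`), whose
coefficients are given by the difference derivatives of `W`; by the relations above only multiples
of `φ` remain (`LG.sigma_cusp_inv`). The structure constants `σ_{h, k}` with `h = 1` or `k = 1` are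
`1`, and the remaining ones vanish for degree reasons. Since `φ` is annihilated by the maximal ideal
of `M(W)` and vanishes in the twisted sectors, the product is well defined and associative
(`LG.exists_cusp_isAlgebra`).

Monomials have a weight under the group, and averaging shows that the invariants of `M(W)` are
spanned by `1` and `φ` (`LG.mem_span_of_invariant`). Hence the algebra of invariants is
`ℂ ⊕ V ⊕ ℂφ`, where `V` is spanned by the `2g` elements `ξ_h`, `h ≠ 1`, and the product of `V` is
given by a form that pairs `ξ_h` with `ξ_{h⁻¹}`. The form is nondegenerate, and it is alternating as
`(1 - ζ)² (1 - ζ⁻²)` is odd under `ζ ↦ ζ⁻¹` (`LG.twistForm_isAlt`).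

The cohomology of a surface of genus `g` is of the same form. Poincaré duality is proved directly
on the triangulation (`LG.Complex₂.exists_primitive`): for a `1`-cocycle `a` for which the
functional `b ↦ ∫ a ∪ b` factors through the coboundary, the equations for the indicator functions
of the edges say that the primitives of `a` on the triangles fit together. With the Euler
characteristic this gives a symplectic space of dimension `2g` in degree one
(`LG.Complex₂.finrank_ker_d₁`, `LG.Complex₂.exists_d₀_eq`). Symplectic spaces of the same dimension
are isometric (`LG.exists_isometry_of_isAlt`), so the two algebras are isomorphic.
-/

open scoped TensorProduct

noncomputable section

/-! ### Poincaré duality for triangulated surfaces -/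

namespace LG.Complex₂

variable {S : Complex₂}

/-- The coboundary in degree `0`. -/
def d₀ (S : Complex₂) : (S.V → ℂ) →ₗ[ℂ] (S.E → ℂ) where
  toFun c e := c (S.ends e 1) - c (S.ends e 0)
  map_add' a b := by ext; simp; ring
  map_smul' r a := by ext; simp; ring

/-- The coboundary in degree `1`. -/
def d₁ (S : Complex₂) : (S.E → ℂ) →ₗ[ℂ] (S.T → ℂ) where
  toFun a t := a (S.side t 0) - a (S.side t 1) + a (S.side t 2)
  map_add' a b := by ext; simp; ring
  map_smul' r a := by ext; simp; ring

theorem d₀_apply (c : S.V → ℂ) (e : S.E) : S.d₀ c e = c (S.ends e 1) - c (S.ends e 0) := rfl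

theorem d₁_apply (a : S.E → ℂ) (t : S.T) :
    S.d₁ a t = a (S.side t 0) - a (S.side t 1) + a (S.side t 2) := rfl

theorem d₁_d₀ (c : S.V → ℂ) : S.d₁ (S.d₀ c) = 0 := by
  ext t
  simp only [d₁_apply, d₀_apply, Cochain.ends_side_two_zero, Cochain.ends_side_two_one,
    Cochain.ends_side_one_zero, Cochain.ends_side_one_one, Cochain.ends_side_zero_zero,
    Cochain.ends_side_zero_one, Pi.zero_apply]
  ring

/-- The pairing of a `2`-cochain with the fundamental cycle `∑ o(t) t`. -/
def integral (o : S.T → ℤˣ) : (S.T → ℂ) →ₗ[ℂ] ℂ where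
  toFun c := ∑ t, ((o t : ℤ) : ℂ) * c t
  map_add' a b := by simp [mul_add, Finset.sum_add_distrib]
  map_smul' r a := by
    simp only [Pi.smul_apply, smul_eq_mul, RingHom.id_apply, Finset.mul_sum]
    exact Finset.sum_congr rfl fun t _ => by ring

theorem integral_apply (o : S.T → ℤˣ) (c : S.T → ℂ) :
    integral o c = ∑ t, ((o t : ℤ) : ℂ) * c t := rfl

/-- The cup product of two `1`-cochains. -/
def cup₁ (S : Complex₂) : (S.E → ℂ) →ₗ[ℂ] (S.E → ℂ) →ₗ[ℂ] (S.T → ℂ) :=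
  LinearMap.mk₂ ℂ (fun a b t => a (S.side t 2) * b (S.side t 0))
    (fun a a' b => by ext; simp [add_mul]) (fun r a b => by ext; simp [mul_assoc])
    (fun a b b' => by ext; simp [mul_add]) (fun r a b => by ext; simp; ring)

theorem cup₁_apply (a b : S.E → ℂ) (t : S.T) :
    S.cup₁ a b t = a (S.side t 2) * b (S.side t 0) := rfl

/-- On cocycles of degree one the cup product is anticommutative up to a coboundary: the
cochain `e ↦ a e * b e` is the `∪₁`-product of `a` and `b`. -/
theorem cup₁_add_cup₁_swap {a b : S.E → ℂ} (ha : S.d₁ a = 0) (hb : S.d₁ b = 0) :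
    S.cup₁ a b + S.cup₁ b a = S.d₁ (-(a * b)) := by
  ext t
  have ha' := congrFun ha t
  have hb' := congrFun hb t
  simp only [d₁_apply, Pi.zero_apply] at ha' hb'
  simp only [Pi.add_apply, cup₁_apply, d₁_apply, Pi.neg_apply, Pi.mul_apply]
  linear_combination b (S.side t 1) * ha' + (a (S.side t 0) + a (S.side t 2)) * hb'

/-- The Leibniz rule for a vertex function and a `1`-cocycle. -/
theorem cup₁_d₀ (c : S.V → ℂ) {b : S.E → ℂ} (hb : S.d₁ b = 0) :
    S.cup₁ (S.d₀ c) b = S.d₁ fun e => c (S.ends e 0) * b e := by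
  ext t
  have hb' := congrFun hb t
  simp only [d₁_apply, Pi.zero_apply] at hb'
  simp only [cup₁_apply, d₀_apply, d₁_apply, Cochain.ends_side_two_zero,
    Cochain.ends_side_two_one, Cochain.ends_side_one_zero, Cochain.ends_side_zero_zero]
  linear_combination (-c (S.corner t 0)) * hb'

section sides

open Classical in
/-- A function on the sides of triangles whose signed sum over the two sides glued along any
edge vanishes takes the same value on these two sides. -/
theorem eq_of_side_eq (hS : S.IsClosedSurface) {o : S.T → ℤˣ} (ho : S.IsOrientation o)
    (f : S.T × Fin 3 → ℂ)
    (hf : ∀ e, ∑ c ∈ Finset.univ.filter (fun c : S.T × Fin 3 => S.side c.1 c.2 = e),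
      ((o c.1 : ℤ) : ℂ) * (-1) ^ (c.2 : ℕ) * f c = 0)
    (c c' : S.T × Fin 3) (h : S.side c.1 c.2 = S.side c'.1 c'.2) : f c = f c' := by
  by_cases hcc : c = c'
  · rw [hcc]
  have hcard := hS.two_sides (S.side c'.1 c'.2)
  rw [Nat.card_eq_fintype_card, Fintype.card_subtype] at hcard
  have hpair : Finset.univ.filter (fun x : S.T × Fin 3 => S.side x.1 x.2 = S.side c'.1 c'.2) =
      {c, c'} := by
    symm
    apply Finset.eq_of_subset_of_card_le
    · intro x hx
      rcases Finset.mem_insert.1 hx with rfl | hx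
      · simp [h]
      · rw [Finset.mem_singleton.1 hx]; simp
    · rw [hcard, Finset.card_pair hcc]
  have h1 : ∑ c ∈ Finset.univ.filter (fun x : S.T × Fin 3 => S.side x.1 x.2 = S.side c'.1 c'.2),
      (o c.1 : ℤ) * (-1) ^ (c.2 : ℕ) = 0 := by
    convert! ho (S.side c'.1 c'.2)
  have h2 := hf (S.side c'.1 c'.2)
  rw [hpair, Finset.sum_pair hcc] at h1 h2
  have h1' : ((o c.1 : ℤ) : ℂ) * (-1) ^ (c.2 : ℕ) = -(((o c'.1 : ℤ) : ℂ) * (-1) ^ (c'.2 : ℕ)) := by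
    have := congrArg (Int.cast : ℤ → ℂ) h1
    push_cast at this
    linear_combination this
  have hne : ((o c'.1 : ℤ) : ℂ) * (-1) ^ (c'.2 : ℕ) ≠ 0 :=
    mul_ne_zero (by simp) (by simp)
  rw [h1'] at h2
  have : (((o c'.1 : ℤ) : ℂ) * (-1) ^ (c'.2 : ℕ)) * (f c' - f c) = 0 := by linear_combination h2
  rcases mul_eq_zero.1 this with h3 | h3
  · exact absurd h3 hne
  · exact (sub_eq_zero.1 h3).symm

end sides

theorem exists_side_eq (hS : S.IsClosedSurface) (e : S.E) : ∃ t i, S.side t i = e := by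
  have h := hS.two_sides e
  have : Nonempty {c : S.T × Fin 3 // S.side c.1 c.2 = e} := by
    by_contra hne
    rw [not_nonempty_iff] at hne
    simp at h
  obtain ⟨c, hc⟩ := this
  exact ⟨c.1, c.2, hc⟩

/-- Because the links of the vertices are connected, a function on the corners of triangles
that agrees at neighbouring corners is a function on the vertices. -/
theorem exists_vertex_function (hS : S.IsClosedSurface) (x : S.T × Fin 3 → ℂ)
    (hx : ∀ c c', S.Neighbours c c' → x c = x c') :
    ∃ c : S.V → ℂ, ∀ t k, c (S.corner t k) = x (t, k) := by
  choose T K hTK using hS.link_nonempty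
  refine ⟨fun v => x (T v, K v), fun t k => ?_⟩
  have h := hS.link_connected _ _ t k (hTK (S.corner t k))
  change x (T (S.corner t k), K (S.corner t k)) = x (t, k)
  generalize ((T (S.corner t k), K (S.corner t k)) : S.T × Fin 3) = p at h ⊢
  generalize ((t, k) : S.T × Fin 3) = q at h ⊢
  induction h with
  | rel a b h => exact hx a b h
  | refl => rfl
  | symm a b _ ih => exact ih.symm
  | trans a b c _ _ h1 h2 => exact h1.trans h2

open Classical in
/-- The heart of Poincaré duality. If the functional `b ↦ ∫ a ∪ b` of a `1`-cocycle `a` factors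
through the coboundary as `F ∘ d`, then `a` is the coboundary of a vertex function `c`, whose
value at the first vertex of a triangle `t` is `-o(t) F(t)`. Indeed the values of `c` at the
corners of `t` are forced by `a`, and the equation `∫ a ∪ b = F (d b)` for the indicator `b` of
an edge says that the values coming from the two adjacent triangles agree. -/
theorem exists_primitive (hS : S.IsClosedSurface) {o : S.T → ℤˣ} (ho : S.IsOrientation o)
    {a : S.E → ℂ} (ha : S.d₁ a = 0) (F : S.T → ℂ)
    (hF : ∀ b, integral o (S.cup₁ a b) = ∑ t, F t * S.d₁ b t) :
    ∃ c : S.V → ℂ, S.d₀ c = a ∧ ∀ t, F t = -(((o t : ℤ) : ℂ) * c (S.corner t 0)) := by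
  have hoo : ∀ t, ((o t : ℤ) : ℂ) * ((o t : ℤ) : ℂ) = 1 := by
    intro t
    rcases Int.units_eq_one_or (o t) with h | h <;> simp [h]
  -- the value of `c` at the `k`-th corner of `t`
  let x : S.T × Fin 3 → ℂ := fun p =>
    -(((o p.1 : ℤ) : ℂ) * F p.1) + ![0, a (S.side p.1 2), a (S.side p.1 1)] p.2
  -- the increment of `x` along a side is the value of `a`
  have hinc : ∀ t i, x (t, i.succAbove 1) - x (t, i.succAbove (0 : Fin 2)) = a (S.side t i) := by
    intro t i
    have ha' := congrFun ha t
    simp only [d₁_apply, Pi.zero_apply] at ha'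
    have e1 : (0 : Fin 3).succAbove (1 : Fin 2) = 2 := rfl
    have e2 : (0 : Fin 3).succAbove (0 : Fin 2) = 1 := rfl
    have e3 : (1 : Fin 3).succAbove (1 : Fin 2) = 2 := rfl
    have e4 : (1 : Fin 3).succAbove (0 : Fin 2) = 0 := rfl
    have e5 : (2 : Fin 3).succAbove (1 : Fin 2) = 1 := rfl
    have e6 : (2 : Fin 3).succAbove (0 : Fin 2) = 0 := rfl
    fin_cases i <;> simp [x, e1, e2, e3, e4, e5, e6]
    linear_combination -ha'
  have hstart : ∀ p p' : S.T × Fin 3, S.side p.1 p.2 = S.side p'.1 p'.2 →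
      x (p.1, p.2.succAbove (0 : Fin 2)) = x (p'.1, p'.2.succAbove (0 : Fin 2)) := by
    refine eq_of_side_eq hS ho (fun p => x (p.1, p.2.succAbove (0 : Fin 2))) fun e => ?_
    have h := hF (Pi.single e 1)
    rw [Finset.sum_filter, Fintype.sum_prod_type]
    rw [integral_apply, ← sub_eq_zero, ← Finset.sum_sub_distrib] at h
    refine Eq.trans (Finset.sum_congr rfl fun t _ => ?_) h
    have e2 : (0 : Fin 3).succAbove (0 : Fin 2) = 1 := rfl
    have e4 : (1 : Fin 3).succAbove (0 : Fin 2) = 0 := rfl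
    have e6 : (2 : Fin 3).succAbove (0 : Fin 2) = 0 := rfl
    simp only [Fin.sum_univ_three, e2, e4, e6, x, cup₁_apply, d₁_apply, Pi.single_apply]
    have h1 := hoo t
    by_cases s0 : S.side t 0 = e <;> by_cases s1 : S.side t 1 = e <;>
      by_cases s2 : S.side t 2 = e <;> simp [s0, s1, s2] <;>
      first
      | ring1
      | linear_combination F t * h1
      | linear_combination -F t * h1
      | linear_combination -2 * F t * h1
  obtain ⟨c, hc⟩ := exists_vertex_function hS x (by
    rintro ⟨t, k⟩ ⟨t', k'⟩ ⟨i, i', p, hs, hk, hk'⟩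
    dsimp only at hs hk hk'
    subst hk hk'
    have h0 := hstart (t, i) (t', i') hs
    dsimp only at h0
    fin_cases p
    · exact h0
    · have h1 := hinc t i
      have h2 := hinc t' i'
      rw [hs] at h1
      change x (t, i.succAbove 1) = x (t', i'.succAbove 1)
      linear_combination h1 - h2 + h0)
  refine ⟨c, ?_, fun t => ?_⟩
  · ext e
    obtain ⟨t, i, rfl⟩ := exists_side_eq hS e
    rw [d₀_apply, S.ends_side, S.ends_side, hc, hc, hinc]
  · rw [hc]
    simp only [x, Matrix.cons_val_zero]
    linear_combination (-F t) * hoo t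

theorem eq_of_d₀_eq_zero (hS : S.IsClosedSurface) {c : S.V → ℂ} (hc : S.d₀ c = 0) (v w : S.V) :
    c v = c w := by
  induction hS.connected v w with
  | rel a b h =>
    obtain ⟨e, rfl, rfl⟩ := h
    exact (sub_eq_zero.1 (congrFun hc e)).symm
  | refl => rfl
  | symm a b _ ih => exact ih.symm
  | trans a b c _ _ h1 h2 => exact h1.trans h2

open Classical in
theorem integral_d₁ {o : S.T → ℤˣ} (ho : S.IsOrientation o) (b : S.E → ℂ) :
    integral o (S.d₁ b) = 0 := by
  have h1 : integral o (S.d₁ b) =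
      ∑ p : S.T × Fin 3, ((o p.1 : ℤ) : ℂ) * (-1) ^ (p.2 : ℕ) * b (S.side p.1 p.2) := by
    rw [integral_apply, Fintype.sum_prod_type]
    refine Finset.sum_congr rfl fun t _ => ?_
    simp [Fin.sum_univ_three, d₁_apply]
    ring
  rw [h1, ← Finset.sum_fiberwise (s := Finset.univ) (g := fun p : S.T × Fin 3 => S.side p.1 p.2)]
  refine Finset.sum_eq_zero fun e _ => ?_
  have h2 := ho e
  have h3 := congrArg (Int.cast : ℤ → ℂ) h2
  push_cast at h3
  calc _ = ∑ p ∈ Finset.univ.filter (fun p : S.T × Fin 3 => S.side p.1 p.2 = e),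
        ((o p.1 : ℤ) : ℂ) * (-1) ^ (p.2 : ℕ) * b e := by
        refine Finset.sum_congr rfl fun p hp => ?_
        rw [(Finset.mem_filter.1 hp).2]
    _ = 0 := by
        rw [← Finset.sum_mul]
        refine mul_eq_zero_of_left ?_ _
        convert! h3

theorem nonempty_triangle (hS : S.IsClosedSurface) : Nonempty S.T := by
  obtain ⟨v⟩ := hS.nonempty
  obtain ⟨t, -, -⟩ := hS.link_nonempty v
  exact ⟨t⟩

/-- A linear functional on `ℂ^ι` is given by its coefficients. -/
theorem functional_eq_sum {ι : Type*} [Fintype ι] [DecidableEq ι] (φ : (ι → ℂ) →ₗ[ℂ] ℂ)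
    (x : ι → ℂ) : φ x = ∑ i, φ (Pi.single i 1) * x i := by
  conv_lhs => rw [pi_eq_sum_univ' x]
  simp [map_sum, mul_comm]

open Classical in
/-- A `2`-cochain of integral zero is a coboundary. -/
theorem exists_d₁_eq (hS : S.IsClosedSurface) {o : S.T → ℤˣ} (ho : S.IsOrientation o)
    {w : S.T → ℂ} (hw : integral o w = 0) : ∃ b, S.d₁ b = w := by
  by_contra hne
  have hnot : w ∉ LinearMap.range S.d₁ := fun ⟨b, hb⟩ => hne ⟨b, hb⟩
  obtain ⟨φ, hφw, hφ⟩ := Submodule.exists_le_ker_of_notMem hnot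
  obtain ⟨c, hc, hcF⟩ := exists_primitive hS ho (a := 0) (by simp)
    (fun t => φ (Pi.single t 1)) (fun b => by
      rw [map_zero, LinearMap.zero_apply, map_zero, ← functional_eq_sum φ]
      exact (hφ ⟨b, rfl⟩).symm)
  obtain ⟨v⟩ := hS.nonempty
  apply hφw
  rw [functional_eq_sum φ]
  have : ∀ t, φ (Pi.single t 1) = -(((o t : ℤ) : ℂ) * c v) := fun t => by
    rw [hcF t, eq_of_d₀_eq_zero hS hc (S.corner t 0) v]
  simp only [this]
  calc _ = -(c v * integral o w) := by
        rw [integral_apply, Finset.mul_sum, ← Finset.sum_neg_distrib]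
        exact Finset.sum_congr rfl fun t _ => by ring
    _ = 0 := by rw [hw]; simp

open Classical in
/-- Nondegeneracy of the cup product in degree one. -/
theorem exists_d₀_eq (hS : S.IsClosedSurface) {o : S.T → ℤˣ} (ho : S.IsOrientation o)
    {a : S.E → ℂ} (ha : S.d₁ a = 0)
    (h : ∀ b, S.d₁ b = 0 → integral o (S.cup₁ a b) = 0) : ∃ c, S.d₀ c = a := by
  have hker : LinearMap.ker S.d₁ ≤ LinearMap.ker (integral o ∘ₗ S.cup₁ a) := fun b hb => h b hb
  have hmem : integral o ∘ₗ S.cup₁ a ∈ LinearMap.range S.d₁.dualMap := by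
    rw [LinearMap.range_dualMap_eq_dualAnnihilator_ker, Submodule.mem_dualAnnihilator]
    exact hker
  obtain ⟨φ, hφ⟩ := hmem
  obtain ⟨c, hc, -⟩ := exists_primitive hS ho ha (fun t => φ (Pi.single t 1)) fun b => by
    rw [← functional_eq_sum φ]
    exact (LinearMap.congr_fun hφ b).symm
  exact ⟨c, hc⟩

end LG.Complex₂

/-! ### Nondegenerate alternating forms -/

namespace LG

/-- A nondegenerate alternating form splits off a hyperbolic plane. -/
theorem exists_hyperbolic_split {K V : Type*} [Field K] [AddCommGroup V] [Module K V]
    (B : LinearMap.BilinForm K V) (hB : B.IsAlt) (hnd : ∀ x, (∀ y, B x y = 0) → x = 0)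
    (hV : Nontrivial V) :
    ∃ (U : Submodule K V) (D : ((K × K) × U) ≃ₗ[K] V),
      ∀ p q, B (D p) (D q) = p.1.1 * q.1.2 - p.1.2 * q.1.1 + B p.2 q.2 := by
  obtain ⟨v, hv⟩ := exists_ne (0 : V)
  obtain ⟨w', hw'⟩ : ∃ w, B v w ≠ 0 := by
    by_contra! h
    exact hv (hnd v h)
  set w : V := (B v w')⁻¹ • w' with hw
  have hvw : B v w = 1 := by rw [hw, map_smul, smul_eq_mul, inv_mul_cancel₀ hw']
  have hwv : B w v = -1 := by rw [← LinearMap.BilinForm.IsAlt.neg_eq hB, hvw]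
  have hvv : B v v = 0 := hB v
  have hww : B w w = 0 := hB w
  set U : Submodule K V := LinearMap.ker (B v) ⊓ LinearMap.ker (B w) with hU
  have hU1 : ∀ p : U, B v p = 0 := fun p => p.2.1
  have hU2 : ∀ p : U, B w p = 0 := fun p => p.2.2
  have hU3 : ∀ p : U, B p v = 0 := fun p => by
    rw [← LinearMap.BilinForm.IsAlt.neg_eq hB, hU1, neg_zero]
  have hU4 : ∀ p : U, B p w = 0 := fun p => by
    rw [← LinearMap.BilinForm.IsAlt.neg_eq hB, hU2, neg_zero]
  let f : ((K × K) × U) →ₗ[K] V :=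
    (((LinearMap.toSpanSingleton K V v).coprod (LinearMap.toSpanSingleton K V w)).coprod U.subtype)
  have hf : ∀ p, f p = p.1.1 • v + p.1.2 • w + p.2 := fun p => rfl
  have hform : ∀ p q, B (f p) (f q) = p.1.1 * q.1.2 - p.1.2 * q.1.1 + B p.2 q.2 := by
    intro p q
    simp only [hf, map_add, map_smul, LinearMap.add_apply, LinearMap.smul_apply, smul_eq_mul, hvv,
      hvw, hwv, hww, hU1, hU2, hU3, hU4]
    ring
  have hinj : Function.Injective f := by
    rw [← LinearMap.ker_eq_bot, LinearMap.ker_eq_bot']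
    intro p hp
    have h1 : B v (f p) = 0 := by rw [hp, map_zero]
    have h2 : B w (f p) = 0 := by rw [hp, map_zero]
    simp only [hf, map_add, map_smul, smul_eq_mul, hvv, hvw, hU1, mul_zero, mul_one, zero_add,
      add_zero] at h1
    simp only [hf, map_add, map_smul, smul_eq_mul, hww, hwv, hU2, mul_zero, mul_neg, mul_one,
      add_zero, neg_eq_zero] at h2
    rw [hf, h1, h2, zero_smul, zero_smul, zero_add, zero_add] at hp
    refine Prod.ext (Prod.ext h2 h1) (Subtype.ext hp)
  have hsurj : Function.Surjective f := by
    intro x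
    refine ⟨((-B w x, B v x), ⟨x + B w x • v - B v x • w, ?_, ?_⟩), ?_⟩
    · simp [hvv, hvw]
    · simp [hww, hwv]
    · rw [hf]
      simp
  exact ⟨U, LinearEquiv.ofBijective f ⟨hinj, hsurj⟩, hform⟩

/-- Nondegenerate alternating forms on spaces of the same finite dimension are isometric. -/
theorem exists_isometry_of_isAlt {K V V' : Type*} [Field K] [AddCommGroup V] [Module K V]
    [AddCommGroup V'] [Module K V'] [FiniteDimensional K V] [FiniteDimensional K V']
    (B : LinearMap.BilinForm K V) (hB : B.IsAlt) (hnd : ∀ x, (∀ y, B x y = 0) → x = 0)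
    (B' : LinearMap.BilinForm K V') (hB' : B'.IsAlt) (hnd' : ∀ x, (∀ y, B' x y = 0) → x = 0)
    (h : Module.finrank K V = Module.finrank K V') :
    ∃ e : V ≃ₗ[K] V', ∀ x y, B' (e x) (e y) = B x y := by
  induction hn : Module.finrank K V using Nat.strong_induction_on generalizing V V' with
  | _ n ih =>
    rcases subsingleton_or_nontrivial V with hV | hV
    · refine ⟨LinearEquiv.ofFinrankEq V V' h, fun x y => ?_⟩
      rw [Subsingleton.elim x 0]
      simp
    · have hV' : Nontrivial V' := by
        rw [← Module.finrank_pos_iff (R := K), ← h]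
        exact Module.finrank_pos
      obtain ⟨U, D, hD⟩ := exists_hyperbolic_split B hB hnd hV
      obtain ⟨U', D', hD'⟩ := exists_hyperbolic_split B' hB' hnd' hV'
      have hU := D.finrank_eq
      have hU' := D'.finrank_eq
      rw [Module.finrank_prod, Module.finrank_prod, Module.finrank_self] at hU hU'
      have nd : ∀ x : U, (∀ y : U, B.restrict U x y = 0) → x = 0 := by
        intro x hx
        have : D ((0, 0), x) = 0 := hnd _ fun y => by
          obtain ⟨q, rfl⟩ := D.surjective y
          rw [hD]
          simpa using hx q.2
        simpa using this
      have nd' : ∀ x : U', (∀ y : U', B'.restrict U' x y = 0) → x = 0 := by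
        intro x hx
        have : D' ((0, 0), x) = 0 := hnd' _ fun y => by
          obtain ⟨q, rfl⟩ := D'.surjective y
          rw [hD']
          simpa using hx q.2
        simpa using this
      obtain ⟨e, he⟩ := ih (Module.finrank K U) (by omega) (B.restrict U) (fun x => hB x) nd
        (B'.restrict U') (fun x => hB' x) nd' (by omega) rfl
      refine ⟨D.symm.trans (((LinearEquiv.refl K (K × K)).prodCongr e).trans D'), fun x y => ?_⟩
      obtain ⟨p, rfl⟩ := D.surjective x
      obtain ⟨q, rfl⟩ := D.surjective y
      have := he p.2 q.2
      simp only [LinearMap.BilinForm.restrict_apply, LinearMap.domRestrict_apply] at this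
      simp [hD, hD', this]

namespace Complex₂

variable {S : Complex₂}

theorem integral_cup₁_swap {o : S.T → ℤˣ} (ho : S.IsOrientation o) {a b : S.E → ℂ}
    (ha : S.d₁ a = 0) (hb : S.d₁ b = 0) :
    integral o (S.cup₁ a b) = -integral o (S.cup₁ b a) := by
  rw [eq_neg_iff_add_eq_zero, ← map_add, cup₁_add_cup₁_swap ha hb, integral_d₁ ho]

theorem integral_cup₁_d₀_left {o : S.T → ℤˣ} (ho : S.IsOrientation o) (c : S.V → ℂ) {b : S.E → ℂ}
    (hb : S.d₁ b = 0) : integral o (S.cup₁ (S.d₀ c) b) = 0 := by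
  rw [cup₁_d₀ c hb, integral_d₁ ho]

theorem integral_cup₁_d₀_right {o : S.T → ℤˣ} (ho : S.IsOrientation o) (c : S.V → ℂ)
    {b : S.E → ℂ} (hb : S.d₁ b = 0) : integral o (S.cup₁ b (S.d₀ c)) = 0 := by
  rw [integral_cup₁_swap ho hb (d₁_d₀ c), integral_cup₁_d₀_left ho c hb, neg_zero]

theorem exists_integral_eq_one (hS : S.IsClosedSurface) (o : S.T → ℤˣ) :
    ∃ τ, integral o τ = 1 := by
  classical
  obtain ⟨t⟩ := nonempty_triangle hS
  refine ⟨Pi.single t ((o t : ℤ) : ℂ), ?_⟩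
  rw [integral_apply, Finset.sum_eq_single t]
  · rcases Int.units_eq_one_or (o t) with h | h <;> simp [h]
  · intro s _ hs
    simp [hs]
  · simp

/-- The first Betti number of a surface of genus `g` is `2g`: the kernel of `d₀` and the cokernel
of `d₁` being one-dimensional, it is determined by the Euler characteristic. -/
theorem finrank_ker_d₁ (hS : S.IsClosedSurface) {o : S.T → ℤˣ} (ho : S.IsOrientation o) {g : ℕ}
    (hg : S.HasGenus g) :
    Module.finrank ℂ (LinearMap.ker S.d₁) = 2 * g + Module.finrank ℂ (LinearMap.range S.d₀) := by
  have h0 : Module.finrank ℂ (LinearMap.ker S.d₀) = 1 := by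
    obtain ⟨v⟩ := hS.nonempty
    have e : LinearMap.ker S.d₀ = Submodule.span ℂ {(fun _ => 1 : S.V → ℂ)} := by
      ext c
      rw [Submodule.mem_span_singleton, LinearMap.mem_ker]
      constructor
      · intro hc
        exact ⟨c v, funext fun w => by simp [eq_of_d₀_eq_zero hS hc v w]⟩
      · rintro ⟨r, rfl⟩
        ext e
        simp [d₀_apply]
    rw [e]
    exact finrank_span_singleton fun h => one_ne_zero (congrFun h v)
  have h1 : LinearMap.range S.d₁ = LinearMap.ker (integral o) := by
    ext w
    constructor
    · rintro ⟨b, rfl⟩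
      exact integral_d₁ ho b
    · intro hw
      exact exists_d₁_eq hS ho hw
  have h2 : Module.finrank ℂ (LinearMap.range (integral o)) = 1 := by
    have : LinearMap.range (integral o) = ⊤ := by
      obtain ⟨τ, hτ⟩ := exists_integral_eq_one hS o
      refine LinearMap.range_eq_top.2 fun r => ⟨r • τ, ?_⟩
      rw [map_smul, hτ, smul_eq_mul, mul_one]
    rw [this, finrank_top, Module.finrank_self]
  have r0 := LinearMap.finrank_range_add_finrank_ker S.d₀
  have r1 := LinearMap.finrank_range_add_finrank_ker S.d₁
  have r2 := LinearMap.finrank_range_add_finrank_ker (integral o)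
  rw [h1] at r1
  rw [Module.finrank_fintype_fun_eq_card] at r0 r1 r2
  unfold HasGenus at hg
  omega

/-- Every symplectic space of dimension `2g` is isometric to the first cohomology of a surface
of genus `g`; the isometry is given by a linear map to cocycles. -/
theorem exists_isometry_cocycles (hS : S.IsClosedSurface) {o : S.T → ℤˣ} (ho : S.IsOrientation o)
    {g : ℕ} (hg : S.HasGenus g) {V : Type*} [AddCommGroup V] [Module ℂ V]
    [FiniteDimensional ℂ V] (B : LinearMap.BilinForm ℂ V) (hB : B.IsAlt)
    (hnd : ∀ x, (∀ y, B x y = 0) → x = 0) (hV : Module.finrank ℂ V = 2 * g) :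
    ∃ L : V →ₗ[ℂ] (S.E → ℂ), (∀ u, S.d₁ (L u) = 0) ∧
      (∀ u v, integral o (S.cup₁ (L u) (L v)) = B u v) ∧
      ∀ z, S.d₁ z = 0 → ∃ u c, L u + S.d₀ c = z := by
  -- a complement `K` of the coboundaries in the cocycles represents the first cohomology
  let Z := LinearMap.ker S.d₁
  let B₁ : Submodule ℂ Z := (LinearMap.range S.d₀).comap Z.subtype
  obtain ⟨K, hK⟩ := Submodule.exists_isCompl B₁
  let β : LinearMap.BilinForm ℂ K :=
    ((S.cup₁.compr₂ (integral o)).compl₁₂ (Z.subtype ∘ₗ K.subtype) (Z.subtype ∘ₗ K.subtype))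
  have hβ : ∀ x y : K, β x y = integral o (S.cup₁ (x : Z) (y : Z)) := fun _ _ => rfl
  have hZ : ∀ z : Z, S.d₁ z = 0 := fun z => z.2
  have hsplit : ∀ z : Z, ∃ (k : K) (c : S.V → ℂ), ((k : Z) : S.E → ℂ) + S.d₀ c = z := by
    intro z
    have : z ∈ B₁ ⊔ K := by rw [hK.sup_eq_top]; trivial
    obtain ⟨y, ⟨c, hc⟩, k, hk, rfl⟩ := Submodule.mem_sup.1 this
    refine ⟨⟨k, hk⟩, c, ?_⟩
    rw [hc]
    simp [add_comm]
  have hdim : Module.finrank ℂ K = 2 * g := by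
    have h1 := Submodule.finrank_add_eq_of_isCompl hK
    have h2 : Module.finrank ℂ B₁ = Module.finrank ℂ (LinearMap.range S.d₀) := by
      refine (Submodule.comapSubtypeEquivOfLe ?_).finrank_eq
      rintro _ ⟨c, rfl⟩
      exact d₁_d₀ c
    have h3 : Module.finrank ℂ Z = _ := finrank_ker_d₁ hS ho hg
    omega
  obtain ⟨e, he⟩ := exists_isometry_of_isAlt (V' := K) B hB hnd β
    (fun x : K => by
      have := integral_cup₁_swap ho (hZ (x : Z)) (hZ (x : Z))
      rw [← hβ] at this
      exact self_eq_neg.1 this)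
    (fun (x : K) hx => by
      have : ((x : Z) : S.E → ℂ) ∈ LinearMap.range S.d₀ := by
        refine exists_d₀_eq hS ho (hZ (x : Z)) fun b hb => ?_
        obtain ⟨k, c, hkc⟩ := hsplit ⟨b, hb⟩
        change _ = b at hkc
        rw [← hkc, map_add, map_add, ← hβ, hx, integral_cup₁_d₀_right ho c (hZ (x : Z)), zero_add]
      have h0 : (x : Z) ∈ B₁ ⊓ K := ⟨this, x.2⟩
      rw [hK.inf_eq_bot] at h0
      exact Subtype.ext h0)
    (hV.trans hdim.symm)
  refine ⟨(Z.subtype ∘ₗ K.subtype) ∘ₗ e.toLinearMap, fun u => hZ _, fun u v => he u v,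
    fun z hz => ?_⟩
  obtain ⟨k, c, hkc⟩ := hsplit ⟨z, hz⟩
  exact ⟨e.symm k, c, by simpa using hkc⟩

end Complex₂

end LG

/-! ### The cohomology algebra of a surface -/

namespace LG.Complex₂

variable {S : Complex₂}

theorem coclass_eq_iff (x y : S.cocycles) :
    S.coclass x = S.coclass y ↔ ∃ b : S.Cochain, Cochain.d b = (x : S.Cochain) - y :=
  Ideal.Quotient.eq

theorem Cochain.sub_c0 (a b : S.Cochain) : (a - b).c0 = a.c0 - b.c0 := by
  rw [sub_eq_add_neg, sub_eq_add_neg, Cochain.add_c0, Cochain.neg_c0]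

theorem Cochain.sub_c1 (a b : S.Cochain) : (a - b).c1 = a.c1 - b.c1 := by
  rw [sub_eq_add_neg, sub_eq_add_neg, Cochain.add_c1, Cochain.neg_c1]

theorem Cochain.sub_c2 (a b : S.Cochain) : (a - b).c2 = a.c2 - b.c2 := by
  rw [sub_eq_add_neg, sub_eq_add_neg, Cochain.add_c2, Cochain.neg_c2]

/-- The total coboundary in terms of its components. -/
theorem exists_d_eq_iff (w : S.Cochain) :
    (∃ b, Cochain.d b = w) ↔ w.c0 = 0 ∧ (∃ c, S.d₀ c = w.c1) ∧ ∃ b, S.d₁ b = w.c2 := by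
  constructor
  · rintro ⟨b, rfl⟩
    exact ⟨rfl, ⟨b.c0, rfl⟩, ⟨b.c1, rfl⟩⟩
  · rintro ⟨h0, ⟨c, hc⟩, ⟨b, hb⟩⟩
    exact ⟨⟨c, b, 0⟩, Cochain.ext h0.symm hc hb⟩

theorem d_eq_zero_iff (w : S.Cochain) : Cochain.d w = 0 ↔ S.d₀ w.c0 = 0 ∧ S.d₁ w.c1 = 0 := by
  constructor
  · intro h
    exact ⟨congrArg Cochain.c1 h, congrArg Cochain.c2 h⟩
  · rintro ⟨h0, h1⟩
    exact Cochain.ext rfl h0 h1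

/-- The cohomology of a closed oriented surface of genus `g` is `ℂ ⊕ V ⊕ ℂ`, where `V` is any
symplectic space of dimension `2g` and the product `V × V → ℂ` is the symplectic form. -/
theorem exists_cohomology_equiv (hS : S.IsClosedSurface) {o : S.T → ℤˣ} (ho : S.IsOrientation o)
    {g : ℕ} (hg : S.HasGenus g) {V : Type*} [AddCommGroup V] [Module ℂ V]
    [FiniteDimensional ℂ V] (B : LinearMap.BilinForm ℂ V) (hB : B.IsAlt)
    (hnd : ∀ x, (∀ y, B x y = 0) → x = 0) (hV : Module.finrank ℂ V = 2 * g) :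
    ∃ Θ : (ℂ × V × ℂ) ≃ₗ[ℂ] S.Cohomology,
      (∀ p q, Θ p * Θ q = Θ (p.1 * q.1, p.1 • q.2.1 + q.1 • p.2.1,
        p.1 * q.2.2 + q.1 * p.2.2 + B p.2.1 q.2.1)) ∧
      Θ (1, 0, 0) = 1 ∧ (∀ p, Θ p ∈ S.evenPart ↔ p.2.1 = 0) ∧
      ∀ p, Θ p ∈ S.oddPart ↔ p.1 = 0 ∧ p.2.2 = 0 := by
  obtain ⟨L, hL, hLB, hLsurj⟩ := exists_isometry_cocycles hS ho hg B hB hnd hV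
  obtain ⟨τ, hτ⟩ := exists_integral_eq_one hS o
  have hL0 : ∀ u c, S.d₀ c = L u → u = 0 := fun u c h => hnd u fun v => by
    rw [← hLB, ← h, integral_cup₁_d₀_left ho c (hL v)]
  have hτ0 : ∀ (r : ℂ) b, S.d₁ b = r • τ → r = 0 := fun r b h => by
    have := congrArg (integral o) h
    rwa [integral_d₁ ho, map_smul, hτ, smul_eq_mul, mul_one, eq_comm] at this
  obtain ⟨v₀⟩ := hS.nonempty
  -- the cocycle with constant part `p.1`, middle part `L p.2.1` and integral `p.2.2`
  let Ξ : (ℂ × V × ℂ) →ₗ[ℂ] S.cocycles :=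
    { toFun p := ⟨⟨fun _ => p.1, L p.2.1, p.2.2 • τ⟩, (d_eq_zero_iff _).2
        ⟨funext fun e => sub_self _, hL _⟩⟩
      map_add' p q := Subtype.ext (Cochain.ext rfl (map_add L _ _) (add_smul _ _ _))
      map_smul' r p := Subtype.ext (Cochain.ext rfl (map_smul L _ _) (mul_smul r p.2.2 τ)) }
  have hΞ0 : ∀ p, ((Ξ p : S.cocycles) : S.Cochain).c0 = fun _ => p.1 := fun _ => rfl
  have hΞ1 : ∀ p, ((Ξ p : S.cocycles) : S.Cochain).c1 = L p.2.1 := fun _ => rfl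
  have hΞ2 : ∀ p, ((Ξ p : S.cocycles) : S.Cochain).c2 = p.2.2 • τ := fun _ => rfl
  have hinj : Function.Injective (S.coclass.toLinearMap ∘ₗ Ξ) := by
    rw [← LinearMap.ker_eq_bot, LinearMap.ker_eq_bot']
    intro p hp
    have hp' : S.coclass (Ξ p) = S.coclass 0 := by rw [map_zero]; exact hp
    rw [coclass_eq_iff, exists_d_eq_iff] at hp'
    obtain ⟨h0, ⟨c, hc⟩, ⟨b, hb⟩⟩ := hp'
    simp only [ZeroMemClass.coe_zero, sub_zero, hΞ0, hΞ1, hΞ2] at h0 hc hb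
    exact Prod.ext (congrFun h0 v₀) (Prod.ext (hL0 _ c hc) (hτ0 _ b hb))
  have hsurj : Function.Surjective (S.coclass.toLinearMap ∘ₗ Ξ) := by
    intro y
    obtain ⟨z, rfl⟩ := Ideal.Quotient.mk_surjective y
    have hz : Cochain.d (z : S.Cochain) = 0 := z.2
    obtain ⟨hz0, hz1⟩ := (d_eq_zero_iff _).1 hz
    obtain ⟨u, c, huc⟩ := hLsurj _ hz1
    refine ⟨((z : S.Cochain).c0 v₀, u, integral o (z : S.Cochain).c2), ?_⟩
    refine (coclass_eq_iff _ _).2 ((exists_d_eq_iff _).2 ⟨?_, ⟨-c, ?_⟩, ?_⟩)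
    · rw [Cochain.sub_c0, hΞ0, sub_eq_zero]
      exact funext fun v => eq_of_d₀_eq_zero hS hz0 v₀ v
    · rw [Cochain.sub_c1, hΞ1, ← huc, map_neg]
      simp
    · rw [Cochain.sub_c2, hΞ2]
      exact exists_d₁_eq hS ho (by simp [hτ])
  let Θ := LinearEquiv.ofBijective (S.coclass.toLinearMap ∘ₗ Ξ) ⟨hinj, hsurj⟩
  have hΘ : ∀ p, Θ p = S.coclass (Ξ p) := fun _ => rfl
  refine ⟨Θ, fun p q => ?_, ?_, fun p => ?_, fun p => ?_⟩
  · rw [hΘ, hΘ, hΘ, ← map_mul, coclass_eq_iff, exists_d_eq_iff]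
    refine ⟨?_, ⟨0, ?_⟩, exists_d₁_eq hS ho ?_⟩
    · ext v
      simp [Cochain.sub_c0, hΞ0]
    · ext e
      simp [Cochain.sub_c1, hΞ0, hΞ1]
      ring
    · have e : ((Ξ p * Ξ q : S.cocycles) : S.Cochain).c2 =
          (p.1 * q.2.2) • τ + S.cup₁ (L p.2.1) (L q.2.1) + (q.1 * p.2.2) • τ := by
        ext t
        simp [hΞ0, hΞ1, hΞ2, cup₁_apply]
        ring
      rw [Cochain.sub_c2, hΞ2, e]
      simp only [map_sub, map_add, map_smul, hLB, hτ, smul_eq_mul, mul_one]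
      ring
  · rw [hΘ, ← map_one S.coclass]
    refine congrArg _ (Subtype.ext (Cochain.ext rfl (map_zero L) (zero_smul ℂ τ)))
  · constructor
    · rintro ⟨z, hz, hzp⟩
      obtain ⟨-, ⟨c, hc⟩, -⟩ := (exists_d_eq_iff _).1 ((coclass_eq_iff z (Ξ p)).1 hzp)
      have hz' : (z : S.Cochain).c1 = 0 := hz
      refine hL0 _ (-c) ?_
      rw [map_neg, hc, Cochain.sub_c1, hΞ1, hz', zero_sub, neg_neg]
    · intro hp
      refine ⟨Ξ p, ?_, rfl⟩
      change L p.2.1 = 0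
      rw [hp, map_zero]
  · constructor
    · rintro ⟨z, ⟨hz0, hz2⟩, hzp⟩
      obtain ⟨h0, -, ⟨b, hb⟩⟩ := (exists_d_eq_iff _).1 ((coclass_eq_iff z (Ξ p)).1 hzp)
      rw [Cochain.sub_c0, hΞ0, hz0, zero_sub, neg_eq_zero] at h0
      rw [Cochain.sub_c2, hΞ2, hz2, zero_sub] at hb
      refine ⟨congrFun h0 v₀, hτ0 _ (-b) ?_⟩
      rw [map_neg, hb, neg_neg]
    · rintro ⟨h0, h2⟩
      refine ⟨Ξ p, ⟨?_, ?_⟩, rfl⟩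
      · change (fun _ : S.V => p.1) = 0
        rw [h0]; rfl
      · change p.2.2 • τ = 0
        rw [h2, zero_smul]

end LG.Complex₂

/-! ### A computation with anticommuting elements -/

namespace LG

/-- Of the cube of a sum of commuting elements of square zero only the products of three different
elements survive. -/
theorem cube_of_commuting {R : Type*} [Ring R] (X : Fin 4 → R) (hsq : ∀ i, X i * X i = 0)
    (hc : ∀ i j, X i * X j = X j * X i) :
    (X 0 + X 1 + X 2 + X 3) ^ 3 =
      6 • (X 0 * X 1 * X 2 + X 0 * X 1 * X 3 + X 0 * X 2 * X 3 + X 1 * X 2 * X 3) := by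
  have c10 := hc 1 0
  have c20 := hc 2 0
  have c21 := hc 2 1
  have c30 := hc 3 0
  have c31 := hc 3 1
  have c32 := hc 3 2
  have l : ∀ {a b : R}, a * b = b * a → ∀ x, a * (b * x) = b * (a * x) := fun h x => by
    rw [← mul_assoc, h, mul_assoc]
  have l0 : ∀ i x, X i * (X i * x) = 0 := fun i x => by rw [← mul_assoc, hsq, zero_mul]
  rw [pow_three]
  simp only [mul_add, add_mul, mul_assoc, hsq, c10, c20, c21, c30, c31, c32, l c10, l c20, l c21,
    l c30, l c31, l c32, l0, mul_zero, add_zero, zero_add]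
  abel

/-- The cube of a quadratic element in anticommuting elements `pᵢ`, `qᵢ` of square zero, for the
shape of quadratic element that occurs in the structure constants: it is the sum of its parts
divisible by `p₀`, `p₁`, `p₂` and `q₀`, which commute and have square zero. -/
theorem cube_of_anticommuting {B R : Type*} [CommRing B] [Ring R] [Algebra B R] (p q : Fin 3 → R)
    (hp : ∀ i, p i * p i = 0) (hq : ∀ i, q i * q i = 0) (hpp : ∀ i j, p i * p j = -(p j * p i))
    (hqq : ∀ i j, q i * q j = -(q j * q i)) (hqp : ∀ i j, q i * p j = -(p j * q i))
    (d₀ d₁ d₂ e₁₀ e₂₀ e₂₁ a₁ a₂ c₁ c₂ : B) :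
    (d₀ • (p 0 * q 0) + (e₁₀ • (p 1 * q 0) + d₁ • (p 1 * q 1)) +
        (e₂₀ • (p 2 * q 0) + e₂₁ • (p 2 * q 1) + d₂ • (p 2 * q 2)) +
        (a₁ • (p 0 * p 1) + a₂ • (p 0 * p 2)) + (c₁ • (q 0 * q 1) + c₂ • (q 0 * q 2))) ^ 3 =
      (6 * (-(d₀ * d₁ * d₂) + d₂ * a₁ * c₁ + d₁ * a₂ * c₂ - e₂₁ * a₁ * c₂)) •
        (p 0 * p 1 * p 2 * (q 0 * q 1 * q 2)) := by
  have n : ∀ {a b : R}, a * b = -(b * a) → ∀ x, a * (b * x) = -(b * (a * x)) := fun h x => by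
    rw [← mul_assoc, h, neg_mul, mul_assoc]
  have z : ∀ {a : R}, a * a = 0 → ∀ x, a * (a * x) = 0 := fun h x => by
    rw [← mul_assoc, h, zero_mul]
  have p10 := hpp 1 0
  have p20 := hpp 2 0
  have p21 := hpp 2 1
  have q10 := hqq 1 0
  have q20 := hqq 2 0
  have q21 := hqq 2 1
  let X : Fin 4 → R := ![d₀ • (p 0 * q 0) + a₁ • (p 0 * p 1) + a₂ • (p 0 * p 2),
    e₁₀ • (p 1 * q 0) + d₁ • (p 1 * q 1),
    e₂₀ • (p 2 * q 0) + e₂₁ • (p 2 * q 1) + d₂ • (p 2 * q 2),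
    c₁ • (q 0 * q 1) + c₂ • (q 0 * q 2)]
  have h0 : X 0 = d₀ • (p 0 * q 0) + a₁ • (p 0 * p 1) + a₂ • (p 0 * p 2) := rfl
  have h1 : X 1 = e₁₀ • (p 1 * q 0) + d₁ • (p 1 * q 1) := rfl
  have h2 : X 2 = e₂₀ • (p 2 * q 0) + e₂₁ • (p 2 * q 1) + d₂ • (p 2 * q 2) := rfl
  have h3 : X 3 = c₁ • (q 0 * q 1) + c₂ • (q 0 * q 2) := rfl
  have hsq : X 0 * X 0 = 0 ∧ X 1 * X 1 = 0 ∧ X 2 * X 2 = 0 ∧ X 3 * X 3 = 0 := by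
    refine ⟨?_, ?_, ?_, ?_⟩ <;>
      simp only [h0, h1, h2, h3, mul_add, add_mul, smul_mul_assoc, mul_smul_comm, mul_assoc, hp,
        hq, z (hp _), z (hq _), hqp, n (hqp _ _), n p10, n p20, n q10, n q20, mul_neg, mul_zero,
        smul_zero, neg_zero, add_zero]
  have hc : (X 0 * X 1 = X 1 * X 0 ∧ X 0 * X 2 = X 2 * X 0 ∧ X 0 * X 3 = X 3 * X 0) ∧
      X 1 * X 2 = X 2 * X 1 ∧ X 1 * X 3 = X 3 * X 1 ∧ X 2 * X 3 = X 3 * X 2 := by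
    refine ⟨⟨?_, ?_, ?_⟩, ?_, ?_, ?_⟩ <;>
      (simp only [h0, h1, h2, h3, mul_add, add_mul, smul_mul_assoc, mul_smul_comm, mul_assoc, hq,
        z (hp _), z (hq _), hqp, n p10, n p20, n p21, n (hqp _ _), q10, q20, q21, n q10,
        n q20, smul_neg, mul_neg, neg_neg, mul_zero, smul_zero, neg_zero, add_zero]
       module)
  have key := cube_of_commuting X
    (by simpa [Fin.forall_fin_succ] using hsq)
    (by
      obtain ⟨⟨c01, c02, c03⟩, c12, c13, c23⟩ := hc
      intro i j
      fin_cases i <;> fin_cases j <;> first | rfl | assumption | (symm; assumption))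
  have hE : d₀ • (p 0 * q 0) + (e₁₀ • (p 1 * q 0) + d₁ • (p 1 * q 1)) +
        (e₂₀ • (p 2 * q 0) + e₂₁ • (p 2 * q 1) + d₂ • (p 2 * q 2)) +
        (a₁ • (p 0 * p 1) + a₂ • (p 0 * p 2)) + (c₁ • (q 0 * q 1) + c₂ • (q 0 * q 2)) =
      X 0 + X 1 + X 2 + X 3 := by
    rw [h0, h1, h2, h3]
    abel
  rw [hE, key]
  simp only [h0, h1, h2, h3, mul_add, add_mul, smul_mul_assoc, mul_smul_comm, mul_assoc, hq,
    z (hp _), z (hq _), n p21, n (hqp _ _), q10, q21, n q10, n q20, smul_neg, mul_neg, neg_mul,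
    neg_neg, mul_zero, smul_zero, neg_zero, add_zero, zero_add]
  module

end LG

/-! ### The Grassmann algebra and `Υ` -/

namespace LG

section Grassmann

variable {N : ℕ} {B : Type*} [CommRing B]

theorem gen_mul_self (i : Fin N) : (gen i : Grass N B) * gen i = 0 :=
  ExteriorAlgebra.ι_sq_zero _

theorem gen_mul_swap (i j : Fin N) : (gen i : Grass N B) * gen j = -(gen j * gen i) :=
  eq_neg_of_add_eq_zero_left (ExteriorAlgebra.ι_add_mul_swap _ _)

theorem gen_mem (i : Fin N) : (gen i : Grass N B) ∈ grassGrading N B 1 := by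
  simp only [grassGrading, pow_one]
  exact ⟨_, rfl⟩

/-- `a ↦ a ⊗ 1` is multiplicative. -/
theorem ten_one_mul (a b : Grass N B) : ten (a * b) 1 = ten a 1 * ten b 1 :=
  map_mul (GradedTensorProduct.includeLeft (grassGrading N B) (grassGrading N B)) a b

/-- `b ↦ 1 ⊗ b` is multiplicative. -/
theorem one_ten_mul (a b : Grass N B) : ten 1 (a * b) = ten 1 a * ten 1 b :=
  map_mul (GradedTensorProduct.includeRight (grassGrading N B) (grassGrading N B)) a b

theorem ten_eq_mul (a b : Grass N B) : ten a b = ten a 1 * ten 1 b :=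
  (GradedTensorProduct.tmul_one_mul_one_tmul (grassGrading N B) (grassGrading N B) a b).symm

/-- The sign rule of the graded tensor product for odd generators. -/
theorem one_ten_gen_mul_ten_gen_one (i j : Fin N) :
    (ten 1 (gen i) * ten (gen j) 1 : GrassSq N B) = -(ten (gen j) 1 * ten 1 (gen i)) := by
  have h := GradedTensorProduct.tmul_coe_mul_coe_tmul (grassGrading N B) (grassGrading N B)
    (1 : Grass N B) ⟨gen i, gen_mem i⟩ ⟨gen j, gen_mem j⟩ (1 : Grass N B)
  simp only [mul_one, one_mul] at h
  rw [← ten_eq_mul]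
  refine h.trans ?_
  rw [uzpow_one, Units.neg_smul, one_smul]
  rfl

theorem ten_one_smul (r : B) (a : Grass N B) : ten (r • a) 1 = r • ten a 1 :=
  map_smul (GradedTensorProduct.includeLeft (grassGrading N B) (grassGrading N B)) r a

theorem one_ten_smul (r : B) (a : Grass N B) : ten 1 (r • a) = r • ten 1 a :=
  map_smul (GradedTensorProduct.includeRight (grassGrading N B) (grassGrading N B)) r a

theorem ten_one_add (a b : Grass N B) : ten (a + b) 1 = ten a 1 + ten b 1 :=
  map_add (GradedTensorProduct.includeLeft (grassGrading N B) (grassGrading N B)) a b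

theorem one_ten_add (a b : Grass N B) : ten 1 (a + b) = ten 1 a + ten 1 b :=
  map_add (GradedTensorProduct.includeRight (grassGrading N B) (grassGrading N B)) a b

theorem ten_zero_one : (ten 0 1 : GrassSq N B) = 0 :=
  map_zero (GradedTensorProduct.includeLeft (grassGrading N B) (grassGrading N B))

theorem one_ten_zero : (ten 1 0 : GrassSq N B) = 0 :=
  map_zero (GradedTensorProduct.includeRight (grassGrading N B) (grassGrading N B))

theorem ten_neg_one (a : Grass N B) : ten (-a) 1 = -ten a 1 :=
  map_neg (GradedTensorProduct.includeLeft (grassGrading N B) (grassGrading N B)) a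

theorem one_ten_neg (a : Grass N B) : ten 1 (-a) = -ten 1 a :=
  map_neg (GradedTensorProduct.includeRight (grassGrading N B) (grassGrading N B)) a

theorem upsilon_ten (d : ℕ) (q₁ q₂ a b : Grass N B) :
    upsilon d q₁ q₂ (ten a b) = thetaAct N B a q₁ * thetaAct N B
      (((CliffordAlgebra.involute
          (Q := (0 : QuadraticForm B (Fin N → B)))).toLinearMap ^ d) b) q₂ := rfl

theorem thetaAct_gen (i : Fin N) : thetaAct N B (gen i) =
    CliffordAlgebra.contractLeft (Q := (0 : QuadraticForm B (Fin N → B)))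
      ((Pi.basisFun B (Fin N)).toDual (Pi.single i 1)) := by
  simp only [thetaAct, gen]
  exact ExteriorAlgebra.lift_ι_apply B _ _ _

/-- `θᵢ` acts as an odd derivation. -/
theorem thetaAct_gen_gen_mul (i j : Fin N) (x : Grass N B) :
    thetaAct N B (gen i) (gen j * x) =
      (if i = j then 1 else 0 : B) • x - gen j * thetaAct N B (gen i) x := by
  rw [thetaAct_gen]
  refine (CliffordAlgebra.contractLeft_ι_mul (Q := (0 : QuadraticForm B (Fin N → B)))
    ((Pi.basisFun B (Fin N)).toDual (Pi.single i 1)) (Pi.single j 1) x).trans ?_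
  congr 2
  simpa using (Pi.basisFun B (Fin N)).toDual_apply i j

theorem thetaAct_gen_one (i : Fin N) : thetaAct N B (gen i) 1 = 0 := by
  rw [thetaAct_gen]
  exact CliffordAlgebra.contractLeft_one _ _

theorem thetaAct_gen_gen (i j : Fin N) :
    thetaAct N B (gen i) (gen j) = if i = j then 1 else 0 := by
  have h := thetaAct_gen_gen_mul i j (1 : Grass N B)
  rw [mul_one, thetaAct_gen_one, mul_zero, sub_zero] at h
  rw [h]
  split_ifs <;> simp

theorem monomialBasis_empty : monomialBasis N B ∅ = 1 := by
  rw [monomialBasis, ExteriorAlgebra.basis_apply_ofCard (n := 0) _ Finset.card_empty]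
  exact ExteriorAlgebra.ιMulti_zero_apply _

theorem monomialBasis_univ : monomialBasis 3 B Finset.univ = gen 0 * gen 1 * gen 2 := by
  rw [monomialBasis, ExteriorAlgebra.basis_apply_ofCard (n := 3) _ (by simp)]
  have h : ∀ i : Fin 3, Set.powersetCard.ofFinEmbEquiv.symm
      (Set.powersetCard.ofCard (s := (Finset.univ : Finset (Fin 3))) (n := 3) (by simp)) i = i := by
    intro i
    rw [Set.powersetCard.ofFinEmbEquiv_symm_apply]
    have := Finset.orderEmbOfFin_unique (s := (Finset.univ : Finset (Fin 3))) (k := 3) (by simp)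
      (f := id) (fun x => Finset.mem_univ _) strictMono_id
    exact (congrFun this i).symm
  rw [ExteriorAlgebra.ιMulti_family, ExteriorAlgebra.ιMulti_apply]
  simp only [Function.comp_apply, h]
  simp [List.ofFn_succ, gen, mul_assoc]

theorem involute_gen (i : Fin N) : CliffordAlgebra.involute
    (Q := (0 : QuadraticForm B (Fin N → B))) (gen i) = -gen i :=
  CliffordAlgebra.involute_ι _

theorem monomialCoeff_monomialBasis (I : Finset (Fin N)) :
    monomialCoeff I (monomialBasis N B I) = 1 := by
  rw [monomialCoeff, Module.Basis.coord_apply, Module.Basis.repr_self, Finsupp.single_eq_same]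

theorem monomialCoeff_empty_one : monomialCoeff ∅ (1 : Grass N B) = 1 := by
  rw [← monomialBasis_empty, monomialCoeff_monomialBasis]

/-- The value of `Υ` on the top element `θ₀θ₁θ₂ ⊗ θ₀θ₁θ₂`: each of the two factors contributes
`θ₀θ₁θ₂ (∂₀∂₁∂₂) = -1`, and the Koszul sign is `(-1)^{3 · 3} = -1`. -/
theorem monomialCoeff_upsilon_top :
    monomialCoeff ∅ (upsilon 3 (monomialBasis 3 B Finset.univ) (monomialBasis 3 B Finset.univ)
      (ten (gen 0 * gen 1 * gen 2) (gen 0 * gen 1 * gen 2))) = -1 := by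
  have htop : thetaAct 3 B (gen 0 * gen 1 * gen 2) (gen 0 * gen 1 * gen 2) = -1 := by
    simp [mul_assoc, thetaAct_gen_gen_mul, thetaAct_gen_gen]
  have hinv : ((CliffordAlgebra.involute
      (Q := (0 : QuadraticForm B (Fin 3 → B)))).toLinearMap ^ 3)
        (gen 0 * gen 1 * gen 2 : Grass 3 B) = -(gen 0 * gen 1 * gen 2 : Grass 3 B) := by
    have h1 : CliffordAlgebra.involute
        (Q := (0 : QuadraticForm B (Fin 3 → B))) (gen 0 * gen 1 * gen 2 : Grass 3 B) =
        -(gen 0 * gen 1 * gen 2 : Grass 3 B) := by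
      have h2 := map_mul (CliffordAlgebra.involute (Q := (0 : QuadraticForm B (Fin 3 → B))))
        (gen 0 * gen 1 : Grass 3 B) (gen 2 : Grass 3 B)
      have h3 := map_mul (CliffordAlgebra.involute (Q := (0 : QuadraticForm B (Fin 3 → B))))
        (gen 0 : Grass 3 B) (gen 1 : Grass 3 B)
      refine h2.trans ?_
      rw [h3, involute_gen, involute_gen, involute_gen]
      exact (by noncomm_ring : -gen 0 * -gen 1 * -gen 2 = -(gen 0 * gen 1 * gen 2 : Grass 3 B))
    rw [pow_three, Module.End.mul_apply, Module.End.mul_apply]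
    simp only [AlgHom.toLinearMap_apply]
    have hn := fun x : Grass 3 B => map_neg (CliffordAlgebra.involute
      (Q := (0 : QuadraticForm B (Fin 3 → B)))) x
    have h4 := (congrArg (CliffordAlgebra.involute
      (Q := (0 : QuadraticForm B (Fin 3 → B)))) h1).trans ((hn _).trans (congrArg Neg.neg h1))
    refine (congrArg (CliffordAlgebra.involute
      (Q := (0 : QuadraticForm B (Fin 3 → B)))) h4).trans ?_
    refine (congrArg (CliffordAlgebra.involute
      (Q := (0 : QuadraticForm B (Fin 3 → B)))) (neg_neg _)).trans h1
  rw [monomialBasis_univ, upsilon_ten, hinv, map_neg, LinearMap.neg_apply, htop, neg_neg, mul_one,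
    map_neg, monomialCoeff_empty_one]

theorem upsilon_one (d : ℕ) (q₁ q₂ : Grass N B) : upsilon d q₁ q₂ 1 = q₁ * q₂ := by
  have h1 : (((CliffordAlgebra.involute
      (Q := (0 : QuadraticForm B (Fin N → B)))).toLinearMap ^ d) 1 : Grass N B) = 1 := by
    induction d with
    | zero => rfl
    | succ d ih =>
      rw [pow_succ, Module.End.mul_apply]
      exact (congrArg ((CliffordAlgebra.involute
        (Q := (0 : QuadraticForm B (Fin N → B)))).toLinearMap ^ d) (map_one
        (CliffordAlgebra.involute (Q := (0 : QuadraticForm B (Fin N → B)))))).trans ih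
  refine (upsilon_ten d q₁ q₂ 1 1).trans ?_
  rw [h1, map_one, Module.End.one_apply, Module.End.one_apply]

/-- The coefficient that enters the structure constant of two elements moving all variables,
the coefficients at `θ₁θ₂ ⊗ 1` and `1 ⊗ θ₁θ₂` being zero. -/
theorem monomialCoeff_upsilon_cube (d₀ d₁ d₂ e₁₀ e₂₀ e₂₁ a₁ a₂ c₁ c₂ : B) :
    monomialCoeff ∅ (upsilon 3 (monomialBasis 3 B Finset.univ) (monomialBasis 3 B Finset.univ)
      ((d₀ • ten (gen 0) (gen 0) + (e₁₀ • ten (gen 1) (gen 0) + d₁ • ten (gen 1) (gen 1)) +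
        (e₂₀ • ten (gen 2) (gen 0) + e₂₁ • ten (gen 2) (gen 1) + d₂ • ten (gen 2) (gen 2)) +
        ten (a₁ • (gen 0 * gen 1) + a₂ • (gen 0 * gen 2)) 1 +
        ten 1 (c₁ • (gen 0 * gen 1) + c₂ • (gen 0 * gen 2))) ^ 3)) =
      6 * (d₀ * d₁ * d₂ - d₂ * a₁ * c₁ - d₁ * a₂ * c₂ + e₂₁ * a₁ * c₂) := by
  simp only [ten_one_add, one_ten_add, ten_one_smul, one_ten_smul, ten_one_mul, one_ten_mul,
    ten_eq_mul (gen _) (gen _)]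
  rw [cube_of_anticommuting (fun i => ten (gen i) 1) (fun i => ten 1 (gen i))
    (fun i => by rw [← ten_one_mul, gen_mul_self]; exact ten_zero_one)
    (fun i => by rw [← one_ten_mul, gen_mul_self]; exact one_ten_zero)
    (fun i j => by rw [← ten_one_mul, ← ten_one_mul, gen_mul_swap]; exact ten_neg_one _)
    (fun i j => by rw [← one_ten_mul, ← one_ten_mul, gen_mul_swap]; exact one_ten_neg _)
    (fun i j => one_ten_gen_mul_ten_gen_one i j)]
  simp only [← ten_one_mul, ← one_ten_mul]
  rw [← ten_eq_mul, map_smul, map_smul, monomialCoeff_upsilon_top]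
  rw [smul_eq_mul]
  ring

end Grassmann

end LG

/-! ### Regular functions and Milnor algebras -/

namespace LG

namespace Orbifold

variable {K : Type*} [Field K] {N : ℕ} (P : Orbifold K N)

/-- The class in `M(W^g)`, as an algebra homomorphism on polynomials. -/
def polyHom (g : Fin N → Kˣ) : MvPolynomial (Fin N) K →ₐ[K] P.Milnor g :=
  (P.cls g).comp ((Algebra.ofId (MvPolynomial (Fin N) K) P.Reg).restrictScalars K)

theorem polyHom_apply (g : Fin N → Kˣ) (f : MvPolynomial (Fin N) K) :
    P.polyHom g f = P.cls g (algebraMap _ P.Reg f) := rfl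

theorem cls_eq_zero_iff (g : Fin N → Kˣ) (r : P.Reg) :
    P.cls g r = 0 ↔ r ∈ P.milnorIdeal g := Ideal.Quotient.eq_zero_iff_mem

theorem cls_surjective (g : Fin N → Kˣ) : Function.Surjective (P.cls g) :=
  Ideal.Quotient.mk_surjective

theorem eval_zero_denoms_ne_zero {s : MvPolynomial (Fin N) K} (hs : s ∈ P.denoms) :
    MvPolynomial.aeval (0 : Fin N → K) s ≠ 0 := by
  induction hs using Submonoid.closure_induction with
  | mem x hx =>
    obtain ⟨i, c, hc, rfl⟩ := hx
    simpa using P.ne_zero i c hc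
  | one => simp
  | mul x y _ _ hx hy => rw [map_mul]; exact mul_ne_zero hx hy

/-- The value of a regular function at the origin. -/
def evalZero : P.Reg →ₐ[K] K :=
  IsLocalization.liftAlgHom (M := P.denoms) (f := MvPolynomial.aeval (0 : Fin N → K))
    fun s => (P.eval_zero_denoms_ne_zero s.2).isUnit

theorem evalZero_algebraMap (f : MvPolynomial (Fin N) K) :
    P.evalZero (algebraMap _ P.Reg f) = MvPolynomial.aeval (0 : Fin N → K) f := by
  simp [evalZero]

/-- An ideal that contains the variables contains all polynomials without constant term. -/
theorem algebraMap_mem_of_aeval_zero {I : Ideal P.Reg}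
    (hI : ∀ i, algebraMap (MvPolynomial (Fin N) K) P.Reg (MvPolynomial.X i) ∈ I)
    {p : MvPolynomial (Fin N) K} (hp : MvPolynomial.aeval (0 : Fin N → K) p = 0) :
    algebraMap _ P.Reg p ∈ I := by
  have h : ∀ p : MvPolynomial (Fin N) K,
      algebraMap _ P.Reg (p - MvPolynomial.C (MvPolynomial.aeval (0 : Fin N → K) p)) ∈ I := by
    intro p
    induction p using MvPolynomial.induction_on with
    | C a => simp
    | add p q hp hq =>
      rw [map_add, MvPolynomial.C_add, add_sub_add_comm, map_add]
      exact I.add_mem hp hq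
    | mul_X p i _ =>
      rw [map_mul, MvPolynomial.aeval_X, Pi.zero_apply, mul_zero, MvPolynomial.C_0, sub_zero,
        map_mul]
      exact I.mul_mem_left _ (hI i)
  simpa [hp] using h p

/-- If all variables are moved by `g`, then `M(W^g)` is the residue field at the origin. -/
theorem milnorIdeal_eq_ker {g : Fin N → Kˣ} (hg : movedIdx g = Finset.univ) :
    P.milnorIdeal g = RingHom.ker P.evalZero := by
  apply le_antisymm
  · rw [milnorIdeal, Ideal.span_le]
    rintro r (⟨i, hi, rfl⟩ | ⟨i, hi, rfl⟩)
    · simp [evalZero_algebraMap]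
    · exact absurd (hg ▸ Finset.mem_univ i) hi
  · intro r hr
    obtain ⟨p, s, rfl⟩ := IsLocalization.exists_mk'_eq P.denoms r
    have hps : IsLocalization.mk' P.Reg p s * algebraMap _ P.Reg (s : MvPolynomial (Fin N) K) =
        algebraMap _ P.Reg p := IsLocalization.mk'_spec _ _ _
    have hp : MvPolynomial.aeval (0 : Fin N → K) p = 0 := by
      rw [← evalZero_algebraMap, ← hps, map_mul, (RingHom.mem_ker).1 hr, zero_mul]
    rw [← Ideal.mul_unit_mem_iff_mem _ (IsLocalization.map_units P.Reg s), hps]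
    exact P.algebraMap_mem_of_aeval_zero
      (fun i => Ideal.subset_span (Or.inl ⟨i, hg ▸ Finset.mem_univ i, rfl⟩)) hp

end Orbifold

/-! ### The Milnor algebra of the cusp -/

theorem mem_cuspGroup_iff (g : ℕ) (h : Fin 3 → ℂˣ) :
    h ∈ cuspGroup g ↔ ∃ ζ : ℂˣ, ζ ^ (2 * g + 1) = 1 ∧ cuspHom ζ = h := by
  simp [cuspGroup, Subgroup.mem_map, mem_rootsOfUnity]

theorem movedIdx_one {K : Type*} [Field K] {N : ℕ} : movedIdx (1 : Fin N → Kˣ) = ∅ := by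
  simp [movedIdx]

theorem movedIdx_cuspHom {g : ℕ} {ζ : ℂˣ} (hζ : ζ ^ (2 * g + 1) = 1) (h1 : ζ ≠ 1) :
    movedIdx (cuspHom ζ) = Finset.univ := by
  have h2 : ζ ^ 2 ≠ 1 := fun h2 => h1 (by
    rwa [pow_succ, pow_mul, h2, one_pow, one_mul] at hζ)
  simp only [movedIdx, Finset.filter_eq_self]
  intro i _
  fin_cases i
  · exact h1
  · exact h1
  · change ζ⁻¹ ^ 2 ≠ 1
    rwa [inv_pow, Ne, inv_eq_one]

theorem movedIdx_of_mem {g : ℕ} {h : Fin 3 → ℂˣ} (hh : h ∈ cuspGroup g) (h1 : h ≠ 1) :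
    movedIdx h = Finset.univ := by
  obtain ⟨ζ, hζ, rfl⟩ := (mem_cuspGroup_iff g h).1 hh
  exact movedIdx_cuspHom hζ fun h => h1 (by rw [h, map_one])

theorem pderiv_cuspW_zero (g : ℕ) : MvPolynomial.pderiv 0 (cuspW g) =
    (2 * g + 1 : ℂ) • MvPolynomial.X 0 ^ (2 * g) - MvPolynomial.X 1 * MvPolynomial.X 2 := by
  have h2 : (MvPolynomial.C 2 : MvPolynomial (Fin 3) ℂ) = 2 := map_ofNat _ 2
  simp [cuspW, MvPolynomial.pderiv_X, MvPolynomial.smul_eq_C_mul, Derivation.leibniz,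
    Derivation.leibniz_pow, h2, mul_comm]

theorem pderiv_cuspW_one (g : ℕ) : MvPolynomial.pderiv 1 (cuspW g) =
    (2 * g + 1 : ℂ) • MvPolynomial.X 1 ^ (2 * g) - MvPolynomial.X 0 * MvPolynomial.X 2 := by
  have h2 : (MvPolynomial.C 2 : MvPolynomial (Fin 3) ℂ) = 2 := map_ofNat _ 2
  simp [cuspW, MvPolynomial.pderiv_X, MvPolynomial.smul_eq_C_mul, Derivation.leibniz,
    Derivation.leibniz_pow, h2, mul_comm]

theorem pderiv_cuspW_two (g : ℕ) : MvPolynomial.pderiv 2 (cuspW g) =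
    (2 * g + 1 : ℂ) • MvPolynomial.X 2 ^ (2 * g) - MvPolynomial.X 0 * MvPolynomial.X 1 := by
  have h2 : (MvPolynomial.C 2 : MvPolynomial (Fin 3) ℂ) = 2 := map_ofNat _ 2
  simp [cuspW, MvPolynomial.pderiv_X, MvPolynomial.smul_eq_C_mul, Derivation.leibniz,
    Derivation.leibniz_pow, h2, mul_comm]

/-- The relations of the Milnor algebra of the cusp make `x²y` equal to `n³ (xyz)^{n-3} x²y`. -/
theorem sq_mul_eq_zero_of_relations {A : Type*} [CommRing A] [Algebra ℂ A] (n : ℂ) (k : ℕ)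
    {x y z : A} (hx : n • x ^ (k + 2) = y * z) (hy : n • y ^ (k + 2) = x * z)
    (hz : n • z ^ (k + 2) = x * y) (hu : IsUnit (1 - n ^ 3 • (x * y * z) ^ k)) :
    x ^ 2 * y = 0 := by
  apply (hu.mul_left_eq_zero).1
  simp only [Algebra.smul_def, map_pow] at *
  set a := algebraMap ℂ A n
  have h1 : x ^ 2 * y = a ^ 3 * (x ^ (k + 2) * y ^ (k + 1) * z ^ k) := by
    linear_combination (-x) * hz - a * z ^ (k + 1) * hy - a ^ 2 * y ^ (k + 1) * z ^ k * hx
  linear_combination h1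

/-- The properties of the homomorphism from polynomials to the Milnor algebra of the cusp that
determine the structure of the latter: the partial derivatives of `W` are mapped to `0`, and the
equations of the removed hyperplanes to units. -/
structure IsCuspHom {A : Type*} [CommRing A] [Algebra ℂ A] (g : ℕ) (pts : Fin 3 → Finset ℂ)
    (π : MvPolynomial (Fin 3) ℂ →ₐ[ℂ] A) : Prop where
  two_le : 2 ≤ g
  suitable : IsSuitable g pts
  pderiv : ∀ i, π (MvPolynomial.pderiv i (cuspW g)) = 0
  isUnit : ∀ i, ∀ c ∈ pts i, IsUnit (π (MvPolynomial.X i - MvPolynomial.C c))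

theorem two_mul_add_one_ne_zero (g : ℕ) : (2 * g + 1 : ℂ) ≠ 0 := by
  exact_mod_cast Nat.succ_ne_zero (2 * g)

namespace IsCuspHom

variable {A : Type*} [CommRing A] [Algebra ℂ A] {g : ℕ} {pts : Fin 3 → Finset ℂ}
  {π : MvPolynomial (Fin 3) ℂ →ₐ[ℂ] A}

/-- By the Nullstellensatz, a polynomial that vanishes at no critical point other than those on
the removed hyperplanes becomes invertible; the polynomial of the statement takes the value `1`
at the origin, the only critical point that is left. -/
theorem isUnit_one_sub (hπ : IsCuspHom g pts π) (c : ℂ) :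
    IsUnit (π (1 - c • (MvPolynomial.X 0 * MvPolynomial.X 1 * MvPolynomial.X 2) ^
      (2 * g - 2))) := by
  have hg := hπ.two_le
  set U : MvPolynomial (Fin 3) ℂ :=
    1 - c • (MvPolynomial.X 0 * MvPolynomial.X 1 * MvPolynomial.X 2) ^ (2 * g - 2) with hU
  let J : Ideal (MvPolynomial (Fin 3) ℂ) :=
    Ideal.span (insert U (Set.range fun i => MvPolynomial.pderiv i (cuspW g)))
  let s : MvPolynomial (Fin 3) ℂ := ∏ i, ∏ a ∈ pts i, (MvPolynomial.X i - MvPolynomial.C a)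
  have hrad : s ∈ J.radical := by
    rw [← MvPolynomial.vanishingIdeal_zeroLocus_eq_radical (K := ℂ)]
    intro p hp
    have hp0 : p ≠ 0 := by
      rintro rfl
      have h1 := hp U (Ideal.subset_span (Set.mem_insert _ _))
      have h2 : 2 * g - 2 ≠ 0 := by omega
      simp [hU, h2] at h1
    obtain ⟨i, hi⟩ := hπ.suitable.removes p ⟨hp0, fun i => by
      have h1 := hp _ (Ideal.subset_span (Set.mem_insert_of_mem _ ⟨i, rfl⟩))
      rwa [MvPolynomial.aeval_eq_eval] at h1⟩
    rw [map_prod]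
    refine Finset.prod_eq_zero (Finset.mem_univ i) ?_
    rw [map_prod]
    refine Finset.prod_eq_zero hi ?_
    simp
  obtain ⟨m, hm⟩ := hrad
  have hJ : J ≤ (Ideal.span {π U}).comap π := by
    refine Ideal.span_le.2 ?_
    rintro _ (rfl | ⟨i, rfl⟩)
    · exact Ideal.subset_span rfl
    · change _ ∈ Ideal.span _
      rw [hπ.pderiv]
      exact Ideal.zero_mem _
  refine isUnit_of_dvd_unit (Ideal.mem_span_singleton.1 (Ideal.mem_comap.1 (hJ hm))) ?_
  simp only [s, map_pow, map_prod]
  exact (IsUnit.prod_iff.2 fun i _ => IsUnit.prod_iff.2 fun a ha => hπ.isUnit i a ha).pow m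

theorem relations (hπ : IsCuspHom g pts π) {i j k : Fin 3} (hij : i ≠ j) (hik : i ≠ k)
    (hjk : j ≠ k) : (2 * g + 1 : ℂ) • π (.X i) ^ (2 * g) = π (.X j) * π (.X k) := by
  have h0 := hπ.pderiv 0
  have h1 := hπ.pderiv 1
  have h2 := hπ.pderiv 2
  rw [pderiv_cuspW_zero, map_sub, sub_eq_zero, map_smul, map_pow, map_mul] at h0
  rw [pderiv_cuspW_one, map_sub, sub_eq_zero, map_smul, map_pow, map_mul] at h1
  rw [pderiv_cuspW_two, map_sub, sub_eq_zero, map_smul, map_pow, map_mul] at h2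
  fin_cases i <;> fin_cases j <;> fin_cases k <;>
    first
    | exact absurd rfl hij
    | exact absurd rfl hik
    | exact absurd rfl hjk
    | exact h0
    | exact h1
    | exact h2
    | exact h0.trans (mul_comm _ _)
    | exact h1.trans (mul_comm _ _)
    | exact h2.trans (mul_comm _ _)

theorem phi_eq {i j k : Fin 3} (hij : i ≠ j) (hik : i ≠ k) (hjk : j ≠ k) :
    π (.X 0 * .X 1 * .X 2) = π (.X i) * π (.X j) * π (.X k) := by
  have h : (MvPolynomial.X 0 * MvPolynomial.X 1 * MvPolynomial.X 2 : MvPolynomial (Fin 3) ℂ) =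
      .X i * .X j * .X k := by
    fin_cases i <;> fin_cases j <;> fin_cases k <;>
      first
      | exact absurd rfl hij
      | exact absurd rfl hik
      | exact absurd rfl hjk
      | rfl
      | (dsimp only [Fin.mk_zero, Fin.mk_one, Fin.reduceFinMk, Fin.zero_eta, Fin.isValue]; ring)
  rw [h, map_mul, map_mul]

theorem exists_third (i j : Fin 3) (hij : i ≠ j) : ∃ k, i ≠ k ∧ j ≠ k := by
  revert i j
  decide

/-- The factor `1 - n³ (xyz)^{n-3}` being invertible, the relations give `xᵢ² xⱼ = 0`. -/
theorem sq_mul (hπ : IsCuspHom g pts π) (i j : Fin 3) (hij : i ≠ j) :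
    π (.X i) ^ 2 * π (.X j) = 0 := by
  have hg := hπ.two_le
  obtain ⟨k, hik, hjk⟩ := exists_third i j hij
  have hu := hπ.isUnit_one_sub ((2 * g + 1 : ℂ) ^ 3)
  rw [map_sub, map_one, map_smul, map_pow, phi_eq hij hik hjk] at hu
  have hk : 2 * g - 2 + 2 = 2 * g := by omega
  exact sq_mul_eq_zero_of_relations (2 * g + 1 : ℂ) (2 * g - 2)
    (by rw [hk, hπ.relations hij hik hjk]) (by rw [hk, hπ.relations hij.symm hjk hik])
    (by rw [hk, hπ.relations hik.symm hjk.symm hij]) hu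

/-- `φ = x₁x₂x₃` is annihilated by the variables. -/
theorem X_mul_phi (hπ : IsCuspHom g pts π) (i : Fin 3) :
    π (.X i) * π (.X 0 * .X 1 * .X 2) = 0 := by
  obtain ⟨j, hij⟩ : ∃ j, i ≠ j := exists_ne i |>.imp fun _ h => h.symm
  obtain ⟨k, hik, hjk⟩ := exists_third i j hij
  rw [phi_eq hij hik hjk]
  linear_combination π (.X k) * hπ.sq_mul i j hij

theorem X_pow_eq (hπ : IsCuspHom g pts π) (i : Fin 3) :
    π (.X i) ^ (2 * g + 1) = (2 * g + 1 : ℂ)⁻¹ • π (.X 0 * .X 1 * .X 2) := by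
  obtain ⟨j, hij⟩ : ∃ j, i ≠ j := exists_ne i |>.imp fun _ h => h.symm
  obtain ⟨k, hik, hjk⟩ := exists_third i j hij
  rw [eq_inv_smul_iff₀ (two_mul_add_one_ne_zero g), pow_succ, ← smul_mul_assoc,
    hπ.relations hij hik hjk, phi_eq hij hik hjk]
  ring

theorem X_pow_eq_zero (hπ : IsCuspHom g pts π) (i : Fin 3) {m : ℕ} (hm : 2 * g + 2 ≤ m) :
    π (.X i) ^ m = 0 := by
  obtain ⟨k, rfl⟩ := Nat.exists_eq_add_of_le hm
  rw [show 2 * g + 2 + k = 2 * g + 1 + (1 + k) by ring, pow_add, hπ.X_pow_eq, pow_add,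
    pow_one, smul_mul_assoc, ← mul_assoc, mul_comm (π (_ * _)), hπ.X_mul_phi, zero_mul, smul_zero]

/-- The variables being nilpotent, the inverses of the equations of the removed hyperplanes are
classes of polynomials. -/
theorem exists_inv (hπ : IsCuspHom g pts π) (s : MvPolynomial (Fin 3) ℂ)
    (hs : s ∈ Submonoid.closure {p | ∃ i, ∃ c ∈ pts i, p = MvPolynomial.X i - MvPolynomial.C c}) :
    ∃ t, π s * π t = 1 := by
  induction hs using Submonoid.closure_induction with
  | mem s hs =>
    obtain ⟨i, c, hc, rfl⟩ := hs
    have hc0 : c ≠ 0 := hπ.suitable.ne_zero i c hc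
    refine ⟨(-(c ^ (2 * g + 2))⁻¹) • ∑ l ∈ Finset.range (2 * g + 2), MvPolynomial.X i ^ l *
      MvPolynomial.C c ^ (2 * g + 2 - 1 - l), ?_⟩
    have hgeom := (Commute.all (MvPolynomial.X i : MvPolynomial (Fin 3) ℂ)
      (MvPolynomial.C c)).geom_sum₂_mul (2 * g + 2)
    rw [← map_mul, mul_smul_comm, mul_comm (_ - _), hgeom, map_smul, map_sub, map_pow,
      hπ.X_pow_eq_zero i le_rfl, ← MvPolynomial.C_pow, zero_sub,
      smul_neg, neg_smul, neg_neg, ← map_smul, MvPolynomial.smul_eq_C_mul, ← MvPolynomial.C_mul,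
      inv_mul_cancel₀ (pow_ne_zero _ hc0), MvPolynomial.C_1, map_one]
  | one => exact ⟨1, by simp⟩
  | mul s s' _ _ h1 h2 =>
    obtain ⟨t, ht⟩ := h1
    obtain ⟨t', ht'⟩ := h2
    refine ⟨t * t', ?_⟩
    rw [map_mul, map_mul, mul_mul_mul_comm, ht, ht', one_mul]

/-- A monomial whose weight is invariant under `(ω, ω, ω⁻²)` is a multiple of `1` or of `φ`. -/
theorem monomial_mem_span (hπ : IsCuspHom g pts π) (a b c : ℕ)
    (hw : a + b ≡ 2 * c [MOD 2 * g + 1]) :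
    π (.X 0) ^ a * π (.X 1) ^ b * π (.X 2) ^ c ∈ Submodule.span ℂ {1, π (.X 0 * .X 1 * .X 2)} := by
  have hg := hπ.two_le
  set S := Submodule.span ℂ {1, π (.X 0 * .X 1 * .X 2)} with hS
  have h1 : (1 : A) ∈ S := Submodule.subset_span (by simp)
  have hphi : π (.X 0 * .X 1 * .X 2) ∈ S := Submodule.subset_span (by simp)
  -- a pure power
  have hpow : ∀ i m, (m = 0 ∨ 2 * g + 1 ≤ m) → π (.X i) ^ m ∈ S := by
    rintro i m (rfl | hm)
    · rwa [pow_zero]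
    · rcases hm.eq_or_lt with rfl | hm
      · rw [hπ.X_pow_eq]
        exact S.smul_mem _ hphi
      · rw [hπ.X_pow_eq_zero i hm]
        exact S.zero_mem
  -- a product of powers of two different variables
  have hmix : ∀ i j, i ≠ j → ∀ p q, 1 ≤ p → 1 ≤ q → 3 ≤ p + q → ∀ r,
      π (.X i) ^ p * π (.X j) ^ q * r ∈ S := by
    intro i j hij p q hp hq hpq r
    rcases Nat.lt_or_ge 1 p with h | h
    · obtain ⟨p, rfl⟩ := Nat.exists_eq_add_of_le h
      obtain ⟨q, rfl⟩ := Nat.exists_eq_add_of_le hq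
      rw [show π (.X i) ^ (1 + 1 + p) * π (.X j) ^ (1 + q) * r =
        (π (.X i) ^ 2 * π (.X j)) * (π (.X i) ^ p * π (.X j) ^ q * r) by ring, hπ.sq_mul i j hij,
        zero_mul]
      exact S.zero_mem
    · have h' : 2 ≤ q := by omega
      obtain ⟨p, rfl⟩ := Nat.exists_eq_add_of_le hp
      obtain ⟨q, rfl⟩ := Nat.exists_eq_add_of_le h'
      rw [show π (.X i) ^ (1 + p) * π (.X j) ^ (2 + q) * r =
        (π (.X j) ^ 2 * π (.X i)) * (π (.X i) ^ p * π (.X j) ^ q * r) by ring,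
        hπ.sq_mul j i hij.symm, zero_mul]
      exact S.zero_mem
  have hdvd : (2 * g + 1 : ℤ) ∣ 2 * c - (a + b) := by
    have := (Nat.modEq_iff_dvd).1 hw
    push_cast at this
    exact this
  obtain ⟨k, hk⟩ := hdvd
  have hsmall : -(2 * g : ℤ) ≤ 2 * c - (a + b) → 2 * c - (a + b) ≤ (2 * g : ℤ) →
      (2 * c - (a + b) : ℤ) = 0 := by
    intro h1 h2
    rw [hk] at h1 h2 ⊢
    rcases lt_trichotomy k 0 with h | rfl | h
    · nlinarith
    · simp
    · nlinarith
  rcases Nat.eq_zero_or_pos a with rfl | ha <;> rcases Nat.eq_zero_or_pos b with rfl | hb <;>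
    rcases Nat.eq_zero_or_pos c with rfl | hc
  · simpa using h1
  · rw [pow_zero, pow_zero, one_mul, one_mul]
    refine hpow 2 c (Or.inr ?_)
    by_contra hlt
    -- `2c` is a multiple of the odd number `2g + 1` strictly between `0` and twice that number
    push_cast at hk
    have hk2 : k < 2 := by nlinarith
    have hk0 : 0 < k := by nlinarith
    obtain rfl : k = 1 := by omega
    omega
  · rw [pow_zero, pow_zero, one_mul, mul_one]
    exact hpow 1 b (by omega)
  · rw [pow_zero, one_mul, ← mul_one (_ * _)]
    exact hmix 1 2 (by decide) b c hb hc (by omega) 1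
  · rw [pow_zero, pow_zero, mul_one, mul_one]
    exact hpow 0 a (by omega)
  · rw [pow_zero, mul_one, ← mul_one (_ * _)]
    exact hmix 0 2 (by decide) a c ha hc (by omega) 1
  · exact hmix 0 1 (by decide) a b ha hb (by omega) _
  · by_cases hab : 3 ≤ a + b
    · exact hmix 0 1 (by decide) a b ha hb hab _
    · obtain rfl : a = 1 := by omega
      obtain rfl : b = 1 := by omega
      rcases (show c = 1 ∨ 1 < c by omega) with rfl | hc
      · simpa using hphi
      · rw [mul_assoc, mul_comm]
        exact hmix 1 2 (by decide) 1 c le_rfl (by omega) (by omega) _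

end IsCuspHom

section Cusp

variable {g : ℕ} {pts : Fin 3 → Finset ℂ} (h : IsSuitable g pts) {e : Fin 3 → ℂˣ}

theorem restrict_one {K : Type*} [Field K] {N : ℕ} (f : MvPolynomial (Fin N) K) :
    restrict (1 : Fin N → Kˣ) f = f := by
  have : fixedPoint (1 : Fin N → Kˣ) = MvPolynomial.X := by
    ext1 i
    simp [fixedPoint, movedIdx_one]
  rw [restrict, this, MvPolynomial.aeval_X_left_apply]

theorem isCuspHom_polyHom (hg : 2 ≤ g) (he : e = 1) :
    IsCuspHom (A := (cusp g pts h).Milnor e) g pts ((cusp g pts h).polyHom e) where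
  two_le := hg
  suitable := h
  pderiv i := by
    subst he
    rw [Orbifold.polyHom_apply, Orbifold.cls_eq_zero_iff]
    refine Ideal.subset_span (Or.inr ⟨i, by simp [movedIdx_one], ?_⟩)
    rw [restrict_one]
    rfl
  isUnit i c hc := (IsLocalization.map_units (cusp g pts h).Reg
    (⟨_, Submonoid.subset_closure ⟨i, c, hc, rfl⟩⟩ : (cusp g pts h).denoms)).map
      ((cusp g pts h).cls e)

/-- Every class in `M(W)` is the class of a polynomial. -/
theorem polyHom_surjective (hg : 2 ≤ g) (he : e = 1) :
    Function.Surjective ((cusp g pts h).polyHom e) := by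
  intro v
  obtain ⟨r, rfl⟩ := (cusp g pts h).cls_surjective e v
  obtain ⟨p, s, rfl⟩ := IsLocalization.exists_mk'_eq (cusp g pts h).denoms r
  obtain ⟨t, ht⟩ := (isCuspHom_polyHom h hg he).exists_inv s s.2
  have hps : IsLocalization.mk' (cusp g pts h).Reg p s *
      algebraMap _ (cusp g pts h).Reg (s : MvPolynomial (Fin 3) ℂ) =
      algebraMap _ (cusp g pts h).Reg p := IsLocalization.mk'_spec _ _ _
  have h1 := congrArg ((cusp g pts h).cls e) hps
  rw [map_mul, ← Orbifold.polyHom_apply, ← Orbifold.polyHom_apply] at h1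
  have h2 : ∀ {A : Type} [CommRing A] (x y z w : A), x * y = z → y * w = 1 → z * w = x := by
    rintro A _ x y _ w rfl h
    rw [mul_assoc, h, mul_one]
  exact ⟨p * t, (map_mul _ _ _).trans (h2 _ _ _ _ h1 ht)⟩

end Cusp

end LG

namespace LG

/-! ### Non-vanishing of `φ` -/

/-- The exponent of `x₁ ^ a * x₂ ^ b * x₃ ^ c`. -/
def expo (a b c : ℕ) : Fin 3 →₀ ℕ := Finsupp.equivFunOnFinite.symm ![a, b, c]

theorem monomial_expo (a b c : ℕ) (r : ℂ) : MvPolynomial.monomial (expo a b c) r =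
    MvPolynomial.C r *
      (MvPolynomial.X 0 ^ a * MvPolynomial.X 1 ^ b * MvPolynomial.X 2 ^ c) := by
  rw [MvPolynomial.monomial_eq, Finsupp.prod_fintype _ _ (by simp), Fin.prod_univ_three]
  rfl

theorem eq_expo (m : Fin 3 →₀ ℕ) : m = expo (m 0) (m 1) (m 2) := by
  ext i
  fin_cases i <;> rfl

theorem coeff_mul_expo (p : MvPolynomial (Fin 3) ℂ) (a b c a' b' c' : ℕ) :
    MvPolynomial.coeff (expo a b c)
      (p * (MvPolynomial.X 0 ^ a' * MvPolynomial.X 1 ^ b' * MvPolynomial.X 2 ^ c')) =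
    if a' ≤ a ∧ b' ≤ b ∧ c' ≤ c then
      MvPolynomial.coeff (expo (a - a') (b - b') (c - c')) p else 0 := by
  have h1 := monomial_expo a' b' c' 1
  rw [MvPolynomial.C_1, one_mul] at h1
  rw [← h1, MvPolynomial.coeff_mul_monomial', mul_one]
  have h2 : expo a' b' c' ≤ expo a b c ↔ a' ≤ a ∧ b' ≤ b ∧ c' ≤ c := by
    rw [Finsupp.le_def, Fin.forall_fin_succ, Fin.forall_fin_two]
    rfl
  have h3 : expo a b c - expo a' b' c' = expo (a - a') (b - b') (c - c') := by
    ext i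
    fin_cases i <;> rfl
  simp only [h2, h3]

/-- A functional on polynomials that vanishes on the Jacobian ideal of `W` and takes the value
`1` at `x₁x₂x₃`. As `n xᵢⁿ` is congruent to `x₁x₂x₃`, its value at `xᵢⁿ` has to be `1 / n`. -/
def socle (g : ℕ) : MvPolynomial (Fin 3) ℂ →ₗ[ℂ] ℂ :=
  MvPolynomial.lcoeff ℂ (expo 1 1 1) + (2 * g + 1 : ℂ)⁻¹ •
    (MvPolynomial.lcoeff ℂ (expo (2 * g + 1) 0 0) + MvPolynomial.lcoeff ℂ (expo 0 (2 * g + 1) 0) +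
      MvPolynomial.lcoeff ℂ (expo 0 0 (2 * g + 1)))

theorem socle_apply (g : ℕ) (f : MvPolynomial (Fin 3) ℂ) :
    socle g f = f.coeff (expo 1 1 1) + (2 * g + 1 : ℂ)⁻¹ * (f.coeff (expo (2 * g + 1) 0 0) +
      f.coeff (expo 0 (2 * g + 1) 0) + f.coeff (expo 0 0 (2 * g + 1))) := rfl

theorem socle_mul_pderiv {g : ℕ} (hg : 2 ≤ g) (p : MvPolynomial (Fin 3) ℂ) (i : Fin 3) :
    socle g (p * MvPolynomial.pderiv i (cuspW g)) = 0 := by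
  have hn : (2 * g + 1 : ℂ) ≠ 0 := two_mul_add_one_ne_zero g
  have e0 : (MvPolynomial.X 0 ^ (2 * g) : MvPolynomial (Fin 3) ℂ) =
      MvPolynomial.X 0 ^ (2 * g) * MvPolynomial.X 1 ^ 0 * MvPolynomial.X 2 ^ 0 := by simp
  have e1 : (MvPolynomial.X 1 ^ (2 * g) : MvPolynomial (Fin 3) ℂ) =
      MvPolynomial.X 0 ^ 0 * MvPolynomial.X 1 ^ (2 * g) * MvPolynomial.X 2 ^ 0 := by simp
  have e2 : (MvPolynomial.X 2 ^ (2 * g) : MvPolynomial (Fin 3) ℂ) =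
      MvPolynomial.X 0 ^ 0 * MvPolynomial.X 1 ^ 0 * MvPolynomial.X 2 ^ (2 * g) := by simp
  have f0 : (MvPolynomial.X 1 * MvPolynomial.X 2 : MvPolynomial (Fin 3) ℂ) =
      MvPolynomial.X 0 ^ 0 * MvPolynomial.X 1 ^ 1 * MvPolynomial.X 2 ^ 1 := by simp
  have f1 : (MvPolynomial.X 0 * MvPolynomial.X 2 : MvPolynomial (Fin 3) ℂ) =
      MvPolynomial.X 0 ^ 1 * MvPolynomial.X 1 ^ 0 * MvPolynomial.X 2 ^ 1 := by simp
  have f2 : (MvPolynomial.X 0 * MvPolynomial.X 1 : MvPolynomial (Fin 3) ℂ) =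
      MvPolynomial.X 0 ^ 1 * MvPolynomial.X 1 ^ 1 * MvPolynomial.X 2 ^ 0 := by simp
  have h1 : ¬ 2 * g ≤ 1 := by omega
  have h2 : ¬ 2 * g ≤ 0 := by omega
  have h3 : 2 * g + 1 - 2 * g = 1 := by omega
  have hcases : i = 0 ∨ i = 1 ∨ i = 2 := by fin_cases i <;> simp
  rcases hcases with rfl | rfl | rfl
  · rw [pderiv_cuspW_zero, e0, f0, mul_sub, mul_smul_comm, map_sub, map_smul]
    simp only [socle_apply, coeff_mul_expo, h1, h2, h3]
    simp [hn]
  · rw [pderiv_cuspW_one, e1, f1, mul_sub, mul_smul_comm, map_sub, map_smul]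
    simp only [socle_apply, coeff_mul_expo, h1, h2, h3]
    simp [hn]
  · rw [pderiv_cuspW_two, e2, f2, mul_sub, mul_smul_comm, map_sub, map_smul]
    simp only [socle_apply, coeff_mul_expo, h1, h2, h3]
    simp [hn]

theorem socle_mul_phi (g : ℕ) (p : MvPolynomial (Fin 3) ℂ) :
    socle g (p * (MvPolynomial.X 0 * MvPolynomial.X 1 * MvPolynomial.X 2)) =
      MvPolynomial.aeval (0 : Fin 3 → ℂ) p := by
  have e : (MvPolynomial.X 0 * MvPolynomial.X 1 * MvPolynomial.X 2 : MvPolynomial (Fin 3) ℂ) =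
      MvPolynomial.X 0 ^ 1 * MvPolynomial.X 1 ^ 1 * MvPolynomial.X 2 ^ 1 := by simp
  have h0 : expo 0 0 0 = 0 := by ext i; fin_cases i <;> rfl
  rw [e]
  simp only [socle_apply, coeff_mul_expo]
  simp [h0, ← MvPolynomial.constantCoeff_eq]

section Cusp

variable {g : ℕ} {pts : Fin 3 → Finset ℂ} (h : IsSuitable g pts) {e : Fin 3 → ℂˣ}

theorem milnorIdeal_eq_map (he : e = 1) : (cusp g pts h).milnorIdeal e =
    (Ideal.span (Set.range fun i => MvPolynomial.pderiv i (cuspW g))).map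
      (algebraMap _ (cusp g pts h).Reg) := by
  subst he
  rw [Ideal.map_span, Orbifold.milnorIdeal]
  congr 1
  ext r
  constructor
  · rintro (⟨i, hi, rfl⟩ | ⟨i, -, rfl⟩)
    · simp [movedIdx_one] at hi
    · exact ⟨_, ⟨i, rfl⟩, by rw [restrict_one]; rfl⟩
  · rintro ⟨_, ⟨i, rfl⟩, rfl⟩
    exact Or.inr ⟨i, by simp [movedIdx_one], by rw [restrict_one]; rfl⟩

theorem milnorIdeal_le_ker (hg : 2 ≤ g) (he : e = 1) :
    (cusp g pts h).milnorIdeal e ≤ RingHom.ker (cusp g pts h).evalZero := by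
  rw [milnorIdeal_eq_map h he, Ideal.map_span, Ideal.span_le]
  rintro _ ⟨_, ⟨i, rfl⟩, rfl⟩
  have h0 : 2 * g ≠ 0 := by omega
  have hcases : i = 0 ∨ i = 1 ∨ i = 2 := by fin_cases i <;> simp
  rw [SetLike.mem_coe, RingHom.mem_ker, Orbifold.evalZero_algebraMap]
  rcases hcases with rfl | rfl | rfl
  · simp [pderiv_cuspW_zero, h0]
  · simp [pderiv_cuspW_one, h0]
  · simp [pderiv_cuspW_two, h0]

/-- `x₁x₂x₃` does not lie in the Jacobian ideal at the origin: a multiple `s x₁x₂x₃` in the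
Jacobian ideal would be killed by `socle`, which however takes the value `s(0) ≠ 0` on it. -/
theorem polyCls_phi_ne_zero (hg : 2 ≤ g) (he : e = 1) :
    (cusp g pts h).polyCls e (MvPolynomial.X 0 * MvPolynomial.X 1 * MvPolynomial.X 2) ≠ 0 := by
  intro h0
  have h1 := ((cusp g pts h).cls_eq_zero_iff e _).1 h0
  rw [milnorIdeal_eq_map h he, IsLocalization.mem_map_algebraMap_iff (cusp g pts h).denoms] at h1
  obtain ⟨⟨⟨q, hq⟩, s⟩, hs⟩ := h1
  have hinj : Function.Injective
      (algebraMap (MvPolynomial (Fin 3) ℂ) (cusp g pts h).Reg) := by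
    refine IsLocalization.injective _ (M := (cusp g pts h).denoms) fun s hs => ?_
    rw [mem_nonZeroDivisors_iff_ne_zero]
    rintro rfl
    exact (cusp g pts h).eval_zero_denoms_ne_zero hs (map_zero _)
  have h2 := hinj ((map_mul _ _ _).trans hs)
  have h3 : ∀ q ∈ Ideal.span (Set.range fun i => MvPolynomial.pderiv i (cuspW g)),
      socle g q = 0 := by
    intro q hq
    refine Submodule.span_induction (p := fun q _ => ∀ r, socle g (r * q) = 0) ?_ ?_ ?_ ?_ hq 1
      |> fun h => by rwa [one_mul] at h
    · rintro _ ⟨i, rfl⟩ r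
      exact socle_mul_pderiv hg r i
    · simp
    · intro x y _ _ hx hy r
      rw [mul_add, map_add, hx, hy, add_zero]
    · intro a x _ hx r
      rw [smul_eq_mul, ← mul_assoc, hx]
  refine (cusp g pts h).eval_zero_denoms_ne_zero s.2 ?_
  rw [← socle_mul_phi g, mul_comm]
  exact (congrArg (socle g) h2).trans (h3 q hq)

/-! ### Invariants of the Milnor algebra -/

theorem actMilnor_polyHom (k : (cusp g pts h).G) (f : MvPolynomial (Fin 3) ℂ) :
    (cusp g pts h).actMilnor k e ((cusp g pts h).polyHom e f) =
      (cusp g pts h).polyHom e (rescale (k : Fin 3 → ℂˣ) f) := by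
  rw [Orbifold.polyHom_apply, Orbifold.polyHom_apply, ← Orbifold.actReg_algebraMap]
  rfl

theorem rescale_cuspHom_expo (ζ : ℂˣ) (a b c : ℕ) :
    rescale (cuspHom ζ)
      (MvPolynomial.X 0 ^ a * MvPolynomial.X 1 ^ b * MvPolynomial.X 2 ^ c) =
    ((ζ ^ (a + b) * (ζ ^ (2 * c))⁻¹ : ℂˣ) : ℂ) •
      (MvPolynomial.X 0 ^ a * MvPolynomial.X 1 ^ b * MvPolynomial.X 2 ^ c) := by
  have h0 : cuspHom ζ 0 = ζ := rfl
  have h1 : cuspHom ζ 1 = ζ := rfl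
  have h2 : cuspHom ζ 2 = ζ⁻¹ ^ 2 := rfl
  simp only [rescale, map_mul, map_pow, MvPolynomial.aeval_X, h0, h1, h2, mul_pow,
    MvPolynomial.smul_eq_C_mul]
  have h3 : ((ζ ^ (a + b) * (ζ ^ (2 * c))⁻¹ : ℂˣ) : ℂ) =
      (ζ : ℂ) ^ a * (ζ : ℂ) ^ b * ((ζ⁻¹ ^ 2 : ℂˣ) : ℂ) ^ c := by
    push_cast
    rw [pow_add, ← pow_mul, inv_pow]
  rw [h3, map_mul, map_mul, map_pow, map_pow, map_pow]
  ring

/-- The invariants of `M(W)` are spanned by `1` and `φ`: averaging over the group kills all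
monomials of non-trivial weight. -/
theorem mem_span_of_invariant (hg : 2 ≤ g) (he : e = 1) (v : (cusp g pts h).Milnor e)
    (hv : ∀ k, (cusp g pts h).actMilnor k e v = v) :
    v ∈ Submodule.span ℂ {1, (cusp g pts h).polyHom e
      (MvPolynomial.X 0 * MvPolynomial.X 1 * MvPolynomial.X 2)} := by
  set S := Submodule.span ℂ {1, (cusp g pts h).polyHom e
      (MvPolynomial.X 0 * MvPolynomial.X 1 * MvPolynomial.X 2)} with hS
  have hn : 2 * g + 1 ≠ 0 := by omega
  obtain ⟨f, rfl⟩ := polyHom_surjective h hg he v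
  have hω := Complex.isPrimitiveRoot_exp (2 * g + 1) hn
  set ω : ℂˣ := (hω.isUnit hn).unit with hωdef
  have hω' : IsPrimitiveRoot ω (2 * g + 1) := hω.isUnit_unit hn
  have key : ∀ f : MvPolynomial (Fin 3) ℂ, (cusp g pts h).polyHom e
      (∑ k ∈ Finset.range (2 * g + 1), rescale (cuspHom (ω ^ k)) f) ∈ S := by
    intro f
    induction f using MvPolynomial.induction_on' with
    | monomial m r =>
      rw [eq_expo m, monomial_expo]
      set a := m 0
      set b := m 1
      set c := m 2
      set ρ : ℂˣ := ω ^ (a + b) * (ω ^ (2 * c))⁻¹ with hρ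
      have h1 : ∀ k, rescale (cuspHom (ω ^ k)) (MvPolynomial.C r *
          (MvPolynomial.X 0 ^ a * MvPolynomial.X 1 ^ b * MvPolynomial.X 2 ^ c)) =
          (r * (ρ : ℂ) ^ k) •
            (MvPolynomial.X 0 ^ a * MvPolynomial.X 1 ^ b * MvPolynomial.X 2 ^ c) := by
        intro k
        rw [← MvPolynomial.smul_eq_C_mul, map_smul, rescale_cuspHom_expo, smul_smul, hρ,
          ← Units.val_pow_eq_pow_val, mul_pow, inv_pow, ← pow_mul, ← pow_mul, ← pow_mul,
          ← pow_mul, mul_comm k, mul_comm k]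
      simp only [h1, ← Finset.sum_smul, ← Finset.mul_sum]
      rw [map_smul]
      by_cases hw : a + b ≡ 2 * c [MOD 2 * g + 1]
      · refine S.smul_mem _ ?_
        rw [map_mul, map_mul, map_pow, map_pow, map_pow]
        exact (isCuspHom_polyHom h hg he).monomial_mem_span a b c hw
      · have hρ1 : (ρ : ℂ) ≠ 1 := by
          intro h2
          rw [Units.val_eq_one, hρ, mul_inv_eq_one, pow_eq_pow_iff_modEq, ← hω'.eq_orderOf] at h2
          exact hw h2
        have hρn : ρ ^ (2 * g + 1) = 1 := by
          have h2 : ∀ d, (ω ^ d) ^ (2 * g + 1) = 1 := fun d => by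
            rw [← pow_mul, mul_comm, pow_mul, hω'.pow_eq_one, one_pow]
          rw [hρ, mul_pow, inv_pow, h2, h2, inv_one, mul_one]
        have hρn' : (ρ : ℂ) ^ (2 * g + 1) = 1 := by
          rw [← Units.val_pow_eq_pow_val, hρn, Units.val_one]
        have hsum : ∑ k ∈ Finset.range (2 * g + 1), (ρ : ℂ) ^ k = 0 := by
          rw [geom_sum_eq hρ1, hρn', sub_self, zero_div]
        rw [hsum, mul_zero, zero_smul]
        exact S.zero_mem
    | add p q hp hq =>
      simp only [map_add, Finset.sum_add_distrib] at hp hq ⊢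
      exact S.add_mem hp hq
  have h1 : (cusp g pts h).polyHom e
      (∑ k ∈ Finset.range (2 * g + 1), rescale (cuspHom (ω ^ k)) f) =
      (2 * g + 1 : ℂ) • (cusp g pts h).polyHom e f := by
    have h2 : ∀ k, (cusp g pts h).polyHom e (rescale (cuspHom (ω ^ k)) f) =
        (cusp g pts h).polyHom e f := by
      intro k
      have hk : cuspHom (ω ^ k) ∈ (cusp g pts h).G := (mem_cuspGroup_iff g _).2
        ⟨ω ^ k, by rw [← pow_mul, mul_comm, pow_mul, hω'.pow_eq_one, one_pow], rfl⟩
      exact (actMilnor_polyHom h ⟨_, hk⟩ f).symm.trans (hv _)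
    rw [map_sum, Finset.sum_congr rfl fun k _ => h2 k, Finset.sum_const, Finset.card_range,
      ← Nat.cast_smul_eq_nsmul ℂ]
    push_cast
    rfl
  have h2 := key f
  rw [h1] at h2
  have h3 := S.smul_mem (2 * g + 1 : ℂ)⁻¹ h2
  rwa [inv_smul_smul₀ (two_mul_add_one_ne_zero g)] at h3

end Cusp

end LG

namespace LG

/-! ### The structure constants -/

section DiffDer

variable {R A : Type*} [CommRing R] [CommRing A] [Algebra R A] (a b : Fin 3 → A) (p q r : ℕ)

theorem diffDer_monomial (i : Fin 3) (p q r : ℕ) :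
    diffDer i a b (MvPolynomial.X 0 ^ p * MvPolynomial.X 1 ^ q * MvPolynomial.X 2 ^ r :
      MvPolynomial (Fin 3) R) =
    (∏ k ∈ Finset.univ.filter (fun k => k < i), b k ^ ![p, q, r] k) *
      (∑ l ∈ Finset.range (![p, q, r] i), a i ^ l * b i ^ (![p, q, r] i - 1 - l)) *
      ∏ k ∈ Finset.univ.filter (fun k => i < k), a k ^ ![p, q, r] k := by
  have h : (MvPolynomial.X 0 ^ p * MvPolynomial.X 1 ^ q * MvPolynomial.X 2 ^ r :
      MvPolynomial (Fin 3) R) = MvPolynomial.basisMonomials (Fin 3) R (expo p q r) := by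
    rw [MvPolynomial.coe_basisMonomials]
    beta_reduce
    rw [MvPolynomial.monomial_eq,
      Finsupp.prod_fintype _ _ (by simp), Fin.prod_univ_three, MvPolynomial.C_1, one_mul]
    rfl
  rw [h, diffDer, Module.Basis.constr_basis]
  rfl

theorem diffDer_zero : diffDer 0 a b (MvPolynomial.X 0 ^ p * MvPolynomial.X 1 ^ q *
      MvPolynomial.X 2 ^ r : MvPolynomial (Fin 3) R) =
    (∑ l ∈ Finset.range p, a 0 ^ l * b 0 ^ (p - 1 - l)) * (a 1 ^ q * a 2 ^ r) := by
  have h1 : Finset.univ.filter (fun k : Fin 3 => k < 0) = ∅ := by decide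
  have h2 : Finset.univ.filter (fun k : Fin 3 => 0 < k) = {1, 2} := by decide
  rw [diffDer_monomial, h1, h2, Finset.prod_empty, one_mul, Finset.prod_pair (by decide)]
  rfl

theorem diffDer_one : diffDer 1 a b (MvPolynomial.X 0 ^ p * MvPolynomial.X 1 ^ q *
      MvPolynomial.X 2 ^ r : MvPolynomial (Fin 3) R) =
    b 0 ^ p * (∑ l ∈ Finset.range q, a 1 ^ l * b 1 ^ (q - 1 - l)) * a 2 ^ r := by
  have h1 : Finset.univ.filter (fun k : Fin 3 => k < 1) = {0} := by decide
  have h2 : Finset.univ.filter (fun k : Fin 3 => 1 < k) = {2} := by decide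
  rw [diffDer_monomial, h1, h2, Finset.prod_singleton, Finset.prod_singleton]
  rfl

theorem diffDer_two : diffDer 2 a b (MvPolynomial.X 0 ^ p * MvPolynomial.X 1 ^ q *
      MvPolynomial.X 2 ^ r : MvPolynomial (Fin 3) R) =
    b 0 ^ p * b 1 ^ q * (∑ l ∈ Finset.range r, a 2 ^ l * b 2 ^ (r - 1 - l)) := by
  have h1 : Finset.univ.filter (fun k : Fin 3 => k < 2) = {0, 1} := by decide
  have h2 : Finset.univ.filter (fun k : Fin 3 => 2 < k) = ∅ := by decide
  rw [diffDer_monomial, h1, h2, Finset.prod_pair (by decide), Finset.prod_empty, mul_one]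
  rfl

/-- Monomials with all exponents written out, as they are used by `diffDer_zero` and the lemmas
after it. -/
theorem monomial_forms (m : ℕ) :
    (MvPolynomial.X 0 ^ m : MvPolynomial (Fin 3) R) =
      MvPolynomial.X 0 ^ m * MvPolynomial.X 1 ^ 0 * MvPolynomial.X 2 ^ 0 ∧
    (MvPolynomial.X 1 ^ m : MvPolynomial (Fin 3) R) =
      MvPolynomial.X 0 ^ 0 * MvPolynomial.X 1 ^ m * MvPolynomial.X 2 ^ 0 ∧
    (MvPolynomial.X 2 ^ m : MvPolynomial (Fin 3) R) =
      MvPolynomial.X 0 ^ 0 * MvPolynomial.X 1 ^ 0 * MvPolynomial.X 2 ^ m := by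
  simp

theorem diffDer_X_pow_of_ne {i j : Fin 3} (hij : j ≠ i) (m : ℕ) :
    diffDer j a b (MvPolynomial.X i ^ m : MvPolynomial (Fin 3) R) = 0 := by
  have h : (MvPolynomial.X i ^ m : MvPolynomial (Fin 3) R) =
      MvPolynomial.basisMonomials (Fin 3) R (Finsupp.single i m) := by
    rw [MvPolynomial.coe_basisMonomials, MvPolynomial.X_pow_eq_monomial]
  rw [h, diffDer, Module.Basis.constr_basis, Finsupp.single_eq_of_ne hij, Finset.sum_range_zero,
    mul_zero, zero_mul]

theorem diffDer_X_pow_self (i : Fin 3) (m : ℕ) :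
    diffDer i a b (MvPolynomial.X i ^ m : MvPolynomial (Fin 3) R) =
      ∑ l ∈ Finset.range m, a i ^ l * b i ^ (m - 1 - l) := by
  obtain ⟨h0, h1, h2⟩ := monomial_forms (R := R) m
  have hcases : i = 0 ∨ i = 1 ∨ i = 2 := by fin_cases i <;> simp
  rcases hcases with rfl | rfl | rfl
  · rw [h0, diffDer_zero]; simp
  · rw [h1, diffDer_one]; simp
  · rw [h2, diffDer_two]; simp

end DiffDer

section CuspDiffDer

variable {A : Type*} [CommRing A] [Algebra ℂ A] (a b : Fin 3 → A) (g : ℕ)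

theorem diffDer_cuspW (i : Fin 3) : diffDer i a b (cuspW g) =
    (∑ l ∈ Finset.range (2 * g + 1), a i ^ l * b i ^ (2 * g + 1 - 1 - l)) -
      ![a 1 * a 2, b 0 * a 2, b 0 * b 1] i := by
  have hx : (MvPolynomial.X 0 * MvPolynomial.X 1 * MvPolynomial.X 2 : MvPolynomial (Fin 3) ℂ) =
      MvPolynomial.X 0 ^ 1 * MvPolynomial.X 1 ^ 1 * MvPolynomial.X 2 ^ 1 := by simp
  rw [cuspW, map_sub, map_add, map_add]
  congr 1
  · have hcases : i = 0 ∨ i = 1 ∨ i = 2 := by fin_cases i <;> simp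
    rcases hcases with rfl | rfl | rfl
    · rw [diffDer_X_pow_self, diffDer_X_pow_of_ne a b (by decide),
        diffDer_X_pow_of_ne a b (by decide), add_zero, add_zero]
    · rw [diffDer_X_pow_self, diffDer_X_pow_of_ne a b (by decide),
        diffDer_X_pow_of_ne a b (by decide), zero_add, add_zero]
    · rw [diffDer_X_pow_self, diffDer_X_pow_of_ne a b (by decide),
        diffDer_X_pow_of_ne a b (by decide), add_zero, zero_add]
  · have hcases : i = 0 ∨ i = 1 ∨ i = 2 := by fin_cases i <;> simp
    rw [hx]
    rcases hcases with rfl | rfl | rfl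
    · rw [diffDer_zero]; simp
    · rw [diffDer_one]; simp
    · rw [diffDer_two]; simp

end CuspDiffDer

/-- The sum that arises on applying a difference derivative with respect to `x ↦ cx` and one with
respect to `cx ↦ x`. -/
theorem sum_sum_pow {c : ℂ} {n : ℕ} (hc : c ^ n = 1) (h1 : c ≠ 1) :
    ∑ l ∈ Finset.range n, ∑ k ∈ Finset.range (n - 1 - l), c ^ k = n / (1 - c) := by
  have h : 1 - c ≠ 0 := sub_ne_zero.2 (Ne.symm h1)
  have h2 : ∀ m, ∑ k ∈ Finset.range m, c ^ k = (1 - c ^ m) / (1 - c) := fun m => by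
    rw [eq_div_iff h, mul_comm, mul_neg_geom_sum]
  simp only [h2]
  rw [← Finset.sum_div, Finset.sum_range_reflect (fun l => 1 - c ^ l), Finset.sum_sub_distrib,
    h2 n, hc]
  simp

section Coefficients

variable (g : ℕ) (ζ : ℂˣ)

theorem rescale_cuspHom_X : (fun k => rescale (cuspHom ζ) (MvPolynomial.X k)) =
    fun k => ((cuspHom ζ k : ℂˣ) : ℂ) • (MvPolynomial.X k : MvPolynomial (Fin 3) ℂ) := by
  ext1 k
  rw [rescale, MvPolynomial.aeval_X, MvPolynomial.smul_eq_C_mul]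

/-- The diagonal coefficients of `H_W(x, h(x), x)`, where `h = (ζ, ζ, ζ⁻²)`. -/
theorem diffDer₂_cuspW_self (i : Fin 3) (h1 : cuspHom ζ i ≠ 1)
    (hn : cuspHom ζ i ^ (2 * g + 1) = 1) :
    diffDer₂ i i MvPolynomial.X (fun k => rescale (cuspHom ζ) (MvPolynomial.X k))
      MvPolynomial.X (cuspW g) =
    ((2 * g + 1 : ℂ) / (1 - (cuspHom ζ i : ℂ))) •
      (MvPolynomial.X i : MvPolynomial (Fin 3) ℂ) ^ (2 * g - 1) := by
  have h1' : ((cuspHom ζ i : ℂˣ) : ℂ) ≠ 1 := by simpa using h1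
  have hn' : ((cuspHom ζ i : ℂˣ) : ℂ) ^ (2 * g + 1) = 1 := by
    rw [← Units.val_pow_eq_pow_val, hn, Units.val_one]
  have hmain : diffDer i (fun k => ((cuspHom ζ k : ℂˣ) : ℂ) •
        (MvPolynomial.X k : MvPolynomial (Fin 3) ℂ)) MvPolynomial.X
      (∑ l ∈ Finset.range (2 * g + 1), (MvPolynomial.C (MvPolynomial.X i) :
        MvPolynomial (Fin 3) (MvPolynomial (Fin 3) ℂ)) ^ l *
          MvPolynomial.X i ^ (2 * g + 1 - 1 - l)) =
      ((2 * g + 1 : ℂ) / (1 - (cuspHom ζ i : ℂ))) •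
      (MvPolynomial.X i : MvPolynomial (Fin 3) ℂ) ^ (2 * g - 1) := by
    have h := sum_sum_pow hn' h1'
    push_cast at h
    rw [map_sum, ← h, Finset.sum_smul]
    refine Finset.sum_congr rfl fun l hl => ?_
    rw [← MvPolynomial.C_pow, ← MvPolynomial.smul_eq_C_mul, map_smul, diffDer_X_pow_self,
      Finset.sum_smul, Finset.smul_sum]
    refine Finset.sum_congr rfl fun k hk => ?_
    rw [Finset.mem_range] at hl hk
    rw [smul_pow, smul_mul_assoc, smul_comm, smul_eq_mul, ← pow_add, ← pow_add]
    congr 2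
    omega
  have hcross : diffDer i (fun k => ((cuspHom ζ k : ℂˣ) : ℂ) •
        (MvPolynomial.X k : MvPolynomial (Fin 3) ℂ)) MvPolynomial.X
      ((![MvPolynomial.C (MvPolynomial.X 1) * MvPolynomial.C (MvPolynomial.X 2),
        MvPolynomial.X 0 * MvPolynomial.C (MvPolynomial.X 2),
        MvPolynomial.X 0 * MvPolynomial.X 1] : Fin 3 → MvPolynomial (Fin 3)
          (MvPolynomial (Fin 3) ℂ)) i) = 0 := by
    have hcases : i = 0 ∨ i = 1 ∨ i = 2 := by fin_cases i <;> simp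
    rcases hcases with rfl | rfl | rfl
    · have h : (MvPolynomial.C (MvPolynomial.X 1) * MvPolynomial.C (MvPolynomial.X 2) :
          MvPolynomial (Fin 3) (MvPolynomial (Fin 3) ℂ)) =
          (MvPolynomial.X 1 * MvPolynomial.X 2 : MvPolynomial (Fin 3) ℂ) •
            (MvPolynomial.X 1 ^ 0 : MvPolynomial (Fin 3) (MvPolynomial (Fin 3) ℂ)) := by
        rw [MvPolynomial.smul_eq_C_mul, pow_zero, mul_one, map_mul]
      simp only [Matrix.cons_val_zero]
      rw [h, map_smul, diffDer_X_pow_of_ne _ _ (by decide), smul_zero]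
    · have h : (MvPolynomial.X 0 * MvPolynomial.C (MvPolynomial.X 2) :
          MvPolynomial (Fin 3) (MvPolynomial (Fin 3) ℂ)) =
          (MvPolynomial.X 2 : MvPolynomial (Fin 3) ℂ) •
            (MvPolynomial.X 0 ^ 1 : MvPolynomial (Fin 3) (MvPolynomial (Fin 3) ℂ)) := by
        rw [MvPolynomial.smul_eq_C_mul, pow_one, mul_comm]
      simp only [Matrix.cons_val_one, Matrix.cons_val_zero]
      rw [h, map_smul, diffDer_X_pow_of_ne _ _ (by decide), smul_zero]
    · have h : (MvPolynomial.X 0 * MvPolynomial.X 1 :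
          MvPolynomial (Fin 3) (MvPolynomial (Fin 3) ℂ)) =
          MvPolynomial.X 0 ^ 1 * MvPolynomial.X 1 ^ 1 * MvPolynomial.X 2 ^ 0 := by simp
      simp only [Matrix.cons_val]
      rw [h, diffDer_two]
      simp
  rw [diffDer₂, diffDer_cuspW, rescale_cuspHom_X, map_sub, hmain, hcross, sub_zero]

theorem diffDer₂_cuspW_one_two : diffDer₂ 1 2 MvPolynomial.X
      (fun k => rescale (cuspHom ζ) (MvPolynomial.X k)) MvPolynomial.X (cuspW g) =
    -(MvPolynomial.X 0 : MvPolynomial (Fin 3) ℂ) := by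
  have h : (MvPolynomial.X 0 * MvPolynomial.X 1 :
      MvPolynomial (Fin 3) (MvPolynomial (Fin 3) ℂ)) =
      MvPolynomial.X 0 ^ 1 * MvPolynomial.X 1 ^ 1 * MvPolynomial.X 2 ^ 0 := by simp
  rw [diffDer₂, diffDer_cuspW, map_sub, map_sum, Finset.sum_eq_zero, zero_sub]
  · simp only [Matrix.cons_val]
    rw [h, diffDer_one]
    simp
  · intro l _
    rw [← MvPolynomial.C_pow, ← MvPolynomial.smul_eq_C_mul, map_smul,
      diffDer_X_pow_of_ne _ _ (by decide), smul_zero]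

/-- The difference derivatives of `W` at the pair `(x, h(x))`, where `h = (ζ, ζ, ζ⁻²)`. -/
theorem diffDer_cuspW_rescale (i : Fin 3) :
    diffDer i MvPolynomial.X (fun k => rescale (cuspHom ζ) (MvPolynomial.X k)) (cuspW g) =
    (∑ l ∈ Finset.range (2 * g + 1), ((cuspHom ζ i : ℂˣ) : ℂ) ^ (2 * g + 1 - 1 - l)) •
      (MvPolynomial.X i : MvPolynomial (Fin 3) ℂ) ^ (2 * g) -
      ![MvPolynomial.X 1 * MvPolynomial.X 2, (ζ : ℂ) • (MvPolynomial.X 0 * MvPolynomial.X 2),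
        (ζ : ℂ) ^ 2 • (MvPolynomial.X 0 * MvPolynomial.X 1)] i := by
  have h0 : cuspHom ζ 0 = ζ := rfl
  have h1 : cuspHom ζ 1 = ζ := rfl
  rw [rescale_cuspHom_X, diffDer_cuspW, Finset.sum_smul]
  congr 1
  · refine Finset.sum_congr rfl fun l hl => ?_
    rw [Finset.mem_range] at hl
    rw [smul_pow, mul_smul_comm, ← pow_add]
    congr 2
    omega
  · simp only [h0, h1, smul_mul_assoc, mul_smul_comm, smul_smul, pow_two]

variable {g ζ}

theorem fixedPoint_eq_zero (hm : movedIdx (cuspHom ζ) = Finset.univ) :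
    fixedPoint (cuspHom ζ) = 0 := by
  ext1 i
  simp [fixedPoint, hm]

theorem twistCoeff_cuspW_zero_one (hm : movedIdx (cuspHom ζ) = Finset.univ) :
    twistCoeff (cuspW g) (cuspHom ζ) 0 1 =
    (-(ζ : ℂ) / (1 - ζ)) • MvPolynomial.X 2 := by
  have h : (MvPolynomial.X 0 * MvPolynomial.X 2 : MvPolynomial (Fin 3) ℂ) =
      MvPolynomial.X 0 ^ 1 * MvPolynomial.X 1 ^ 0 * MvPolynomial.X 2 ^ 1 := by simp
  have h0 : cuspHom ζ 0 = ζ := rfl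
  rw [twistCoeff, diffDer_cuspW_rescale, fixedPoint_eq_zero hm, map_sub, map_smul,
    diffDer_X_pow_of_ne _ _ (by decide), smul_zero, zero_sub, ← MvPolynomial.smul_eq_C_mul, h0]
  simp only [Matrix.cons_val_one, Matrix.cons_val_zero]
  rw [map_smul, h, diffDer_zero, ← neg_smul, smul_smul]
  simp [div_eq_inv_mul]

theorem twistCoeff_cuspW_zero_two (hm : movedIdx (cuspHom ζ) = Finset.univ) :
    twistCoeff (cuspW g) (cuspHom ζ) 0 2 =
    (-(ζ : ℂ) ^ 2 / (1 - ζ)) • MvPolynomial.X 1 := by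
  have h : (MvPolynomial.X 0 * MvPolynomial.X 1 : MvPolynomial (Fin 3) ℂ) =
      MvPolynomial.X 0 ^ 1 * MvPolynomial.X 1 ^ 1 * MvPolynomial.X 2 ^ 0 := by simp
  have h0 : cuspHom ζ 0 = ζ := rfl
  rw [twistCoeff, diffDer_cuspW_rescale, fixedPoint_eq_zero hm, map_sub, map_smul,
    diffDer_X_pow_of_ne _ _ (by decide), smul_zero, zero_sub, ← MvPolynomial.smul_eq_C_mul, h0]
  simp only [Matrix.cons_val]
  rw [map_smul, h, diffDer_zero, ← neg_smul, smul_smul]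
  simp [div_eq_inv_mul]

theorem twistCoeff_cuspW_one_two (hm : movedIdx (cuspHom ζ) = Finset.univ) :
    twistCoeff (cuspW g) (cuspHom ζ) 1 2 = 0 := by
  have h : (MvPolynomial.X 0 * MvPolynomial.X 1 : MvPolynomial (Fin 3) ℂ) =
      MvPolynomial.X 0 ^ 1 * MvPolynomial.X 1 ^ 1 * MvPolynomial.X 2 ^ 0 := by simp
  rw [twistCoeff, diffDer_cuspW_rescale, fixedPoint_eq_zero hm, map_sub, map_smul,
    diffDer_X_pow_of_ne _ _ (by decide), smul_zero, zero_sub]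
  simp only [Matrix.cons_val]
  rw [map_smul, h, diffDer_one]
  simp

end Coefficients

end LG

namespace LG

/-- The coefficient of `1` in `Υ` of the cube of a structure element, both group elements moving
all three variables. -/
theorem monomialCoeff_upsilon_structure {B : Type*} [CommRing B] (H T T' : Fin 3 → Fin 3 → B)
    (hT : T 1 2 = 0) (hT' : T' 1 2 = 0) :
    monomialCoeff ∅ (upsilon 3 (monomialBasis 3 B Finset.univ) (monomialBasis 3 B Finset.univ)
      (((∑ i, ∑ j ∈ Finset.univ.filter (fun j => j ≤ i), H j i • ten (gen i) (gen j)) +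
        ten (∑ i ∈ Finset.univ, ∑ j ∈ Finset.univ.filter (fun j => j < i),
          T j i • (gen j * gen i)) 1 +
        ten 1 (∑ i ∈ Finset.univ, ∑ j ∈ Finset.univ.filter (fun j => j < i),
          T' j i • (gen j * gen i))) ^ 3)) =
    6 * (H 0 0 * H 1 1 * H 2 2 - H 2 2 * T 0 1 * T' 0 1 - H 1 1 * T 0 2 * T' 0 2 +
      H 1 2 * T 0 1 * T' 0 2) := by
  have l0 : Finset.univ.filter (fun k : Fin 3 => k ≤ 0) = {0} := by decide
  have l1 : Finset.univ.filter (fun k : Fin 3 => k ≤ 1) = {0, 1} := by decide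
  have l2 : Finset.univ.filter (fun k : Fin 3 => k ≤ 2) = {0, 1, 2} := by decide
  have k0 : Finset.univ.filter (fun k : Fin 3 => k < 0) = ∅ := by decide
  have k1 : Finset.univ.filter (fun k : Fin 3 => k < 1) = {0} := by decide
  have k2 : Finset.univ.filter (fun k : Fin 3 => k < 2) = {0, 1} := by decide
  rw [← monomialCoeff_upsilon_cube (H 0 0) (H 1 1) (H 2 2) (H 0 1) (H 0 2) (H 1 2)
    (T 0 1) (T 0 2) (T' 0 1) (T' 0 2)]
  simp only [Fin.sum_univ_three, l0, l1, l2, k0, k1, k2, Finset.sum_empty, Finset.sum_singleton,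
    zero_add]
  rw [Finset.sum_pair (by decide), Finset.sum_pair (by decide), Finset.sum_pair (by decide),
    Finset.sum_insert (by decide), Finset.sum_pair (by decide), hT, hT', zero_smul, add_zero,
    add_zero, ← add_assoc (H 0 2 • _)]

/-- The structure constant of two elements that move all variables and are inverse to each other.
The factor `6⁻¹` is the `1 / d!` of the definition with `d = 3`. -/
theorem Orbifold.sigma_of_movedIdx_eq_univ {K : Type*} [Field K] (P : Orbifold K 3)
    {g h : Fin 3 → Kˣ} (hg : movedIdx g = Finset.univ) (hh : movedIdx h = Finset.univ)
    (hgh : movedIdx (g * h) = ∅) (hT : twistCoeff P.W g 1 2 = 0)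
    (hT' : twistCoeff P.W h 1 2 = 0) :
    P.sigma g h = (6 : K)⁻¹ • (6 *
      let H := fun j i => P.polyHom (g * h) (diffDer₂ j i MvPolynomial.X
        (fun k => rescale g (MvPolynomial.X k)) MvPolynomial.X P.W)
      let T := fun j i => P.polyHom (g * h) (twistCoeff P.W g j i)
      let T' := fun j i => P.polyHom (g * h) (rescale g (twistCoeff P.W h j i))
      H 0 0 * H 1 1 * H 2 2 - H 2 2 * T 0 1 * T' 0 1 - H 1 1 * T 0 2 * T' 0 2 +
        H 1 2 * T 0 1 * T' 0 2) := by
  have hcg : codim g = 3 := by rw [codim, hg]; rfl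
  have hch : codim h = 3 := by rw [codim, hh]; rfl
  have hcgh : codim (g * h) = 0 := by rw [codim, hgh]; rfl
  have hhalf : halfExcess g h = 3 := by rw [halfExcess, hcg, hch, hcgh]
  have key := monomialCoeff_upsilon_structure (B := P.Milnor (g * h))
    (fun j i => P.polyHom (g * h) (diffDer₂ j i MvPolynomial.X
      (fun k => rescale g (MvPolynomial.X k)) MvPolynomial.X P.W))
    (fun j i => P.polyHom (g * h) (twistCoeff P.W g j i))
    (fun j i => P.polyHom (g * h) (rescale g (twistCoeff P.W h j i)))
    (by simp only [hT, map_zero]) (by simp only [hT', map_zero])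
  rw [sigma, if_pos (by rw [hcg, hch, hcgh]; exact ⟨by omega, ⟨3, rfl⟩⟩), hhalf, hcg]
  have h6 : ((Nat.factorial 3 : ℕ) : K) = 6 := by norm_num [Nat.factorial]
  rw [h6, structureElement, hg, hh, hgh]
  exact congrArg _ key

/-- The value of the structure constant, in terms of the coefficients of the structure element.
The product of the three diagonal coefficients vanishes as `xᵢ² xⱼ = 0`, and the other three terms
are multiples of `φ`. -/
theorem IsCuspHom.structure_value {g : ℕ} {pts : Fin 3 → Finset ℂ} {A : Type*} [CommRing A]
    [Algebra ℂ A] {π : MvPolynomial (Fin 3) ℂ →ₐ[ℂ] A} (hπ : IsCuspHom g pts π) (z : ℂ)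
    (hz0 : z ≠ 0) (hz1 : 1 - z ≠ 0) (hz2 : 1 - z⁻¹ ^ 2 ≠ 0) :
    (6 : ℂ)⁻¹ • (6 *
      (π (((2 * g + 1 : ℂ) / (1 - z)) • MvPolynomial.X 0 ^ (2 * g - 1)) *
        π (((2 * g + 1 : ℂ) / (1 - z)) • MvPolynomial.X 1 ^ (2 * g - 1)) *
        π (((2 * g + 1 : ℂ) / (1 - z⁻¹ ^ 2)) • MvPolynomial.X 2 ^ (2 * g - 1)) -
      π (((2 * g + 1 : ℂ) / (1 - z⁻¹ ^ 2)) • MvPolynomial.X 2 ^ (2 * g - 1)) *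
        π ((-z / (1 - z)) • MvPolynomial.X 2) *
        π ((z⁻¹ ^ 2 / (1 - z)) • MvPolynomial.X 2) -
      π (((2 * g + 1 : ℂ) / (1 - z)) • MvPolynomial.X 1 ^ (2 * g - 1)) *
        π ((-z ^ 2 / (1 - z)) • MvPolynomial.X 1) *
        π ((1 / (1 - z)) • MvPolynomial.X 1) +
      π (-MvPolynomial.X 0) * π ((-z / (1 - z)) • MvPolynomial.X 2) *
        π ((1 / (1 - z)) • MvPolynomial.X 1))) =
    (-((1 - z) ^ 2 * (1 - z⁻¹ ^ 2))⁻¹) • π (.X 0 * .X 1 * .X 2) := by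
  have hg := hπ.two_le
  have hn := two_mul_add_one_ne_zero g
  have hexp : 2 * g - 1 = 2 + (2 * g - 3) := by omega
  have h01 : π (.X 0) ^ (2 * g - 1) * π (.X 1) ^ (2 * g - 1) = 0 := by
    rw [hexp, pow_add, pow_add, show π (.X 0) ^ 2 * π (.X 0) ^ (2 * g - 3) *
      (π (.X 1) ^ 2 * π (.X 1) ^ (2 * g - 3)) = (π (.X 0) ^ 2 * π (.X 1)) *
        (π (.X 0) ^ (2 * g - 3) * π (.X 1) * π (.X 1) ^ (2 * g - 3)) by ring,
      hπ.sq_mul 0 1 (by decide), zero_mul]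
  have hsq : ∀ i, π (.X i) ^ (2 * g - 1) * π (.X i) * π (.X i) =
      (2 * g + 1 : ℂ)⁻¹ • π (.X 0 * .X 1 * .X 2) := by
    intro i
    rw [← hπ.X_pow_eq i, ← pow_succ, ← pow_succ]
    congr 1
    omega
  have hlin : π (.X 0) * π (.X 2) * π (.X 1) = π (.X 0 * .X 1 * .X 2) :=
    (IsCuspHom.phi_eq (by decide) (by decide) (by decide)).symm
  have h6 : ∀ a : A, (6 : ℂ)⁻¹ • (6 * a) = a := by
    intro a
    rw [show (6 : A) * a = (6 : ℂ) • a by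
      rw [Algebra.smul_def, map_ofNat], inv_smul_smul₀ (by norm_num)]
  rw [h6]
  simp only [map_smul, map_pow, map_neg, smul_mul_assoc, neg_mul, mul_smul_comm, h01, hsq,
    hlin, smul_zero, zero_mul, smul_smul, zero_sub]
  have hz3 : 1 - z⁻¹ ^ 2 = (z - 1) * (z + 1) / z ^ 2 := by
    field_simp
    ring
  have hz4 : z - 1 ≠ 0 := fun h => hz1 (by linear_combination -h)
  have hz5 : z + 1 ≠ 0 := fun h => hz2 (by rw [hz3, h]; simp)
  have hz6 : 1 - z = -(z - 1) := by ring
  match_scalars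
  rw [hz3, hz6]
  field_simp
  ring

end LG

namespace LG

section SigmaOne

variable {K : Type*} [Field K] {N : ℕ} (P : Orbifold K N)

theorem codim_one : codim (1 : Fin N → Kˣ) = 0 := by rw [codim, movedIdx_one]; rfl

theorem Orbifold.sigma_one_left (h : Fin N → Kˣ) : P.sigma 1 h = 1 := by
  have hc : codim (1 * h) = codim h := by rw [one_mul]
  have hm : movedIdx (1 * h) = movedIdx h := by rw [one_mul]
  have hh : halfExcess 1 h = 0 := by rw [halfExcess, codim_one, hc]; simp
  rw [sigma, if_pos (by rw [codim_one, hc]; simp), hh, Nat.factorial_zero, Nat.cast_one, inv_one,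
    one_smul, pow_zero, upsilon_one, movedIdx_one, monomialBasis_empty, hm]
  exact (congrArg _ (one_mul _)).trans (monomialCoeff_monomialBasis _)

theorem Orbifold.sigma_one_right (g : Fin N → Kˣ) : P.sigma g 1 = 1 := by
  have hc : codim (g * 1) = codim g := by rw [mul_one]
  have hm : movedIdx (g * 1) = movedIdx g := by rw [mul_one]
  have hh : halfExcess g 1 = 0 := by rw [halfExcess, codim_one, hc]; simp
  rw [sigma, if_pos (by rw [codim_one, hc]; simp), hh, Nat.factorial_zero, Nat.cast_one, inv_one,
    one_smul, pow_zero, upsilon_one, movedIdx_one, monomialBasis_empty, hm]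
  exact (congrArg _ (mul_one _)).trans (monomialCoeff_monomialBasis _)

end SigmaOne

section SigmaCusp

variable {g : ℕ} {pts : Fin 3 → Finset ℂ} (hpts : IsSuitable g pts)

/-- If `h`, `k` and `hk` are non-trivial, then `d_h + d_k - d_{hk} = 3` is odd. -/
theorem sigma_cusp_eq_zero {h k : Fin 3 → ℂˣ} (hh : h ∈ cuspGroup g) (hk : k ∈ cuspGroup g)
    (h1 : h ≠ 1) (k1 : k ≠ 1) (hk1 : h * k ≠ 1) : (cusp g pts hpts).sigma h k = 0 := by
  have e1 : codim h = 3 := by rw [codim, movedIdx_of_mem hh h1]; rfl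
  have e2 : codim k = 3 := by rw [codim, movedIdx_of_mem hk k1]; rfl
  have e3 : codim (h * k) = 3 := by rw [codim, movedIdx_of_mem (mul_mem hh hk) hk1]; rfl
  rw [Orbifold.sigma, if_neg]
  rw [e1, e2, e3]
  rintro ⟨-, m, hm⟩
  omega

theorem sq_ne_one_of_pow_eq_one {ζ : ℂˣ} (hζ : ζ ^ (2 * g + 1) = 1) (h1 : ζ ≠ 1) : ζ ^ 2 ≠ 1 :=
  fun h2 => h1 (by rwa [pow_succ, pow_mul, h2, one_pow, one_mul] at hζ)

theorem one_sub_ne_zero {ζ : ℂˣ} (h1 : ζ ≠ 1) : (1 : ℂ) - ζ ≠ 0 :=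
  sub_ne_zero.2 fun h => h1 (Units.ext h.symm)

theorem one_sub_inv_sq_ne_zero {ζ : ℂˣ} (hζ : ζ ^ (2 * g + 1) = 1) (h1 : ζ ≠ 1) :
    (1 : ℂ) - (ζ : ℂ)⁻¹ ^ 2 ≠ 0 := by
  have h2 : ζ⁻¹ ^ 2 ≠ 1 := by rw [inv_pow, Ne, inv_eq_one]; exact sq_ne_one_of_pow_eq_one hζ h1
  simpa using one_sub_ne_zero h2

theorem sigma_cusp_inv (hg : 2 ≤ g) {ζ : ℂˣ} (hζ : ζ ^ (2 * g + 1) = 1) (h1 : ζ ≠ 1) :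
    (cusp g pts hpts).sigma (cuspHom ζ) (cuspHom ζ)⁻¹ =
      (-((1 - (ζ : ℂ)) ^ 2 * (1 - (ζ : ℂ)⁻¹ ^ 2))⁻¹) •
        (cusp g pts hpts).polyCls (cuspHom ζ * (cuspHom ζ)⁻¹)
          (MvPolynomial.X 0 * MvPolynomial.X 1 * MvPolynomial.X 2) := by
  have hz0 : (ζ : ℂ) ≠ 0 := ζ.ne_zero
  have hz1 := one_sub_ne_zero h1
  have hz2 := one_sub_inv_sq_ne_zero hζ h1
  have hζ' : ζ⁻¹ ^ (2 * g + 1) = 1 := by rw [inv_pow, hζ, inv_one]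
  have hm : movedIdx (cuspHom ζ) = Finset.univ := movedIdx_cuspHom hζ h1
  have hm' : movedIdx (cuspHom ζ⁻¹) = Finset.univ :=
    movedIdx_cuspHom hζ' fun h => h1 (inv_eq_one.1 h)
  have hinv : (cuspHom ζ)⁻¹ = cuspHom ζ⁻¹ := (map_inv _ _).symm
  have hT : ∀ i j, cuspHom ζ i = j → rescale (cuspHom ζ) (MvPolynomial.X i) =
      (j : ℂ) • MvPolynomial.X i := by
    rintro i _ rfl
    rw [rescale, MvPolynomial.aeval_X, MvPolynomial.smul_eq_C_mul]
  have c0 : cuspHom ζ 0 = ζ := rfl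
  have c1 : cuspHom ζ 1 = ζ := rfl
  have c2 : cuspHom ζ 2 = ζ⁻¹ ^ 2 := rfl
  have hn2 : (ζ⁻¹ ^ 2) ^ (2 * g + 1) = 1 := by rw [← pow_mul, mul_comm, pow_mul, hζ', one_pow]
  have h2 : ζ⁻¹ ^ 2 ≠ 1 := by rw [inv_pow, Ne, inv_eq_one]; exact sq_ne_one_of_pow_eq_one hζ h1
  have t1 : rescale (cuspHom ζ) (twistCoeff (cuspW g) (cuspHom ζ)⁻¹ 0 1) =
      (((ζ : ℂ)⁻¹ ^ 2 / (1 - ζ)) • MvPolynomial.X 2 : MvPolynomial (Fin 3) ℂ) := by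
    rw [hinv, twistCoeff_cuspW_zero_one hm', map_smul, hT 2 _ c2, smul_smul]
    congr 1
    push_cast
    have : (ζ : ℂ) - 1 ≠ 0 := fun h => hz1 (by linear_combination -h)
    have e : 1 - (ζ : ℂ)⁻¹ = ((ζ : ℂ) - 1) / ζ := by field_simp
    have e' : 1 - (ζ : ℂ) = -((ζ : ℂ) - 1) := by ring
    rw [e, e']
    field_simp
  have t2 : rescale (cuspHom ζ) (twistCoeff (cuspW g) (cuspHom ζ)⁻¹ 0 2) =
      ((1 / (1 - (ζ : ℂ))) • MvPolynomial.X 1 : MvPolynomial (Fin 3) ℂ) := by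
    rw [hinv, twistCoeff_cuspW_zero_two hm', map_smul, hT 1 _ c1, smul_smul]
    congr 1
    push_cast
    have : (ζ : ℂ) - 1 ≠ 0 := fun h => hz1 (by linear_combination -h)
    have e : 1 - (ζ : ℂ)⁻¹ = ((ζ : ℂ) - 1) / ζ := by field_simp
    have e' : 1 - (ζ : ℂ) = -((ζ : ℂ) - 1) := by ring
    rw [e, e']
    field_simp
  have d0 := diffDer₂_cuspW_self g ζ 0 h1 hζ
  have d1 := diffDer₂_cuspW_self g ζ 1 h1 hζ
  have d2 := diffDer₂_cuspW_self g ζ 2 h2 hn2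
  rw [c0] at d0
  rw [c1] at d1
  rw [c2, Units.val_pow_eq_pow_val, Units.val_inv_eq_inv_val] at d2
  have hW : (cusp g pts hpts).W = cuspW g := rfl
  have he : cuspHom ζ * (cuspHom ζ)⁻¹ = 1 := mul_inv_cancel _
  have hm'' : movedIdx (cuspHom ζ)⁻¹ = Finset.univ := by rw [hinv, hm']
  have hgh : movedIdx (cuspHom ζ * (cuspHom ζ)⁻¹) = ∅ := by rw [he, movedIdx_one]
  have w1 : twistCoeff (cusp g pts hpts).W (cuspHom ζ) 1 2 = 0 := twistCoeff_cuspW_one_two hm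
  have w2 : twistCoeff (cusp g pts hpts).W (cuspHom ζ)⁻¹ 1 2 = 0 := by
    rw [hinv]
    exact twistCoeff_cuspW_one_two hm'
  have h3 := Orbifold.sigma_of_movedIdx_eq_univ (cusp g pts hpts) hm hm'' hgh w1 w2
  have h4 := (isCuspHom_polyHom hpts hg he).structure_value ζ hz0 hz1 hz2
  rw [← d0, ← d1, ← d2, ← t1, ← t2, ← diffDer₂_cuspW_one_two g ζ,
    ← twistCoeff_cuspW_zero_one hm, ← twistCoeff_cuspW_zero_two hm] at h4
  exact h3.trans h4

end SigmaCusp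

/-! ### The product -/

namespace Orbifold

variable {K : Type*} [Field K] {N : ℕ} (P : Orbifold K N)

/-- `⌊f⌋ ξ_g` -/
def elt (g : P.G) : P.Reg →ₗ[K] P.Total := (P.sector g).comp (P.cls g).toLinearMap

theorem elt_apply (g : P.G) (f : P.Reg) : P.elt g f = P.sector g (P.cls g f) := rfl

theorem elt_eq_iff_sub_mem {g : P.G} {f f' : P.Reg} (h : f - f' ∈ P.milnorIdeal g) :
    P.elt g f = P.elt g f' := by
  rw [elt_apply, elt_apply, Ideal.Quotient.mk_eq_mk_iff_sub_mem _ _ |>.2 h |> fun h =>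
    (h : P.cls g f = P.cls g f')]

theorem hom_ext {M : Type*} [AddCommMonoid M] [Module K M] {a b : P.Total →ₗ[K] M}
    (h : ∀ g f, a (P.elt g f) = b (P.elt g f)) : a = b := by
  classical
  refine DirectSum.linearMap_ext K fun g => LinearMap.ext fun v => ?_
  obtain ⟨f, rfl⟩ := P.cls_surjective g v
  convert h g f using 2 <;> simp only [elt_apply, sector] <;> congr!

theorem IsCup.elt {P : Orbifold K N} {cup : P.Total →ₗ[K] P.Total →ₗ[K] P.Total}
    (hc : P.IsCup cup) {g h : P.G} {s : P.Reg}
    (hs : P.cls ((g * h : P.G) : Fin N → Kˣ) s = P.sigma g h) (f₁ f₂ : P.Reg) :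
    cup (P.elt g f₁) (P.elt h f₂) = P.elt (g * h) (f₁ * f₂ * s) := by
  rw [elt_apply, elt_apply, hc, elt_apply, map_mul _ (f₁ * f₂), hs]

theorem IsCup.unique {P : Orbifold K N} {cup cup' : P.Total →ₗ[K] P.Total →ₗ[K] P.Total}
    (hc : P.IsCup cup) (hc' : P.IsCup cup') : cup' = cup :=
  P.hom_ext fun g f => P.hom_ext fun h f' => by
    rw [elt_apply, elt_apply, hc, hc']

theorem act_elt (k g : P.G) (f : P.Reg) : P.act k (P.elt g f) =
    (∏ i ∈ movedIdx (g : Fin N → Kˣ), (((k : Fin N → Kˣ) i : Kˣ) : K)⁻¹) •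
      P.elt g (P.actReg k f) := by
  classical
  rw [← map_smul]
  have h : P.sector g = DirectSum.lof K P.G (fun g => P.Milnor (g : Fin N → Kˣ)) g := by
    unfold sector; congr!
  rw [elt_apply, elt_apply, h, act, DirectSum.lmap_lof, map_smul]
  rfl

end Orbifold

end LG

namespace LG

namespace Orbifold

variable {K : Type*} [Field K] {N : ℕ} (P : Orbifold K N)

/-- Lifts of the structure constants to regular functions give a product, provided that
multiplication by them is well defined on the Milnor algebras. The product is constructed with the
help of linear sections of the projections onto the Milnor algebras. -/
theorem exists_isCup (s : P.G → P.G → P.Reg)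
    (hs : ∀ g h : P.G, P.cls ((g * h : P.G) : Fin N → Kˣ) (s g h) = P.sigma g h)
    (hl : ∀ g h : P.G, ∀ r ∈ P.milnorIdeal g,
      r * s g h ∈ P.milnorIdeal ((g * h : P.G) : Fin N → Kˣ))
    (hr : ∀ g h : P.G, ∀ r ∈ P.milnorIdeal h,
      r * s g h ∈ P.milnorIdeal ((g * h : P.G) : Fin N → Kˣ)) :
    ∃ cup : P.Total →ₗ[K] P.Total →ₗ[K] P.Total, P.IsCup cup := by
  classical
  have hsec : ∀ g : P.G, ∃ t : P.Milnor (g : Fin N → Kˣ) →ₗ[K] P.Reg,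
      (P.cls g).toLinearMap ∘ₗ t = LinearMap.id := fun g =>
    LinearMap.exists_rightInverse_of_surjective _
      (LinearMap.range_eq_top.2 (P.cls_surjective g))
  choose t ht using hsec
  have ht' : ∀ (g : P.G) (f : P.Reg), f - t g (P.cls g f) ∈ P.milnorIdeal g := fun g f => by
    rw [← cls_eq_zero_iff, map_sub, sub_eq_zero]
    exact (LinearMap.congr_fun (ht g) (P.cls g f)).symm
  let μ : ∀ g h : P.G, P.Milnor (g : Fin N → Kˣ) →ₗ[K] P.Milnor (h : Fin N → Kˣ) →ₗ[K]
      P.Total := fun g h =>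
    ((LinearMap.mul K P.Reg).compr₂ (P.elt (g * h) ∘ₗ LinearMap.mulRight K (s g h))).compl₁₂
      (t g) (t h)
  have hμ : ∀ g h v w, μ g h v w = P.elt (g * h) (t g v * t h w * s g h) := fun _ _ _ _ => rfl
  let cup : P.Total →ₗ[K] P.Total →ₗ[K] P.Total :=
    DirectSum.toModule K P.G (P.Total →ₗ[K] P.Total) fun g =>
      LinearMap.flip (DirectSum.toModule K P.G (P.Milnor (g : Fin N → Kˣ) →ₗ[K] P.Total)
        fun h => (μ g h).flip)
  have hsector : ∀ g : P.G, P.sector g =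
      DirectSum.lof K P.G (fun g => P.Milnor (g : Fin N → Kˣ)) g := fun g => by
    unfold sector; congr!
  have hcup : ∀ (g h : P.G) v w, cup (P.sector g v) (P.sector h w) = μ g h v w := by
    intro g h v w
    rw [hsector, hsector, DirectSum.toModule_lof, LinearMap.flip_apply, DirectSum.toModule_lof,
      LinearMap.flip_apply]
  refine ⟨cup, fun g h f₁ f₂ => ?_⟩
  rw [hcup, hμ, ← hs, ← map_mul, ← elt_apply]
  refine (P.elt_eq_iff_sub_mem ?_).symm
  have h1 := Ideal.mul_mem_right f₂ _ (hl g h _ (ht' g f₁))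
  have h2 := Ideal.mul_mem_right (t g (P.cls g f₁)) _ (hr g h _ (ht' h f₂))
  convert Ideal.add_mem _ h1 h2 using 1
  ring

theorem unit_eq : P.unit = P.elt 1 1 := congrArg (P.sector 1) (map_one (P.cls _)).symm

theorem act_elt_of_prod_eq_one {k g : P.G} (h : ∏ i ∈ movedIdx (g : Fin N → Kˣ),
    (((k : Fin N → Kˣ) i : Kˣ) : K)⁻¹ = 1) (f : P.Reg) :
    P.act k (P.elt g f) = P.elt g (P.actReg k f) := by
  rw [act_elt, h]
  exact one_smul K (P.elt g (P.actReg k f))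

/-- The product is that of an algebra if the lifts of the structure constants satisfy the cocycle
identity and are invariant, the group acting trivially on the elements `ξ_g`. -/
theorem IsCup.isAlgebra {P : Orbifold K N} {cup : P.Total →ₗ[K] P.Total →ₗ[K] P.Total}
    (hc : P.IsCup cup) (s : P.G → P.G → P.Reg)
    (hs : ∀ g h : P.G, P.cls ((g * h : P.G) : Fin N → Kˣ) (s g h) = P.sigma g h)
    (hassoc : ∀ g h k : P.G, s g h * s (g * h) k - s h k * s g (h * k) ∈
      P.milnorIdeal ((g * h * k : P.G) : Fin N → Kˣ))
    (hs1 : ∀ g, s 1 g = 1) (hs2 : ∀ g, s g 1 = 1) (hact : ∀ k g h, P.actReg k (s g h) = s g h)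
    (hdet : ∀ k g : P.G, ∏ i ∈ movedIdx (g : Fin N → Kˣ),
      (((k : Fin N → Kˣ) i : Kˣ) : K)⁻¹ = 1) : P.IsAlgebra cup := by
  have hequiv : ∀ k x y, P.act k (cup x y) = cup (P.act k x) (P.act k y) := by
    intro k
    have h1 : cup.compr₂ (P.act k) = cup.compl₁₂ (P.act k) (P.act k) :=
      P.hom_ext fun g f => P.hom_ext fun h f' => by
        rw [LinearMap.compr₂_apply, LinearMap.compl₁₂_apply, hc.elt (hs g h),
          P.act_elt_of_prod_eq_one (hdet _ _), P.act_elt_of_prod_eq_one (hdet _ _),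
          P.act_elt_of_prod_eq_one (hdet _ _), hc.elt (hs g h), map_mul (P.actReg k),
          map_mul (P.actReg k), hact]
    exact fun x y => LinearMap.congr_fun₂ h1 x y
  refine ⟨hc, ?_, ?_, ?_, hequiv, ?_, ?_⟩
  · have h3 : ∀ g f h f' z, cup (cup (P.elt g f) (P.elt h f')) z =
        cup (P.elt g f) (cup (P.elt h f') z) := fun g f h f' z =>
      LinearMap.congr_fun (f := cup (cup (P.elt g f) (P.elt h f')))
        (g := cup (P.elt g f) ∘ₗ cup (P.elt h f')) (P.hom_ext fun k f'' => by
          rw [LinearMap.comp_apply, hc.elt (hs g h), hc.elt (hs (g * h) k), hc.elt (hs h k),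
            hc.elt (hs g (h * k)), ← mul_assoc g h k]
          refine P.elt_eq_iff_sub_mem ?_
          convert Ideal.mul_mem_left _ (f * f' * f'') (hassoc g h k) using 1
          ring) z
    have h2 : ∀ g f y z, cup (cup (P.elt g f) y) z = cup (P.elt g f) (cup y z) :=
      fun g f y z => LinearMap.congr_fun (f := cup.flip z ∘ₗ cup (P.elt g f))
        (g := cup (P.elt g f) ∘ₗ cup.flip z) (P.hom_ext fun h f' => h3 g f h f' z) y
    exact fun x y z => LinearMap.congr_fun (f := cup.flip z ∘ₗ cup.flip y)
        (g := cup.flip (cup y z)) (P.hom_ext fun g f => h2 g f y z) x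
  · intro x
    refine LinearMap.congr_fun (f := cup P.unit) (g := LinearMap.id) (P.hom_ext fun g f => ?_) x
    rw [unit_eq, hc.elt (hs 1 g), hs1, one_mul, mul_one, one_mul, LinearMap.id_apply]
  · intro x
    refine LinearMap.congr_fun (f := cup.flip P.unit) (g := LinearMap.id)
      (P.hom_ext fun g f => ?_) x
    rw [LinearMap.flip_apply, unit_eq, hc.elt (hs g 1), hs2, mul_one, mul_one, mul_one,
      LinearMap.id_apply]
  · rw [invariants, Submodule.mem_iInf]
    intro k
    rw [LinearMap.mem_eqLocus, unit_eq, P.act_elt_of_prod_eq_one (hdet _ _), map_one,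
      LinearMap.id_apply]
  · intro x hx y hy
    rw [invariants, Submodule.mem_iInf] at hx hy ⊢
    intro k
    rw [LinearMap.mem_eqLocus, hequiv, LinearMap.mem_eqLocus.1 (hx k),
      LinearMap.mem_eqLocus.1 (hy k)]
    rfl

end Orbifold

/-! ### The algebra of the cusp -/

section Cusp

variable {g : ℕ} {pts : Fin 3 → Finset ℂ} (hpts : IsSuitable g pts)

/-- The coefficient of `φ` in the structure constant of `(ζ, ζ, ζ⁻²)` and its inverse. -/
def sigmaCoeff (z : ℂ) : ℂ := -((1 - z) ^ 2 * (1 - z⁻¹ ^ 2))⁻¹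

/-- The function `x₁x₂x₃` on `X`. -/
def phi : (cusp g pts hpts).Reg :=
  algebraMap _ _ (MvPolynomial.X 0 * MvPolynomial.X 1 * MvPolynomial.X 2 : MvPolynomial (Fin 3) ℂ)

theorem milnorIdeal_of_ne_one {k : (cusp g pts hpts).G} (hk : k ≠ 1) :
    (cusp g pts hpts).milnorIdeal k = RingHom.ker (cusp g pts hpts).evalZero :=
  (cusp g pts hpts).milnorIdeal_eq_ker (movedIdx_of_mem k.2 fun h => hk (Subtype.ext h))

theorem milnorIdeal_one_le (hg : 2 ≤ g) (k : (cusp g pts hpts).G) :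
    (cusp g pts hpts).milnorIdeal (1 : (cusp g pts hpts).G) ≤ (cusp g pts hpts).milnorIdeal k := by
  by_cases hk : k = 1
  · rw [hk]
  · rw [milnorIdeal_of_ne_one hpts hk]
    exact milnorIdeal_le_ker hpts hg rfl

/-- `φ` vanishes in the twisted sectors. -/
theorem phi_mem {k : (cusp g pts hpts).G} (hk : k ≠ 1) :
    phi hpts ∈ (cusp g pts hpts).milnorIdeal k := by
  rw [milnorIdeal_of_ne_one hpts hk, RingHom.mem_ker, phi, Orbifold.evalZero_algebraMap]
  simp

/-- The maximal ideal at the origin annihilates `φ`. -/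
theorem mul_phi_mem (hg : 2 ≤ g) {k : (cusp g pts hpts).G} (hk : k ≠ 1) {r : (cusp g pts hpts).Reg}
    (hr : r ∈ (cusp g pts hpts).milnorIdeal k) :
    r * phi hpts ∈ (cusp g pts hpts).milnorIdeal (1 : (cusp g pts hpts).G) := by
  have hm : movedIdx (k : Fin 3 → ℂˣ) = Finset.univ :=
    movedIdx_of_mem k.2 fun h => hk (Subtype.ext h)
  refine Submodule.span_induction (p := fun r _ => r * phi hpts ∈
    (cusp g pts hpts).milnorIdeal (1 : (cusp g pts hpts).G)) ?_ ?_ ?_ ?_ hr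
  · rintro _ (⟨i, -, rfl⟩ | ⟨i, hi, rfl⟩)
    · rw [phi, ← map_mul, ← Orbifold.cls_eq_zero_iff]
      exact (map_mul _ _ _).trans ((isCuspHom_polyHom hpts hg rfl).X_mul_phi i)
    · exact absurd (hm ▸ Finset.mem_univ i) hi
  · rw [zero_mul]
    exact Ideal.zero_mem _
  · intro x y _ _ hx hy
    rw [add_mul]
    exact Ideal.add_mem _ hx hy
  · intro a x _ hx
    rw [smul_eq_mul, mul_assoc]
    exact Ideal.mul_mem_left _ _ hx

open Classical in
/-- The structure constants, lifted to regular functions. -/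
def sigmaLift (k l : (cusp g pts hpts).G) : (cusp g pts hpts).Reg :=
  if k = 1 ∨ l = 1 then 1 else if k * l = 1 then
    sigmaCoeff ((k : Fin 3 → ℂˣ) 0 : ℂˣ) • phi hpts else 0

variable {hpts}

theorem sigmaLift_one_left (l : (cusp g pts hpts).G) : sigmaLift hpts 1 l = 1 := by
  rw [sigmaLift, if_pos (Or.inl rfl)]

theorem sigmaLift_one_right (k : (cusp g pts hpts).G) : sigmaLift hpts k 1 = 1 := by
  rw [sigmaLift, if_pos (Or.inr rfl)]

theorem sigmaLift_of_mul_eq_one {k l : (cusp g pts hpts).G} (hk : k ≠ 1) (hkl : k * l = 1) :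
    sigmaLift hpts k l = sigmaCoeff ((k : Fin 3 → ℂˣ) 0 : ℂˣ) • phi hpts := by
  rw [sigmaLift, if_neg, if_pos hkl]
  rintro (h | rfl)
  · exact hk h
  · exact hk (by rwa [mul_one] at hkl)

theorem sigmaLift_of_mul_ne_one {k l : (cusp g pts hpts).G} (hk : k ≠ 1) (hl : l ≠ 1)
    (hkl : k * l ≠ 1) : sigmaLift hpts k l = 0 := by
  rw [sigmaLift, if_neg (by tauto), if_neg hkl]

theorem cls_sigmaLift (hg : 2 ≤ g) (k l : (cusp g pts hpts).G) :
    (cusp g pts hpts).cls ((k * l : (cusp g pts hpts).G) : Fin 3 → ℂˣ) (sigmaLift hpts k l) =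
      (cusp g pts hpts).sigma k l := by
  by_cases hk : k = 1
  · subst hk
    rw [sigmaLift_one_left]
    exact (map_one _).trans (Orbifold.sigma_one_left _ _).symm
  by_cases hl : l = 1
  · subst hl
    rw [sigmaLift_one_right]
    exact (map_one _).trans (Orbifold.sigma_one_right _ _).symm
  by_cases hkl : k * l = 1
  · rw [sigmaLift_of_mul_eq_one hk hkl]
    obtain rfl : l = k⁻¹ := (inv_eq_of_mul_eq_one_right hkl).symm
    obtain ⟨k, hkG⟩ := k
    obtain ⟨ζ, hζ, rfl⟩ := (mem_cuspGroup_iff g k).1 hkG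
    have hζ1 : ζ ≠ 1 := by
      rintro rfl
      exact hk (Subtype.ext (map_one _))
    exact (map_smul _ _ _).trans (sigma_cusp_inv hpts hg hζ hζ1).symm
  · rw [sigmaLift_of_mul_ne_one hk hl hkl]
    refine (map_zero _).trans (sigma_cusp_eq_zero hpts k.2 l.2 (fun h => hk (Subtype.ext h))
      (fun h => hl (Subtype.ext h)) fun h => hkl (Subtype.ext h)).symm

theorem mul_sigmaLift_mem_left (hg : 2 ≤ g) (k l : (cusp g pts hpts).G) {r}
    (hr : r ∈ (cusp g pts hpts).milnorIdeal k) :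
    r * sigmaLift hpts k l ∈ (cusp g pts hpts).milnorIdeal
      ((k * l : (cusp g pts hpts).G) : Fin 3 → ℂˣ) := by
  by_cases hk : k = 1
  · subst hk
    exact Ideal.mul_mem_right _ _ (milnorIdeal_one_le hpts hg _ hr)
  by_cases hl : l = 1
  · subst hl
    rw [mul_one k]
    exact Ideal.mul_mem_right _ _ hr
  by_cases hkl : k * l = 1
  · rw [sigmaLift_of_mul_eq_one hk hkl, hkl, mul_smul_comm]
    exact Submodule.smul_of_tower_mem _ _ (mul_phi_mem hpts hg hk hr)
  · rw [sigmaLift_of_mul_ne_one hk hl hkl, mul_zero]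
    exact Ideal.zero_mem _

theorem mul_sigmaLift_mem_right (hg : 2 ≤ g) (k l : (cusp g pts hpts).G) {r}
    (hr : r ∈ (cusp g pts hpts).milnorIdeal l) :
    r * sigmaLift hpts k l ∈ (cusp g pts hpts).milnorIdeal
      ((k * l : (cusp g pts hpts).G) : Fin 3 → ℂˣ) := by
  by_cases hk : k = 1
  · subst hk
    rw [one_mul l]
    exact Ideal.mul_mem_right _ _ hr
  by_cases hl : l = 1
  · subst hl
    exact Ideal.mul_mem_right _ _ (milnorIdeal_one_le hpts hg _ hr)
  by_cases hkl : k * l = 1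
  · rw [sigmaLift_of_mul_eq_one hk hkl, hkl, mul_smul_comm]
    exact Submodule.smul_of_tower_mem _ _ (mul_phi_mem hpts hg hl hr)
  · rw [sigmaLift_of_mul_ne_one hk hl hkl, mul_zero]
    exact Ideal.zero_mem _

theorem sigmaLift_mem {k l m : (cusp g pts hpts).G} (hk : k ≠ 1) (hl : l ≠ 1)
    (hm : k * l = 1 → m ≠ 1) : sigmaLift hpts k l ∈ (cusp g pts hpts).milnorIdeal m := by
  by_cases hkl : k * l = 1
  · rw [sigmaLift_of_mul_eq_one hk hkl]
    exact Submodule.smul_of_tower_mem _ _ (phi_mem hpts (hm hkl))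
  · rw [sigmaLift_of_mul_ne_one hk hl hkl]
    exact Ideal.zero_mem _

/-- For non-trivial elements both products lie in the ideal: if `kl = 1`, then `klm = m` is
non-trivial, and `φ` vanishes in the twisted sectors. -/
theorem sigmaLift_cocycle (k l m : (cusp g pts hpts).G) :
    sigmaLift hpts k l * sigmaLift hpts (k * l) m - sigmaLift hpts l m * sigmaLift hpts k (l * m) ∈
      (cusp g pts hpts).milnorIdeal ((k * l * m : (cusp g pts hpts).G) : Fin 3 → ℂˣ) := by
  by_cases hk : k = 1
  · subst hk
    rw [sigmaLift_one_left, sigmaLift_one_left, one_mul l, one_mul, mul_one, sub_self]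
    exact Ideal.zero_mem _
  by_cases hl : l = 1
  · subst hl
    rw [sigmaLift_one_right, sigmaLift_one_left, mul_one k, one_mul m, sub_self]
    exact Ideal.zero_mem _
  by_cases hm : m = 1
  · subst hm
    rw [sigmaLift_one_right, sigmaLift_one_right, mul_one l, mul_one (sigmaLift hpts k l),
      one_mul, sub_self]
    exact Ideal.zero_mem _
  refine Ideal.sub_mem _ (Ideal.mul_mem_right _ _ (sigmaLift_mem hk hl fun h => ?_))
    (Ideal.mul_mem_right _ _ (sigmaLift_mem hl hm fun h => ?_))
  · rwa [h, one_mul]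
  · rwa [mul_assoc, h, mul_one]

theorem rescale_phi {k : Fin 3 → ℂˣ} (hk : k ∈ cuspGroup g) :
    rescale k (MvPolynomial.X 0 * MvPolynomial.X 1 * MvPolynomial.X 2) =
      MvPolynomial.X 0 * MvPolynomial.X 1 * MvPolynomial.X 2 := by
  obtain ⟨ζ, -, rfl⟩ := (mem_cuspGroup_iff g k).1 hk
  have h := rescale_cuspHom_expo ζ 1 1 1
  simpa using h

theorem actReg_sigmaLift (k l m : (cusp g pts hpts).G) :
    (cusp g pts hpts).actReg k (sigmaLift hpts l m) = sigmaLift hpts l m := by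
  have h : (cusp g pts hpts).actReg k (phi hpts) = phi hpts := by
    rw [phi, Orbifold.actReg_algebraMap, rescale_phi k.2]
  rw [sigmaLift]
  split_ifs
  · exact map_one _
  · rw [map_smul, h]
  · exact map_zero _

/-- The group lies in `SL₃`. -/
theorem prod_movedIdx_inv (k l : (cusp g pts hpts).G) : ∏ i ∈ movedIdx (l : Fin 3 → ℂˣ),
    (((k : Fin 3 → ℂˣ) i : ℂˣ) : ℂ)⁻¹ = 1 := by
  by_cases hl : (l : Fin 3 → ℂˣ) = 1
  · rw [hl, movedIdx_one, Finset.prod_empty]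
  · obtain ⟨k, hk⟩ := k
    obtain ⟨ζ, -, rfl⟩ := (mem_cuspGroup_iff g k).1 hk
    have h0 : cuspHom ζ 0 = ζ := rfl
    have h1 : cuspHom ζ 1 = ζ := rfl
    have h2 : cuspHom ζ 2 = ζ⁻¹ ^ 2 := rfl
    have hz : (ζ : ℂ) ≠ 0 := ζ.ne_zero
    rw [movedIdx_of_mem l.2 hl, Fin.prod_univ_three]
    dsimp only
    rw [h0, h1, h2]
    push_cast
    field_simp

theorem exists_cusp_isAlgebra (hg : 2 ≤ g) : ∃ cup, (cusp g pts hpts).IsAlgebra cup := by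
  obtain ⟨cup, hc⟩ := (cusp g pts hpts).exists_isCup (sigmaLift hpts) (cls_sigmaLift hg)
    (fun k l _ => mul_sigmaLift_mem_left hg k l) (fun k l _ => mul_sigmaLift_mem_right hg k l)
  exact ⟨cup, hc.isAlgebra (sigmaLift hpts) (cls_sigmaLift hg) sigmaLift_cocycle
    sigmaLift_one_left sigmaLift_one_right actReg_sigmaLift prod_movedIdx_inv⟩

end Cusp

end LG

/-! ### Components of elements and their parity -/

namespace LG

namespace Orbifold

variable {K : Type*} [Field K] {N : ℕ} (P : Orbifold K N)

/-- The coefficient at `ξ_g`. -/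
def coeffAt (g : P.G) : P.Total →ₗ[K] P.Milnor (g : Fin N → Kˣ) :=
  DirectSum.component K P.G (fun g => P.Milnor (g : Fin N → Kˣ)) g

variable {P}

theorem sector_eq (g : P.G) [DecidableEq P.G] :
    P.sector g = DirectSum.lof K P.G (fun g => P.Milnor (g : Fin N → Kˣ)) g := by
  unfold sector; congr!

theorem coeffAt_elt_self (g : P.G) (f : P.Reg) : P.coeffAt g (P.elt g f) = P.cls g f := by
  classical
  rw [elt_apply, sector_eq]
  exact DirectSum.component.lof_self ..

theorem coeffAt_elt_of_ne {g h : P.G} (hgh : g ≠ h) (f : P.Reg) :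
    P.coeffAt h (P.elt g f) = 0 := by
  classical
  rw [elt_apply, sector_eq]
  exact (DirectSum.component.of ..).trans (dif_neg hgh)

theorem coeffAt_act (k g : P.G) (x : P.Total) : P.coeffAt g (P.act k x) =
    (∏ i ∈ movedIdx (g : Fin N → Kˣ), (((k : Fin N → Kˣ) i : Kˣ) : K)⁻¹) •
      P.actMilnor k g (P.coeffAt g x) := rfl

theorem ext_coeffAt {x y : P.Total} (h : ∀ g, P.coeffAt g x = P.coeffAt g y) : x = y :=
  DirectSum.ext_component K h

theorem mem_even_iff (x : P.Total) : x ∈ P.even ↔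
    ∀ g : P.G, ¬ Even (codim (g : Fin N → Kˣ)) → P.coeffAt g x = 0 := by
  rw [even, Submodule.mem_iInf]
  exact ⟨fun h g hg => h ⟨g, hg⟩, fun h g => h g.1 g.2⟩

theorem mem_odd_iff (x : P.Total) : x ∈ P.odd ↔
    ∀ g : P.G, Even (codim (g : Fin N → Kˣ)) → P.coeffAt g x = 0 := by
  rw [odd, Submodule.mem_iInf]
  exact ⟨fun h g hg => h ⟨g, hg⟩, fun h g => h g.1 g.2⟩

end Orbifold

/-! ### The pairing of the twisted sectors -/

section Cusp

theorem sigmaCoeff_inv {z : ℂ} (hz : z ≠ 0) : sigmaCoeff z⁻¹ = -sigmaCoeff z := by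
  have h : (1 - z⁻¹) ^ 2 * (1 - z⁻¹⁻¹ ^ 2) = -((1 - z) ^ 2 * (1 - z⁻¹ ^ 2)) := by
    rw [inv_inv]
    field_simp
    ring
  rw [sigmaCoeff, sigmaCoeff, h, inv_neg]

theorem cuspHom_injective : Function.Injective cuspHom := fun _ _ h => congrFun h 0

variable (g : ℕ)

theorem card_cuspGroup : Nat.card (cuspGroup g) = 2 * g + 1 := by
  have : NeZero (2 * g + 1) := ⟨by omega⟩
  rw [cuspGroup, Nat.card_congr ((rootsOfUnity (2 * g + 1) ℂ).equivMapOfInjective cuspHom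
    cuspHom_injective).toEquiv.symm, Complex.card_rootsOfUnity]

variable {g} {pts : Fin 3 → Finset ℂ} (hpts : IsSuitable g pts)

instance : Finite (cusp g pts hpts).G :=
  Nat.finite_of_card_ne_zero ((card_cuspGroup g).trans_ne (by omega))

instance : Fintype (cusp g pts hpts).G := Fintype.ofFinite _

/-- The non-trivial elements of the group. -/
abbrev Twist : Type := {k : (cusp g pts hpts).G // k ≠ 1}

theorem finrank_twist : Module.finrank ℂ (Twist hpts → ℂ) = 2 * g := by
  classical
  rw [Module.finrank_fintype_fun_eq_card, Fintype.card_subtype_compl, Fintype.card_subtype_eq,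
    ← Nat.card_eq_fintype_card]
  exact congrArg (· - 1) (card_cuspGroup g)

variable {hpts}

/-- The inversion on the non-trivial elements. -/
def Twist.inv : Twist hpts ≃ Twist hpts :=
  (Equiv.inv (cusp g pts hpts).G).subtypeEquiv fun k => by simp

/-- The coefficient of `φ` in `ξ_k ∪ ξ_{k⁻¹}`. -/
def Twist.weight (k : Twist hpts) : ℂ := sigmaCoeff ((k.1 : Fin 3 → ℂˣ) 0 : ℂˣ)

theorem Twist.weight_inv (k : Twist hpts) : k.inv.weight = -k.weight := by
  rw [weight, weight, ← sigmaCoeff_inv (Units.ne_zero _), ← Units.val_inv_eq_inv_val]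
  rfl

theorem Twist.weight_ne_zero (k : Twist hpts) : k.weight ≠ 0 := by
  obtain ⟨⟨k, hk⟩, hk1⟩ := k
  obtain ⟨ζ, hζ, rfl⟩ := (mem_cuspGroup_iff g k).1 hk
  have h1 : ζ ≠ 1 := by
    rintro rfl
    exact hk1 (Subtype.ext (map_one _))
  exact neg_ne_zero.2 (inv_ne_zero (mul_ne_zero (pow_ne_zero _ (one_sub_ne_zero h1))
    (one_sub_inv_sq_ne_zero hζ h1)))

variable (hpts)

/-- The pairing of the twisted sectors: `(u, v) ↦ ∑ₖ uₖ vₖ⁻¹ cₖ`, where `σ_{k, k⁻¹} = cₖ φ`. -/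
def twistForm : LinearMap.BilinForm ℂ (Twist hpts → ℂ) :=
  ∑ k : Twist hpts, (k.weight • LinearMap.proj k : (Twist hpts → ℂ) →ₗ[ℂ] ℂ).smulRight
    (LinearMap.proj k.inv : (Twist hpts → ℂ) →ₗ[ℂ] ℂ)

variable {hpts}

theorem twistForm_apply (u v : Twist hpts → ℂ) :
    twistForm hpts u v = ∑ k : Twist hpts, k.weight * u k * v k.inv := by
  simp [twistForm, LinearMap.sum_apply]

/-- As `1/((1 - ζ)²(1 - ζ⁻²))` is odd under `ζ ↦ ζ⁻¹`, the pairing is alternating. -/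
theorem twistForm_isAlt : (twistForm hpts).IsAlt := by
  intro u
  have h : twistForm hpts u u = -twistForm hpts u u := by
    conv_lhs => rw [twistForm_apply, ← Equiv.sum_comp Twist.inv]
    rw [twistForm_apply, ← Finset.sum_neg_distrib]
    refine Finset.sum_congr rfl fun k _ => ?_
    have : k.inv.inv = k := Subtype.ext (inv_inv _)
    rw [Twist.weight_inv, this]
    ring
  exact self_eq_neg.1 h

theorem eq_zero_of_twistForm (u : Twist hpts → ℂ) (h : ∀ v, twistForm hpts u v = 0) : u = 0 := by
  classical
  ext1 k
  have h1 := h (Pi.single k.inv 1)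
  rw [twistForm_apply, Finset.sum_eq_single k] at h1
  · rw [Pi.single_eq_same, mul_one] at h1
    exact (mul_eq_zero.1 h1).resolve_left k.weight_ne_zero
  · intro l _ hl
    rw [Pi.single_eq_of_ne (fun h => hl (Twist.inv.injective h)), mul_zero]
  · exact fun h => absurd (Finset.mem_univ k) h

end Cusp

end LG

/-! ### The algebra of invariants -/

namespace LG

/-- The linear map `(a, u, b) ↦ a E + U u + b F`. -/
def triple {V M : Type*} [AddCommMonoid V] [Module ℂ V] [AddCommMonoid M] [Module ℂ M] (E F : M)
    (U : V →ₗ[ℂ] M) : (ℂ × V × ℂ) →ₗ[ℂ] M :=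
  (LinearMap.toSpanSingleton ℂ M E).coprod (U.coprod (LinearMap.toSpanSingleton ℂ M F))

theorem triple_apply {V M : Type*} [AddCommMonoid V] [Module ℂ V] [AddCommMonoid M] [Module ℂ M]
    (E F : M) (U : V →ₗ[ℂ] M) (p : ℂ × V × ℂ) :
    triple E F U p = p.1 • E + (U p.2.1 + p.2.2 • F) := rfl

/-- The product on the span of a unit `E`, an element `F` and the elements `U u`, where `F` is
annihilated by itself and by the `U u`, and `U u ∪ U v = B(u, v) F`. -/
theorem cup_triple {V M : Type*} [AddCommMonoid V] [Module ℂ V] [AddCommMonoid M] [Module ℂ M]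
    {E F : M} {U : V →ₗ[ℂ] M} {cup : M →ₗ[ℂ] M →ₗ[ℂ] M} (B : LinearMap.BilinForm ℂ V)
    (hl : ∀ x, cup E x = x) (hr : ∀ x, cup x E = x) (hFF : cup F F = 0)
    (hFU : ∀ u, cup F (U u) = 0) (hUF : ∀ u, cup (U u) F = 0)
    (hUU : ∀ u v, cup (U u) (U v) = B u v • F) (p q : ℂ × V × ℂ) :
    cup (triple E F U p) (triple E F U q) = triple E F U (p.1 * q.1,
      p.1 • q.2.1 + q.1 • p.2.1, p.1 * q.2.2 + q.1 * p.2.2 + B p.2.1 q.2.1) := by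
  simp only [triple_apply, map_add, map_smul, LinearMap.add_apply, LinearMap.smul_apply, hl, hr,
    hFF, hFU, hUF, hUU, smul_zero, add_zero]
  module

section Cusp

variable {g : ℕ} {pts : Fin 3 → Finset ℂ} (hpts : IsSuitable g pts)

/-- The element `∑ₖ uₖ ξ_k`. -/
def twisted : (Twist hpts → ℂ) →ₗ[ℂ] (cusp g pts hpts).Total :=
  ∑ k : Twist hpts, (LinearMap.proj k : (Twist hpts → ℂ) →ₗ[ℂ] ℂ).smulRight
    ((cusp g pts hpts).elt k.1 1)

theorem twisted_apply (u : Twist hpts → ℂ) :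
    twisted hpts u = ∑ k : Twist hpts, u k • (cusp g pts hpts).elt k.1 1 := by
  simp [twisted, LinearMap.sum_apply]

/-- The element `a ξ_e + ∑ₖ uₖ ξ_k + b φ ξ_e`. -/
def invariantElt : (ℂ × (Twist hpts → ℂ) × ℂ) →ₗ[ℂ] (cusp g pts hpts).Total :=
  triple (cusp g pts hpts).unit ((cusp g pts hpts).elt 1 (phi hpts)) (twisted hpts)

theorem elt_eq_zero {k : (cusp g pts hpts).G} {f : (cusp g pts hpts).Reg}
    (hf : f ∈ (cusp g pts hpts).milnorIdeal k) : (cusp g pts hpts).elt k f = 0 := by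
  rw [← map_zero ((cusp g pts hpts).elt k)]
  exact (cusp g pts hpts).elt_eq_iff_sub_mem (by rwa [sub_zero])

theorem phi_mul_phi_mem (hg : 2 ≤ g) : phi hpts * phi hpts ∈
    (cusp g pts hpts).milnorIdeal (1 : (cusp g pts hpts).G) := by
  rw [phi, ← map_mul, ← Orbifold.cls_eq_zero_iff]
  have h : ∀ {A : Type} [CommRing A] [Algebra ℂ A] {π : MvPolynomial (Fin 3) ℂ →ₐ[ℂ] A},
      IsCuspHom g pts π → π ((.X 0 * .X 1 * .X 2) * (.X 0 * .X 1 * .X 2)) = 0 := by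
    intro A _ _ π hπ
    rw [map_mul, map_mul _ _ (MvPolynomial.X 2), mul_assoc, ← map_mul _ (MvPolynomial.X 0 * _),
      hπ.X_mul_phi, mul_zero]
  exact h (isCuspHom_polyHom hpts hg rfl)

variable {hpts} {cup : (cusp g pts hpts).Total →ₗ[ℂ] (cusp g pts hpts).Total →ₗ[ℂ]
  (cusp g pts hpts).Total}

theorem cup_phi_phi (hg : 2 ≤ g) (hc : (cusp g pts hpts).IsCup cup) :
    cup ((cusp g pts hpts).elt 1 (phi hpts)) ((cusp g pts hpts).elt 1 (phi hpts)) = 0 := by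
  rw [hc.elt (cls_sigmaLift hg 1 1), sigmaLift_one_left, mul_one (_ * _), mul_one 1]
  exact elt_eq_zero hpts (phi_mul_phi_mem hpts hg)

theorem cup_phi_twisted (hg : 2 ≤ g) (hc : (cusp g pts hpts).IsCup cup) (u : Twist hpts → ℂ) :
    cup ((cusp g pts hpts).elt 1 (phi hpts)) (twisted hpts u) = 0 := by
  rw [twisted_apply, map_sum]
  refine Finset.sum_eq_zero fun k _ => ?_
  rw [map_smul, hc.elt (cls_sigmaLift hg 1 k.1), sigmaLift_one_left, mul_one, mul_one,
    one_mul k.1, elt_eq_zero hpts (phi_mem hpts k.2)]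
  exact smul_zero (M := ℂ) (A := (cusp g pts hpts).Total) _

theorem cup_twisted_phi (hg : 2 ≤ g) (hc : (cusp g pts hpts).IsCup cup) (u : Twist hpts → ℂ) :
    cup (twisted hpts u) ((cusp g pts hpts).elt 1 (phi hpts)) = 0 := by
  rw [twisted_apply, map_sum, LinearMap.sum_apply]
  refine Finset.sum_eq_zero fun k _ => ?_
  rw [map_smul, LinearMap.smul_apply, hc.elt (cls_sigmaLift hg k.1 1), sigmaLift_one_right,
    one_mul, mul_one (phi hpts), mul_one k.1, elt_eq_zero hpts (phi_mem hpts k.2)]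
  exact smul_zero (M := ℂ) (A := (cusp g pts hpts).Total) _

theorem cup_twisted_twisted (hg : 2 ≤ g) (hc : (cusp g pts hpts).IsCup cup)
    (u v : Twist hpts → ℂ) : cup (twisted hpts u) (twisted hpts v) =
      twistForm hpts u v • (cusp g pts hpts).elt 1 (phi hpts) := by
  rw [twisted_apply hpts u, map_sum, LinearMap.sum_apply, twistForm_apply]
  refine (Finset.sum_congr rfl fun k _ => ?_).trans
    (Finset.sum_smul (R := ℂ) (M := (cusp g pts hpts).Total)).symm
  rw [map_smul, LinearMap.smul_apply, twisted_apply, map_sum, Finset.sum_eq_single k.inv]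
  · have h1 : k.1 * k.inv.1 = 1 := mul_inv_cancel k.1
    rw [map_smul, hc.elt (cls_sigmaLift hg k.1 k.inv.1), sigmaLift_of_mul_eq_one k.2 h1, h1,
      mul_one, one_mul, map_smul]
    have h2 : ∀ {M : Type} [AddCommMonoid M] [Module ℂ M] (a b c : ℂ) (x : M),
        a • b • c • x = (c * a * b) • x := fun a b c x => by
      rw [smul_smul, smul_smul, mul_comm c a, mul_assoc, mul_assoc, mul_comm c b]
    exact h2 (M := (cusp g pts hpts).Total) _ _ _ _
  · intro l _ hl
    have h1 : k.1 * l.1 ≠ 1 := fun h => hl (Subtype.ext (inv_eq_of_mul_eq_one_right h).symm)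
    rw [map_smul, hc.elt (cls_sigmaLift hg k.1 l.1), sigmaLift_of_mul_ne_one k.2 l.2 h1, mul_zero,
      map_zero]
    exact smul_zero (M := ℂ) (A := (cusp g pts hpts).Total) _
  · exact fun h => absurd (Finset.mem_univ _) h

theorem cup_invariantElt (hg : 2 ≤ g) (hc : (cusp g pts hpts).IsAlgebra cup)
    (p q : ℂ × (Twist hpts → ℂ) × ℂ) : cup (invariantElt hpts p) (invariantElt hpts q) =
      invariantElt hpts (p.1 * q.1, p.1 • q.2.1 + q.1 • p.2.1,
        p.1 * q.2.2 + q.1 * p.2.2 + twistForm hpts p.2.1 q.2.1) :=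
  cup_triple (twistForm hpts) hc.unit_left hc.unit_right (cup_phi_phi hg hc.isCup)
    (cup_phi_twisted hg hc.isCup) (cup_twisted_phi hg hc.isCup)
    (cup_twisted_twisted hg hc.isCup) p q

theorem invariantElt_apply (p : ℂ × (Twist hpts → ℂ) × ℂ) : invariantElt hpts p =
    p.1 • (cusp g pts hpts).elt 1 1 + ((∑ k : Twist hpts, p.2.1 k • (cusp g pts hpts).elt k.1 1) +
      p.2.2 • (cusp g pts hpts).elt 1 (phi hpts)) := by
  rw [invariantElt, triple_apply, twisted_apply, Orbifold.unit_eq]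

theorem coeffAt_one_invariantElt (p : ℂ × (Twist hpts → ℂ) × ℂ) :
    (cusp g pts hpts).coeffAt 1 (invariantElt hpts p) =
      (cusp g pts hpts).cls (1 : (cusp g pts hpts).G) (p.1 • 1 + p.2.2 • phi hpts) := by
  rw [invariantElt_apply, map_add, map_add, map_sum, Finset.sum_eq_zero, zero_add, map_smul,
    map_smul, Orbifold.coeffAt_elt_self, Orbifold.coeffAt_elt_self, map_add, map_smul, map_smul]
  intro k _
  rw [map_smul, Orbifold.coeffAt_elt_of_ne k.2, smul_zero]

theorem coeffAt_invariantElt (p : ℂ × (Twist hpts → ℂ) × ℂ) (k : Twist hpts) :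
    (cusp g pts hpts).coeffAt k.1 (invariantElt hpts p) =
      (cusp g pts hpts).cls k.1 (p.2.1 k • 1) := by
  rw [invariantElt_apply, map_add, map_add, map_sum, Finset.sum_eq_single k, map_smul, map_smul,
    map_smul, Orbifold.coeffAt_elt_self, Orbifold.coeffAt_elt_of_ne (Ne.symm k.2),
    Orbifold.coeffAt_elt_of_ne (Ne.symm k.2), map_smul]
  · simp
  · intro l _ hl
    rw [map_smul, Orbifold.coeffAt_elt_of_ne (fun h => hl (Subtype.ext h)), smul_zero]
  · exact fun h => absurd (Finset.mem_univ _) h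

theorem cls_smul_one_eq_zero_iff (k : Twist hpts) (c : ℂ) :
    (cusp g pts hpts).cls k.1 (c • 1) = 0 ↔ c = 0 := by
  rw [Orbifold.cls_eq_zero_iff]
  rw [milnorIdeal_of_ne_one hpts k.2, RingHom.mem_ker, map_smul, map_one, smul_eq_mul, mul_one]

theorem cls_one_eq_zero_iff (hg : 2 ≤ g) (a b : ℂ) :
    (cusp g pts hpts).cls (1 : (cusp g pts hpts).G) (a • 1 + b • phi hpts) = 0 ↔
      a = 0 ∧ b = 0 := by
  constructor
  · intro h
    have h1 := milnorIdeal_le_ker hpts hg rfl ((Orbifold.cls_eq_zero_iff _ _ _).1 h)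
    have h2 : (cusp g pts hpts).evalZero (phi hpts) = 0 := by
      rw [phi, Orbifold.evalZero_algebraMap]
      simp
    rw [RingHom.mem_ker, map_add, map_smul, map_smul, h2, map_one, smul_zero, add_zero,
      smul_eq_mul, mul_one] at h1
    refine ⟨h1, ?_⟩
    by_contra hb
    subst h1
    rw [zero_smul, zero_add, map_smul, smul_eq_zero_iff_right hb] at h
    exact polyCls_phi_ne_zero hpts hg rfl h
  · rintro ⟨rfl, rfl⟩
    rw [zero_smul, zero_smul, add_zero, map_zero]

theorem codim_of_ne_one {k : (cusp g pts hpts).G} (hk : k ≠ 1) :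
    codim (k : Fin 3 → ℂˣ) = 3 := by
  rw [codim, movedIdx_of_mem k.2 fun h => hk (Subtype.ext h)]
  rfl

theorem invariantElt_mem_even_iff (p : ℂ × (Twist hpts → ℂ) × ℂ) :
    invariantElt hpts p ∈ (cusp g pts hpts).even ↔ p.2.1 = 0 := by
  rw [Orbifold.mem_even_iff]
  constructor
  · intro h
    ext1 k
    have h1 := h k.1 (by rw [codim_of_ne_one k.2]; decide)
    rwa [coeffAt_invariantElt, cls_smul_one_eq_zero_iff] at h1
  · intro h k hk
    have hk1 : k ≠ 1 := by
      rintro rfl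
      exact hk (by rw [OneMemClass.coe_one, codim_one]; exact Even.zero)
    have h1 := coeffAt_invariantElt (hpts := hpts) p ⟨k, hk1⟩
    rw [h, Pi.zero_apply] at h1
    exact h1.trans ((cls_smul_one_eq_zero_iff ⟨k, hk1⟩ 0).2 rfl)

theorem invariantElt_mem_odd_iff (hg : 2 ≤ g) (p : ℂ × (Twist hpts → ℂ) × ℂ) :
    invariantElt hpts p ∈ (cusp g pts hpts).odd ↔ p.1 = 0 ∧ p.2.2 = 0 := by
  rw [Orbifold.mem_odd_iff, ← cls_one_eq_zero_iff (hpts := hpts) hg, ← coeffAt_one_invariantElt]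
  constructor
  · intro h
    exact h 1 (by rw [OneMemClass.coe_one, codim_one]; exact Even.zero)
  · intro h k hk
    have hk1 : k = 1 := by
      by_contra hk1
      rw [codim_of_ne_one hk1] at hk
      exact absurd hk (by decide)
    rw [hk1, h]

theorem invariantElt_injective (hg : 2 ≤ g) : Function.Injective (invariantElt hpts) := by
  refine (injective_iff_map_eq_zero (invariantElt hpts).toAddMonoidHom).2
    fun p (hp : invariantElt hpts p = 0) => ?_
  have h1 := (invariantElt_mem_even_iff (hpts := hpts) p).1 (hp ▸ Submodule.zero_mem _)
  have h2 := (invariantElt_mem_odd_iff (hpts := hpts) hg p).1 (hp ▸ Submodule.zero_mem _)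
  exact Prod.ext h2.1 (Prod.ext h1 h2.2)

theorem invariantElt_mem_invariants (p : ℂ × (Twist hpts → ℂ) × ℂ) :
    invariantElt hpts p ∈ (cusp g pts hpts).invariants := by
  rw [Orbifold.invariants, Submodule.mem_iInf]
  intro k
  have h : (cusp g pts hpts).actReg k (phi hpts) = phi hpts := by
    rw [phi, Orbifold.actReg_algebraMap, rescale_phi k.2]
  have h1 : ∀ l f, (cusp g pts hpts).act k ((cusp g pts hpts).elt l f) =
      (cusp g pts hpts).elt l ((cusp g pts hpts).actReg k f) := fun l f =>
    (cusp g pts hpts).act_elt_of_prod_eq_one (prod_movedIdx_inv k l) f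
  rw [LinearMap.mem_eqLocus, LinearMap.id_apply, invariantElt_apply]
  simp only [map_add, map_sum, map_smul, h1, h, map_one]

/-- Every invariant is of the form `a ξ_e + ∑ₖ uₖ ξ_k + b φ ξ_e`. -/
theorem exists_invariantElt_eq (hg : 2 ≤ g) {x : (cusp g pts hpts).Total}
    (hx : x ∈ (cusp g pts hpts).invariants) : ∃ p, invariantElt hpts p = x := by
  rw [Orbifold.invariants, Submodule.mem_iInf] at hx
  have h1 := mem_span_of_invariant hpts hg (e := ((1 : (cusp g pts hpts).G) : Fin 3 → ℂˣ)) rfl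
    ((cusp g pts hpts).coeffAt 1 x) fun k => by
      have h2 := congrArg ((cusp g pts hpts).coeffAt 1) (LinearMap.mem_eqLocus.1 (hx k))
      rw [Orbifold.coeffAt_act, prod_movedIdx_inv] at h2
      exact (one_smul ℂ _).symm.trans h2
  obtain ⟨a, b, hab⟩ := Submodule.mem_span_pair.1 h1
  have h2 : ∀ k : Twist hpts, ∃ c : ℂ, (cusp g pts hpts).coeffAt k.1 x =
      (cusp g pts hpts).cls k.1 (c • 1) := by
    intro k
    obtain ⟨r, hr⟩ := (cusp g pts hpts).cls_surjective k.1 ((cusp g pts hpts).coeffAt k.1 x)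
    refine ⟨(cusp g pts hpts).evalZero r, ?_⟩
    refine hr.symm.trans ?_
    rw [← sub_eq_zero, ← map_sub, Orbifold.cls_eq_zero_iff]
    rw [milnorIdeal_of_ne_one hpts k.2, RingHom.mem_ker, map_sub, map_smul, map_one, smul_eq_mul,
      mul_one, sub_self]
  choose u hu using h2
  refine ⟨(a, u, b), Orbifold.ext_coeffAt fun k => ?_⟩
  by_cases hk : k = 1
  · subst hk
    rw [coeffAt_one_invariantElt, ← hab, map_add, map_smul, map_smul, map_one]
    rfl
  · exact (coeffAt_invariantElt (a, u, b) ⟨k, hk⟩).trans (hu ⟨k, hk⟩).symm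

end Cusp

end LG

/-! ### The isomorphism -/

namespace LG

section Cusp

variable {g : ℕ} {pts : Fin 3 → Finset ℂ} {hpts : IsSuitable g pts}
  {cup : (cusp g pts hpts).Total →ₗ[ℂ] (cusp g pts hpts).Total →ₗ[ℂ] (cusp g pts hpts).Total}

/-- The invariants and the cohomology of the surface are both of the form `ℂ ⊕ V ⊕ ℂ` with the
product of `V` given by a symplectic form, with the same `V`. -/
theorem exists_gradedAlgIso (hg : 2 ≤ g) (hc : (cusp g pts hpts).IsAlgebra cup) (S : Complex₂)
    {o : S.T → ℤˣ} (hS : S.IsClosedSurface) (ho : S.IsOrientation o) (hgenus : S.HasGenus g) :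
    ∃ Φ : (cusp g pts hpts).invariants ≃ₗ[ℂ] S.Cohomology,
      S.IsGradedAlgIso (cusp g pts hpts) cup Φ := by
  obtain ⟨Θ, hmul, hone, heven, hodd⟩ := Complex₂.exists_cohomology_equiv hS ho hgenus
    (twistForm hpts) twistForm_isAlt eq_zero_of_twistForm (finrank_twist hpts)
  let Ψ : (ℂ × (Twist hpts → ℂ) × ℂ) ≃ₗ[ℂ] (cusp g pts hpts).invariants :=
    LinearEquiv.ofBijective ((invariantElt hpts).codRestrict _ invariantElt_mem_invariants)
      ⟨fun p q h => invariantElt_injective hg (congrArg Subtype.val h), fun x => by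
        obtain ⟨p, hp⟩ := exists_invariantElt_eq hg x.2
        exact ⟨p, Subtype.ext hp⟩⟩
  have hΨ : ∀ p, (Ψ p : (cusp g pts hpts).Total) = invariantElt hpts p := fun _ => rfl
  have hΦ : ∀ p, (Ψ.symm.trans Θ) (Ψ p) = Θ p := fun p => by
    rw [LinearEquiv.trans_apply, LinearEquiv.symm_apply_apply]
  refine ⟨Ψ.symm.trans Θ, ?_, ?_, ?_, ?_⟩
  · intro x y z hz
    obtain ⟨p, rfl⟩ := Ψ.surjective x
    obtain ⟨q, rfl⟩ := Ψ.surjective y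
    have h : z = Ψ (p.1 * q.1, p.1 • q.2.1 + q.1 • p.2.1,
        p.1 * q.2.2 + q.1 * p.2.2 + twistForm hpts p.2.1 q.2.1) := by
      apply Subtype.ext
      rw [hz, hΨ, hΨ, hΨ, cup_invariantElt hg hc]
    rw [h, hΦ, hΦ, hΦ, hmul]
  · intro u hu
    have h : u = Ψ (1, 0, 0) := by
      apply Subtype.ext
      rw [hu, hΨ, invariantElt, triple_apply, map_zero]
      have h2 : ∀ {M : Type} [AddCommMonoid M] [Module ℂ M] (x y : M),
          x = (1 : ℂ) • x + (0 + (0 : ℂ) • y) := fun x y => by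
        rw [one_smul, zero_smul, add_zero, add_zero]
      exact h2 (M := (cusp g pts hpts).Total) _ _
    rw [h, hΦ, hone]
  · intro x
    obtain ⟨p, rfl⟩ := Ψ.surjective x
    rw [hΦ, heven, hΨ, invariantElt_mem_even_iff]
  · intro x
    obtain ⟨p, rfl⟩ := Ψ.surjective x
    rw [hΦ, hodd, hΨ, invariantElt_mem_odd_iff hg]

end Cusp

/-! ### Existence of suitable sets -/

theorem mem_redundantPoints_iff (g : ℕ) (p : Fin 3 → ℂ) : p ∈ redundantPoints g ↔ p ≠ 0 ∧
    (2 * g + 1) * p 0 ^ (2 * g) = p 1 * p 2 ∧ (2 * g + 1) * p 1 ^ (2 * g) = p 0 * p 2 ∧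
    (2 * g + 1) * p 2 ^ (2 * g) = p 0 * p 1 := by
  have h : (∀ i, MvPolynomial.eval p (MvPolynomial.pderiv i (cuspW g)) = 0) ↔
      (2 * g + 1) * p 0 ^ (2 * g) = p 1 * p 2 ∧ (2 * g + 1) * p 1 ^ (2 * g) = p 0 * p 2 ∧
      (2 * g + 1) * p 2 ^ (2 * g) = p 0 * p 1 := by
    rw [Fin.forall_fin_succ, Fin.forall_fin_two]
    have e1 : (Fin.succ 0 : Fin 3) = 1 := rfl
    have e2 : (Fin.succ 1 : Fin 3) = 2 := rfl
    rw [e1, e2, pderiv_cuspW_zero, pderiv_cuspW_one, pderiv_cuspW_two]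
    simp [sub_eq_zero, MvPolynomial.smul_eval]
  rw [redundantPoints, Set.mem_ofPred_eq, h]

/-- The coordinates of a critical point other than the origin satisfy an algebraic equation with
finitely many solutions. -/
theorem coord_pow_eq {g : ℕ} (hg : 2 ≤ g) {p : Fin 3 → ℂ} (hp : p ∈ redundantPoints g)
    (i : Fin 3) : ((2 * g + 1) ^ 3) * ((2 * g + 1) * p i ^ (2 * g + 1)) ^ (2 * g - 2) = 1 := by
  obtain ⟨hp0, h0, h1, h2⟩ := (mem_redundantPoints_iff g p).1 hp
  have hn := two_mul_add_one_ne_zero g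
  have hk : 2 * g = 2 + (2 * g - 2) := by omega
  have hcases : i = 0 ∨ i = 1 ∨ i = 2 := by fin_cases i <;> simp
  set P := p 0 * p 1 * p 2 with hP
  have e0 : (2 * g + 1) * p 0 ^ (2 * g + 1) = P := by rw [pow_succ, ← mul_assoc, h0, hP]; ring
  have e1 : (2 * g + 1) * p 1 ^ (2 * g + 1) = P := by rw [pow_succ, ← mul_assoc, h1, hP]; ring
  have e2 : (2 * g + 1) * p 2 ^ (2 * g + 1) = P := by rw [pow_succ, ← mul_assoc, h2]
  have hP0 : P ≠ 0 := by
    intro h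
    rw [h] at e0 e1 e2
    refine hp0 (funext fun i => ?_)
    have hcases : i = 0 ∨ i = 1 ∨ i = 2 := by fin_cases i <;> simp
    rcases hcases with rfl | rfl | rfl
    · exact pow_eq_zero_iff (by omega) |>.1 ((mul_eq_zero.1 e0).resolve_left hn)
    · exact pow_eq_zero_iff (by omega) |>.1 ((mul_eq_zero.1 e1).resolve_left hn)
    · exact pow_eq_zero_iff (by omega) |>.1 ((mul_eq_zero.1 e2).resolve_left hn)
  -- the product of the three equations
  have h3 : ((2 * g + 1 : ℂ) ^ 3 * P ^ (2 * g - 2)) * P ^ 2 = 1 * P ^ 2 := by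
    have : (2 * g + 1 : ℂ) ^ 3 * P ^ (2 * g) = P ^ 2 := by
      calc (2 * g + 1 : ℂ) ^ 3 * P ^ (2 * g) = ((2 * g + 1) * p 0 ^ (2 * g)) *
            ((2 * g + 1) * p 1 ^ (2 * g)) * ((2 * g + 1) * p 2 ^ (2 * g)) := by
            rw [hP, mul_pow, mul_pow]; ring
        _ = P ^ 2 := by rw [h0, h1, h2, hP]; ring
    rw [one_mul, mul_assoc, ← pow_add, ← this]
    congr 2
    omega
  have h4 := mul_right_cancel₀ (pow_ne_zero 2 hP0) h3
  rcases hcases with rfl | rfl | rfl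
  · rw [e0, h4]
  · rw [e1, h4]
  · rw [e2, h4]

/-- The group permutes the critical points. -/
theorem smul_mem_redundantPoints {g : ℕ} {p : Fin 3 → ℂ} (hp : p ∈ redundantPoints g)
    {h : Fin 3 → ℂˣ} (hh : h ∈ cuspGroup g) : (fun i => (h i : ℂ) * p i) ∈ redundantPoints g := by
  refine ⟨fun h0 => hp.1 (funext fun i => ?_), fun i => ?_⟩
  · exact (mul_eq_zero.1 (congrFun h0 i)).resolve_left (Units.ne_zero _)
  · have h1 := congrArg (MvPolynomial.eval p) (pderiv_rescale h i (cuspW g))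
    rw [cuspW_invariant g h hh, hp.2 i, map_mul, MvPolynomial.eval_C] at h1
    have h2 := ((mul_eq_zero.1 h1.symm).resolve_left (Units.ne_zero _))
    have h3 : ∀ f : MvPolynomial (Fin 3) ℂ, MvPolynomial.eval p (rescale h f) =
        MvPolynomial.eval (fun i => (h i : ℂ) * p i) f := by
      intro f
      induction f using MvPolynomial.induction_on with
      | C a => simp [rescale]
      | add a b ha hb => rw [map_add, map_add, ha, hb, map_add]
      | mul_X f j hf => rw [map_mul, map_mul, map_mul, hf]; simp [rescale]
    rwa [h3] at h2

theorem exists_isSuitable {g : ℕ} (hg : 2 ≤ g) : ∃ pts : Fin 3 → Finset ℂ,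
    (∀ i, (pts i : Set ℂ) = {c | c ≠ 0 ∧ ∃ p ∈ redundantPoints g, p i = c}) ∧
      IsSuitable g pts := by
  have hfin : ∀ i : Fin 3, {c : ℂ | c ≠ 0 ∧ ∃ p ∈ redundantPoints g, p i = c}.Finite := by
    intro i
    set f : Polynomial ℂ := .C ((2 * g + 1) ^ 3) *
      (.C (2 * g + 1) * .X ^ (2 * g + 1)) ^ (2 * g - 2) - 1 with hf
    have hf0 : f ≠ 0 := by
      intro h
      have h1 := congrArg (Polynomial.eval 0) h
      have h2 : 2 * g - 2 ≠ 0 := by omega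
      rw [hf] at h1
      simp [h2] at h1
    refine (f.roots.toFinset.finite_toSet).subset ?_
    rintro _ ⟨-, p, hp, rfl⟩
    rw [Finset.mem_coe, Multiset.mem_toFinset, Polynomial.mem_roots hf0, Polynomial.IsRoot, hf]
    have := coord_pow_eq hg hp i
    simp only [Polynomial.eval_sub, Polynomial.eval_mul, Polynomial.eval_pow, Polynomial.eval_C,
      Polynomial.eval_X, Polynomial.eval_one]
    rw [this, sub_self]
  have hmem : ∀ i c, c ∈ (hfin i).toFinset ↔ c ≠ 0 ∧ ∃ p ∈ redundantPoints g, p i = c :=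
    fun i c => (hfin i).mem_toFinset
  refine ⟨fun i => (hfin i).toFinset, fun i => (hfin i).coe_toFinset, ?_, ?_, ?_⟩
  · exact fun i c hc => ((hmem i c).1 hc).1
  · intro h hh i c hc
    obtain ⟨hc0, p, hp, rfl⟩ := (hmem i c).1 hc
    exact (hmem _ _).2 ⟨mul_ne_zero (Units.ne_zero _) hc0, _, smul_mem_redundantPoints hp hh, rfl⟩
  · intro p hp
    obtain ⟨i, hi⟩ := Function.ne_iff.1 hp.1
    exact ⟨i, (hmem _ _).2 ⟨hi, p, hp, rfl⟩⟩

end LG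

end

theorem mainTheorem6 (g : ℕ) (hg : 2 ≤ g) :
    (∃ pts : Fin 3 → Finset ℂ,
      (∀ i, (pts i : Set ℂ) = {c | c ≠ 0 ∧ ∃ p ∈ LG.redundantPoints g, p i = c}) ∧
      LG.IsSuitable g pts) ∧
    ∀ (pts : Fin 3 → Finset ℂ) (hpts : LG.IsSuitable g pts),
      (∀ ζ : ℂˣ, ζ ^ (2 * g + 1) = 1 → ζ ≠ 1 →
        (1 - (ζ : ℂ)) ^ 2 * (1 - (ζ : ℂ)⁻¹ ^ 2) ≠ 0 ∧
        (LG.cusp g pts hpts).sigma (LG.cuspHom ζ) (LG.cuspHom ζ)⁻¹ =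
          (-((1 - (ζ : ℂ)) ^ 2 * (1 - (ζ : ℂ)⁻¹ ^ 2))⁻¹) •
            (LG.cusp g pts hpts).polyCls (LG.cuspHom ζ * (LG.cuspHom ζ)⁻¹)
              (MvPolynomial.X 0 * MvPolynomial.X 1 * MvPolynomial.X 2)) ∧
      (LG.cusp g pts hpts).polyCls 1
        (MvPolynomial.X 0 * MvPolynomial.X 1 * MvPolynomial.X 2) ≠ 0 ∧
      ∃ cup : (LG.cusp g pts hpts).Total →ₗ[ℂ]
          (LG.cusp g pts hpts).Total →ₗ[ℂ] (LG.cusp g pts hpts).Total,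
        (LG.cusp g pts hpts).IsAlgebra cup ∧
        (∀ cup', (LG.cusp g pts hpts).IsCup cup' → cup' = cup) ∧
        ∀ (S : LG.Complex₂) (o : S.T → ℤˣ),
          S.IsClosedSurface → S.IsOrientation o → S.HasGenus g →
          ∃ Φ : (LG.cusp g pts hpts).invariants ≃ₗ[ℂ] S.Cohomology,
            S.IsGradedAlgIso (LG.cusp g pts hpts) cup Φ := by
  refine ⟨LG.exists_isSuitable hg, fun pts hpts => ⟨fun ζ hζ h1 => ⟨?_, ?_⟩, ?_, ?_⟩⟩
  · exact mul_ne_zero (pow_ne_zero _ (LG.one_sub_ne_zero h1)) (LG.one_sub_inv_sq_ne_zero hζ h1)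
  · exact LG.sigma_cusp_inv hpts hg hζ h1
  · exact LG.polyCls_phi_ne_zero hpts hg rfl
  · obtain ⟨cup, hc⟩ := LG.exists_cusp_isAlgebra (hpts := hpts) hg
    exact ⟨cup, hc, fun _ hc' => hc.isCup.unique hc',
      fun S _ hS ho hgenus => LG.exists_gradedAlgIso hg hc S hS ho hgenus⟩
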